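/- Let $B$ be a $C^*$-algebra and $A\subseteq B$ a regular $C^*$-subalgebra: $AB=B$ (closed linear span of products), and $B$ is generated as a $C^*$-algebra by the set $N(A)=\{b\in B: bAb^*\subseteq A,\ b^*Ab\subseteq A\}$ of normalisers. Write $\mathbb I(A)$, $\mathbb I(B)$ for the lattices of closed two-sided ideals, $\check A$, $\check B$ for the primitive ideal spaces with the hull-kernel topology, $r(J)=J\cap A$ for $J\in\mathbb I(B)$, $i(I)=\overline{\operatorname{span}}\,BIB$ for $I\in\mathbb I(A)$. Ideals of the form $r(J)$ are called restricted, those of the form $i(I)$ induced, and $A$ separates ideals in $B$ if $r$ is injective. Let $\mathrm{Prime}^B(A)$ be the space of prime elements $P$ of the lattice $\mathbb I^B(A)$ of restricted ideals ($P\ne A$, and $I_1\cap I_2\subseteq P$ implies $I_1\subseteq P$ or $I_2\subseteq P$ for restricted $I_1,I_2$), with open sets $\{P: I\not\subseteq P\}$ for $I\in\mathbb I^B(A)$. A slice is a closed linear subspace $M\subseteq N(A)$ with $AM\subseteq M$ and $MA\subseteq M$; slices form an inverse semigroup $\mathcal S(A)$ under closed spans of products, adjoints, and inclusion as the order. A slice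 $M$ defines a partial homeomorphism $\check M$ of $\check A$ with domain $\check D_M=\{\mathfrak p: M^*M\not\subseteq\mathfrak p\}$ by the Rieffel correspondence, $\check M(\mathfrak p)=\{a\in A: M^*aM\subseteq\mathfrak p\}$. Let $G=\check A\rtimes\mathcal S(A)$ be the dual groupoid, that is, the groupoid of germs $[M,\mathfrak p]$, $\mathfrak p\in\check D_M$, with source $\mathfrak p$ and range $\check M(\mathfrak p)$; here $[M,\mathfrak p]=[M',\mathfrak p]$ if there is a slice $V\subseteq M\cap M'$ with $\mathfrak p\in\check D_V$. Let $G\cdot\mathfrak p$ be the set of ranges of arrows with source $\mathfrak p$. The quasi-orbit space of $A\subseteq B$ exists if joins in $\mathbb I(A)$ of restricted ideals are restricted. Then $\pi\colon\check A\to\mathrm{Prime}^B(A)$ sends $\mathfrak p$ to the largest restricted ideal contained in $\mathfrak p$, and the quasi-orbit space is $\check A/{\sim}$ with the quotient topology, where $\mathfrak p_1\sim\mathfrak p_2$ if and only if $\pi(\mathfrak p_1)=\pi(\mathfrak p_2)$. If $\mathrm{Prime}^B(A)$ is first countable, the quasi-orbit map is said to exist if, in addition, $I\cap r(i(J))=r(i(I\cap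 J))$ for all $I\in\mathbb I^B(A)$, $J\in\mathbb I(A)$, and finite meets of induced ideals are induced. **Theorem.** Let $A\subseteq B$ be a regular inclusion with dual groupoid $G$. The quasi-orbit space $\check A/{\sim}$ of $A\subseteq B$ exists and coincides with the quasi-orbit space of $G$: for $\mathfrak p_1,\mathfrak p_2\in\check A$, $$\mathfrak p_1\sim\mathfrak p_2\iff\overline{G\cdot\mathfrak p_1}=\overline{G\cdot\mathfrak p_2}.$$ If $\check A$ is second countable, then $\mathrm{Prime}^B(A)$ is first countable. If $\mathrm{Prime}^B(A)$ is first countable, then the quasi-orbit map exists: 1. The map $\pi\colon\check A\to\mathrm{Prime}^B(A)$ is a continuous, open surjection, $\pi(\mathfrak p)=\bigcap_{\mathfrak p'\in\overline{G\cdot\mathfrak p}}\mathfrak p'$ for all $\mathfrak p\in\check A$, and $\pi$ descends to a homeomorphism $\widetilde\pi\colon\check A/{\sim}\to\mathrm{Prime}^B(A)$. 2. There is a continuous map $\varrho\colon\check B\to\check A/{\sim}$, $\mathfrak p\mapsto\widetilde\pi^{-1}(r(\mathfrak p))$. It is a homeomorphism $\check B\cong\check A/{\sim}$ if and only if $A$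 separates ideals in $B$. -/

import Mathlib

open Topology Filter

universe u

noncomputable section

namespace CStarIncl

/-! ### Closed two-sided ideals -/

section Ideals

variable (A : Type u) [NonUnitalNormedRing A] [NormedSpace ℂ A]

/-- The closed two-sided ideals of `A`, ordered by inclusion. -/
structure ClosedIdeal extends Submodule ℂ A where
  isClosed' : IsClosed carrier
  mul_mem_left' : ∀ (a : A) {x : A}, x ∈ carrier → a * x ∈ carrier
  mul_mem_right' : ∀ (a : A) {x : A}, x ∈ carrier → x * a ∈ carrier

variable {A}

namespace ClosedIdeal

instance : SetLike (ClosedIdeal A) A where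
  coe I := I.carrier
  coe_injective I J h := by
    obtain ⟨I, _, _, _⟩ := I
    obtain ⟨J, _, _, _⟩ := J
    have : I = J := SetLike.coe_injective h
    subst this
    rfl

instance : PartialOrder (ClosedIdeal A) := .ofSetLike (ClosedIdeal A) A

instance : AddSubgroupClass (ClosedIdeal A) A where
  add_mem {I} _ _ ha hb := I.add_mem' ha hb
  zero_mem I := I.zero_mem'
  neg_mem {I} _ ha := I.toSubmodule.neg_mem ha

instance : SMulMemClass (ClosedIdeal A) ℂ A where
  smul_mem {I} c _ ha := I.smul_mem' c ha

theorem isClosed (I : ClosedIdeal A) : IsClosed (I : Set A) := I.isClosed'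

theorem mul_mem_left (I : ClosedIdeal A) (a : A) {x : A} (hx : x ∈ I) : a * x ∈ I :=
  I.mul_mem_left' a hx

theorem mul_mem_right (I : ClosedIdeal A) (a : A) {x : A} (hx : x ∈ I) : x * a ∈ I :=
  I.mul_mem_right' a hx

instance : Min (ClosedIdeal A) where
  min I J :=
    { toSubmodule := I.toSubmodule ⊓ J.toSubmodule
      isClosed' := I.isClosed.inter J.isClosed
      mul_mem_left' := fun a _ hx => ⟨I.mul_mem_left a hx.1, J.mul_mem_left a hx.2⟩
      mul_mem_right' := fun a _ hx => ⟨I.mul_mem_right a hx.1, J.mul_mem_right a hx.2⟩ }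

instance : InfSet (ClosedIdeal A) where
  sInf S :=
    { carrier := ⋂ I ∈ S, (I : Set A)
      add_mem' := fun ha hb => by
        simp only [Set.mem_iInter, SetLike.mem_coe] at *
        exact fun I hI => add_mem (ha I hI) (hb I hI)
      zero_mem' := by
        simp only [Set.mem_iInter, SetLike.mem_coe]
        exact fun I _ => zero_mem I
      smul_mem' := fun c _ ha => by
        simp only [Set.mem_iInter, SetLike.mem_coe] at *
        exact fun I hI => SMulMemClass.smul_mem c (ha I hI)
      isClosed' := isClosed_biInter fun J _ => J.isClosed
      mul_mem_left' := fun a _ ha => by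
        simp only [Set.mem_iInter, SetLike.mem_coe] at *
        exact fun I hI => I.mul_mem_left a (ha I hI)
      mul_mem_right' := fun a _ ha => by
        simp only [Set.mem_iInter, SetLike.mem_coe] at *
        exact fun I hI => I.mul_mem_right a (ha I hI) }

theorem mem_sInf {S : Set (ClosedIdeal A)} {x : A} : x ∈ sInf S ↔ ∀ I ∈ S, x ∈ I := by
  change x ∈ (⋂ I ∈ S, (I : Set A)) ↔ _
  simp

instance : Top (ClosedIdeal A) where
  top := { toSubmodule := ⊤
           isClosed' := isClosed_univ
           mul_mem_left' := fun _ _ _ => trivial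
           mul_mem_right' := fun _ _ _ => trivial }

theorem mem_top (x : A) : x ∈ (⊤ : ClosedIdeal A) := trivial

/-- The complete lattice of closed two-sided ideals: meets are intersections, and the join of a
family is the smallest closed two-sided ideal that contains it. -/
instance : CompleteLattice (ClosedIdeal A) where
  __ := completeLatticeOfInf (ClosedIdeal A) fun S =>
    ⟨fun I hI _ hx => mem_sInf.1 hx I hI, fun _ hJ _ hx => mem_sInf.2 fun I hI => hJ hI hx⟩
  inf := (· ⊓ ·)
  inf_le_left _ _ _ hx := hx.1
  inf_le_right _ _ _ hx := hx.2
  le_inf _ _ _ h₁ h₂ _ hx := ⟨h₁ hx, h₂ hx⟩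
  top := ⊤
  le_top _ _ _ := trivial

theorem mem_inf {I J : ClosedIdeal A} {x : A} : x ∈ I ⊓ J ↔ x ∈ I ∧ x ∈ J := Iff.rfl

end ClosedIdeal

/-! ### Primitive ideals -/

/-- A `*`-representation on a Hilbert space is irreducible if it is nonzero and has no closed
invariant subspaces besides `0` and the whole space. -/
def IsIrreducibleRep [StarRing A] {H : Type u} [NormedAddCommGroup H] [InnerProductSpace ℂ H]
    [CompleteSpace H] (π : A →⋆ₙₐ[ℂ] (H →L[ℂ] H)) : Prop :=
  (∃ a, π a ≠ 0) ∧
    ∀ K : Submodule ℂ H, IsClosed (K : Set H) → (∀ a, ∀ x ∈ K, π a x ∈ K) → K = ⊥ ∨ K = ⊤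

/-- A primitive ideal is the kernel of an irreducible `*`-representation. -/
def ClosedIdeal.IsPrimitive [StarRing A] (p : ClosedIdeal A) : Prop :=
  ∃ (H : Type u) (_ : NormedAddCommGroup H) (_ : InnerProductSpace ℂ H) (_ : CompleteSpace H)
    (π : A →⋆ₙₐ[ℂ] (H →L[ℂ] H)), IsIrreducibleRep π ∧ ∀ a, a ∈ p ↔ π a = 0

theorem ClosedIdeal.IsPrimitive.exists_mul_mul_notMem [StarRing A] {p : ClosedIdeal A}
    (hp : p.IsPrimitive) {x y : A} (hx : x ∉ p) (hy : y ∉ p) : ∃ c : A, x * c * y ∉ p := by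
  obtain ⟨H, _, _, _, π, ⟨⟨a₀, ha₀⟩, hirr⟩, hker⟩ := hp
  rw [hker] at hx hy
  by_contra! hcon
  simp only [hker, map_mul] at hcon
  -- the vectors that are killed by every operator
  let N : Submodule ℂ H := ⨅ a : A, LinearMap.ker (π a).toLinearMap
  have memN : ∀ v, v ∈ N ↔ ∀ a, π a v = 0 := fun v => by simp [N, Submodule.mem_iInf]
  have hN : N = ⊥ := by
    have hc : IsClosed (N : Set H) := by
      have : (N : Set H) = ⋂ a : A, {v | π a v = 0} := by ext v; simp [memN]
      rw [this]
      exact isClosed_iInter fun a => isClosed_eq (π a).continuous continuous_const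
    rcases hirr N hc (fun a v hv => by rw [(memN v).1 hv a]; exact N.zero_mem) with h | h
    · exact h
    · exact absurd (ContinuousLinearMap.ext fun v => (memN v).1 (h ▸ Submodule.mem_top) a₀) ha₀
  obtain ⟨ξ, hξ⟩ : ∃ ξ, π y ξ ≠ 0 := by
    by_contra! h
    exact hy (ContinuousLinearMap.ext h)
  -- the vectors that are killed by `x c` for all `c`, and by `x`
  let K : Submodule ℂ H :=
    LinearMap.ker (π x).toLinearMap ⊓ ⨅ c : A, LinearMap.ker (π x * π c).toLinearMap
  have memK : ∀ v, v ∈ K ↔ π x v = 0 ∧ ∀ c, π x (π c v) = 0 := fun v => by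
    simp [K, Submodule.mem_iInf]
  have hK : IsClosed (K : Set H) := by
    have : (K : Set H) = {v | π x v = 0} ∩ ⋂ c : A, {v | π x (π c v) = 0} := by
      ext v; simp [memK]
    rw [this]
    exact (isClosed_eq (π x).continuous continuous_const).inter
      (isClosed_iInter fun c =>
        isClosed_eq ((π x).continuous.comp (π c).continuous) continuous_const)
  rcases hirr K hK (fun a v hv => by
      rw [memK] at hv ⊢
      refine ⟨hv.2 a, fun c => ?_⟩
      have := hv.2 (c * a)
      rwa [map_mul] at this) with h | h
  · refine hξ ?_
    have hmem : π y ξ ∈ N := by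
      rw [memN]
      intro a
      have : π a (π y ξ) ∈ K := by
        rw [memK]
        refine ⟨by simpa using congrArg (fun T : H →L[ℂ] H => T ξ) (hcon a), fun c => ?_⟩
        have := congrArg (fun T : H →L[ℂ] H => T ξ) (hcon (c * a))
        simpa using this
      rw [h] at this
      exact (Submodule.mem_bot ℂ).1 this
    rw [hN] at hmem
    exact (Submodule.mem_bot ℂ).1 hmem
  · exact hx (ContinuousLinearMap.ext fun v => ((memK v).1 (h ▸ Submodule.mem_top)).1)

theorem ClosedIdeal.IsPrimitive.exists_notMem [StarRing A] {p : ClosedIdeal A}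
    (hp : p.IsPrimitive) : ∃ x, x ∉ p := by
  obtain ⟨H, _, _, _, π, ⟨⟨a₀, ha₀⟩, _⟩, hker⟩ := hp
  exact ⟨a₀, fun h => ha₀ ((hker a₀).1 h)⟩

theorem ClosedIdeal.IsPrimitive.le_or_le [StarRing A] {p : ClosedIdeal A}
    (hp : p.IsPrimitive) {I J : ClosedIdeal A} (h : I ⊓ J ≤ p) : I ≤ p ∨ J ≤ p := by
  by_contra! hcon
  obtain ⟨x, hxI, hx⟩ := Set.not_subset.1 hcon.1
  obtain ⟨y, hyJ, hy⟩ := Set.not_subset.1 hcon.2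
  obtain ⟨c, hc⟩ := hp.exists_mul_mul_notMem hx hy
  exact hc (h ⟨I.mul_mem_right y (I.mul_mem_right c hxI), J.mul_mem_left _ hyJ⟩)

variable (A) in
/-- The primitive ideal space. -/
def PrimitiveSpectrum [StarRing A] : Type u := {p : ClosedIdeal A // p.IsPrimitive}

/-- The hull-kernel topology; its open subsets are the sets of primitive ideals that do not
contain a given closed ideal. -/
instance [StarRing A] : TopologicalSpace (PrimitiveSpectrum A) :=
  TopologicalSpace.generateFrom (Set.range fun I : ClosedIdeal A => {p | ¬ I ≤ p.1})

/-- The space of prime elements of a meet-semilattice (Mathlib's `InfPrime` excludes the top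
element). -/
def PrimeSpace (L : Type u) [SemilatticeInf L] : Type u := {p : L // InfPrime p}

/-- The topology with the sets `{p | ¬ I ≤ p}` for `I : L` as open sets. -/
instance (L : Type u) [SemilatticeInf L] : TopologicalSpace (PrimeSpace L) :=
  TopologicalSpace.generateFrom (Set.range fun I : L => {p | ¬ I ≤ p.1})

end Ideals

/-! ### Restriction and induction of ideals for an inclusion `A ⊆ B` -/

section Inclusion

variable {B : Type u} [NonUnitalCStarAlgebra B] (A : NonUnitalStarSubalgebra ℂ B)

/-- The restriction `r(J) = J ∩ A` of an ideal of `B`. -/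
def restrict (J : ClosedIdeal B) : ClosedIdeal A where
  carrier := {a | (a : B) ∈ J}
  add_mem' ha hb := add_mem (S := ClosedIdeal B) ha hb
  zero_mem' := zero_mem J
  smul_mem' c _ ha := SMulMemClass.smul_mem (S := ClosedIdeal B) c ha
  isClosed' := J.isClosed.preimage continuous_subtype_val
  mul_mem_left' a _ hx := J.mul_mem_left (a : B) hx
  mul_mem_right' a _ hx := J.mul_mem_right (a : B) hx

/-- The induced ideal `i(I)`, the closed linear span of `B I B`. -/
def induce (I : ClosedIdeal A) : ClosedIdeal B where
  toSubmodule :=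
    (Submodule.span ℂ {x : B | ∃ b₁ b₂ : B, ∃ a ∈ I, x = b₁ * (a : B) * b₂}).topologicalClosure
  isClosed' := Submodule.isClosed_topologicalClosure _
  mul_mem_left' b x hx := by
    refine map_mem_closure (continuous_const_mul b) hx fun y hy => ?_
    refine Submodule.span_induction (p := fun y _ => b * y ∈ Submodule.span ℂ _) ?_ ?_ ?_ ?_ hy
    · rintro _ ⟨b₁, b₂, a, ha, rfl⟩
      exact Submodule.subset_span ⟨b * b₁, b₂, a, ha, by simp only [mul_assoc]⟩
    · simp
    · intro y z _ _ hy hz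
      rw [mul_add]; exact add_mem hy hz
    · intro c y _ hy
      rw [mul_smul_comm]; exact Submodule.smul_mem _ c hy
  mul_mem_right' b x hx := by
    refine map_mem_closure (f := fun y => y * b) (continuous_mul_const b) hx fun y hy => ?_
    refine Submodule.span_induction (p := fun y _ => y * b ∈ Submodule.span ℂ _) ?_ ?_ ?_ ?_ hy
    · rintro _ ⟨b₁, b₂, a, ha, rfl⟩
      exact Submodule.subset_span ⟨b₁, b₂ * b, a, ha, by simp only [mul_assoc]⟩
    · simp
    · intro y z _ _ hy hz
      rw [add_mul]; exact add_mem hy hz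
    · intro c y _ hy
      rw [smul_mul_assoc]; exact Submodule.smul_mem _ c hy

def IsRestricted (I : ClosedIdeal A) : Prop := ∃ J : ClosedIdeal B, restrict A J = I

def IsInduced (J : ClosedIdeal B) : Prop := ∃ I : ClosedIdeal A, induce A I = J

/-- `A` separates ideals in `B`. -/
def SeparatesIdeals : Prop := Function.Injective (restrict A)

/-- The restricted ideals, ordered by inclusion. -/
def RestrictedIdeal : Type u := {I : ClosedIdeal A // IsRestricted A I}

instance : SemilatticeInf (RestrictedIdeal A) :=
  Subtype.semilatticeInf fun {I I'} hI hI' => by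
    obtain ⟨J, rfl⟩ := hI
    obtain ⟨J', rfl⟩ := hI'
    exact ⟨J ⊓ J', rfl⟩

/-- The space of prime elements of the lattice of restricted ideals. -/
abbrev RestrictedPrime : Type u := PrimeSpace (RestrictedIdeal A)

/-! ### The quasi-orbit space -/

/-- The condition for the quasi-orbit space to exist: joins (formed in the lattice of all closed
ideals) of restricted ideals are restricted. -/
def QuasiOrbitSpaceExists : Prop :=
  ∀ S : Set (ClosedIdeal A), (∀ I ∈ S, IsRestricted A I) → IsRestricted A (sSup S)

variable {A}

/-- `π(p)` is the largest restricted ideal contained in the primitive ideal `p`. -/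
def quasiOrbitProj (h : QuasiOrbitSpaceExists A) (p : PrimitiveSpectrum A) : RestrictedPrime A :=
  ⟨⟨sSup {I | IsRestricted A I ∧ I ≤ p.1}, h _ fun _ hI => hI.1⟩, by
    have hle : sSup {I | IsRestricted A I ∧ I ≤ p.1} ≤ p.1 := sSup_le fun _ hI => hI.2
    refine ⟨fun hmax => ?_, fun I J hIJ => ?_⟩
    · obtain ⟨x, hx⟩ := p.2.exists_notMem
      have htop : IsRestricted A (⊤ : ClosedIdeal A) := ⟨⊤, rfl⟩
      have h1 : (⟨⊤, htop⟩ : RestrictedIdeal A) ≤ _ :=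
        hmax (b := ⟨⊤, htop⟩) (le_top (α := ClosedIdeal A))
      exact hx (hle (h1 (ClosedIdeal.mem_top x)))
    · have hIJ' : I.1 ⊓ J.1 ≤ p.1 := le_trans hIJ hle
      exact (p.2.le_or_le hIJ').imp (fun hI => le_sSup (α := ClosedIdeal A) ⟨I.2, hI⟩)
        (fun hJ => le_sSup (α := ClosedIdeal A) ⟨J.2, hJ⟩)⟩

/-- The relation `p ∼ q` if and only if `π(p) = π(q)`. -/
def quasiOrbitRel (h : QuasiOrbitSpaceExists A) : Setoid (PrimitiveSpectrum A) :=
  Setoid.ker (quasiOrbitProj h)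

/-- The quasi-orbit space, with the quotient topology. -/
abbrev QuasiOrbitSpace (h : QuasiOrbitSpaceExists A) : Type u := Quotient (quasiOrbitRel h)

variable (A)

/-- The conditions that define existence of the quasi-orbit map when the space of prime restricted
ideals is first countable. -/
structure QuasiOrbitMapExists : Prop where
  /-- joins of restricted ideals remain restricted -/
  joins_restricted : QuasiOrbitSpaceExists A
  inf_restrict_induce : ∀ I J : ClosedIdeal A, IsRestricted A I →
    I ⊓ restrict A (induce A J) = restrict A (induce A (I ⊓ J))
  /-- finite meets of induced ideals are again induced -/
  meets_induced : ∀ S : Set (ClosedIdeal B), S.Finite → (∀ J ∈ S, IsInduced A J) →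
    IsInduced A (sInf S)

/-! ### Regular inclusions and slices -/

/-- The set `N(A)` of normalisers of `A` in `B`. -/
def normalisers : Set B :=
  {b | (∀ a ∈ A, b * a * star b ∈ A) ∧ ∀ a ∈ A, star b * a * b ∈ A}

/-- `A` is a C⋆-subalgebra of `B`, `A B = B` (where the left side is the closed linear span of the
products), and `B` is generated by the normalisers of `A` as a C⋆-algebra. -/
structure IsRegularInclusion : Prop where
  isClosed : IsClosed (A : Set B)
  nondegenerate : (Submodule.span ℂ {x : B | ∃ a ∈ A, ∃ b : B, x = a * b}).topologicalClosure = ⊤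
  generates : (NonUnitalStarAlgebra.adjoin ℂ (normalisers A)).topologicalClosure = ⊤

/-- Slices: closed linear subspaces `M` of `B` consisting of normalisers, with `A M ⊆ M` and
`M A ⊆ M`. -/
structure Slice extends Submodule ℂ B where
  isClosed' : IsClosed carrier
  normalises : carrier ⊆ normalisers A
  mul_mem_left' : ∀ {a m : B}, a ∈ A → m ∈ carrier → a * m ∈ carrier
  mul_mem_right' : ∀ {a m : B}, a ∈ A → m ∈ carrier → m * a ∈ carrier


variable {A}

namespace Slice

instance : SetLike (Slice A) B where
  coe M := M.carrier
  coe_injective M N h := by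
    obtain ⟨M, _, _, _, _⟩ := M
    obtain ⟨N, _, _, _, _⟩ := N
    have : M = N := SetLike.coe_injective h
    subst this
    rfl

/-- Slices are ordered by inclusion. This is the natural partial order of the inverse semigroup of
slices. -/
instance : PartialOrder (Slice A) := .ofSetLike (Slice A) B

variable {M N V : Slice A}

instance : AddSubgroupClass (Slice A) B where
  add_mem {M} _ _ ha hb := M.add_mem' ha hb
  zero_mem M := M.zero_mem'
  neg_mem {M} _ ha := M.toSubmodule.neg_mem ha

instance : SMulMemClass (Slice A) ℂ B where
  smul_mem {M} c _ ha := M.smul_mem' c ha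

theorem isClosed (M : Slice A) : IsClosed (M : Set B) := M.isClosed'

theorem left_mem {a m : B} (ha : a ∈ A) (hm : m ∈ M) : a * m ∈ M := M.mul_mem_left' ha hm

theorem right_mem {a m : B} (hm : m ∈ M) (ha : a ∈ A) : m * a ∈ M := M.mul_mem_right' ha hm

/-- The adjoint slice `M⋆`. -/
def adj (M : Slice A) : Slice A where
  carrier := {x | star x ∈ M}
  add_mem' ha hb := by
    simp only [Set.mem_ofPred_eq, star_add] at *
    exact add_mem ha hb
  zero_mem' := by
    simp only [Set.mem_ofPred_eq, star_zero]
    exact zero_mem M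
  smul_mem' c _ ha := by
    simp only [Set.mem_ofPred_eq, star_smul] at *
    exact SMulMemClass.smul_mem (star c) ha
  isClosed' := M.isClosed.preimage continuous_star
  normalises x hx := by
    have h := M.normalises hx
    exact ⟨fun a ha => by simpa using h.2 a ha, fun a ha => by simpa using h.1 a ha⟩
  mul_mem_left' ha hm := by
    simp only [Set.mem_ofPred_eq, star_mul] at *
    exact right_mem hm (star_mem ha)
  mul_mem_right' ha hm := by
    simp only [Set.mem_ofPred_eq, star_mul] at *
    exact left_mem (star_mem ha) hm

theorem mem_adj {x : B} : x ∈ M.adj ↔ star x ∈ M := Iff.rfl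

theorem star_mem_adj {x : B} (hx : x ∈ M) : star x ∈ M.adj := by simpa [mem_adj] using hx

/-- Polarisation of the normaliser condition. -/
theorem mul_mul_star_mem {m n a : B} (hm : m ∈ M) (hn : n ∈ M) (ha : a ∈ A) :
    m * a * star n ∈ A := by
  have key : ∀ x ∈ M, x * a * star x ∈ A := fun x hx => (M.normalises hx).1 a ha
  have h1 := sub_mem (sub_mem (key (m + n) (add_mem hm hn)) (key m hm)) (key n hn)
  have hIn : Complex.I • n ∈ M := SMulMemClass.smul_mem _ hn
  have h2 := sub_mem (sub_mem (key (m + Complex.I • n) (add_mem hm hIn)) (key m hm)) (key n hn)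
  have h3 := SMulMemClass.smul_mem (1 / 2 : ℂ) (add_mem h1 (SMulMemClass.smul_mem Complex.I h2))
  convert h3 using 1
  simp only [star_add, star_smul, mul_add, add_mul, smul_mul_assoc, mul_smul_comm, smul_add,
    smul_sub, smul_smul, Complex.star_def, Complex.conj_I]
  have hI : Complex.I * Complex.I = -1 := Complex.I_mul_I
  match_scalars <;> ring_nf <;> simp [Complex.I_sq] <;> norm_num

theorem star_mul_mul_mem {m n a : B} (hm : m ∈ M) (hn : n ∈ M) (ha : a ∈ A) :
    star m * a * n ∈ A := by
  have := mul_mul_star_mem (M := M.adj) (star_mem_adj hm) (star_mem_adj hn) ha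
  simpa using this

/-- The product `M · N`, the closed linear span of the products `m n`. -/
def mul (hA : IsClosed (A : Set B)) (M N : Slice A) : Slice A where
  toSubmodule :=
    (Submodule.span ℂ {x : B | ∃ m ∈ M, ∃ n ∈ N, x = m * n}).topologicalClosure
  isClosed' := Submodule.isClosed_topologicalClosure _
  normalises := by
    have h1 : ∀ x ∈ Submodule.span ℂ {x : B | ∃ m ∈ M, ∃ n ∈ N, x = m * n},
        ∀ y ∈ Submodule.span ℂ {x : B | ∃ m ∈ M, ∃ n ∈ N, x = m * n}, ∀ a ∈ A,
          x * a * star y ∈ A ∧ star x * a * y ∈ A := by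
      intro x hx y hy a ha
      induction hx, hy using Submodule.span_induction₂ with
      | mem_mem x y hx hy =>
        obtain ⟨m, hm, n, hn, rfl⟩ := hx
        obtain ⟨m', hm', n', hn', rfl⟩ := hy
        have e1 := mul_mul_star_mem hm hm' (mul_mul_star_mem hn hn' ha)
        have e2 := star_mul_mul_mem hn hn' (star_mul_mul_mem hm hm' ha)
        simp only [star_mul, mul_assoc] at *
        exact ⟨e1, e2⟩
      | zero_left y hy => simp
      | zero_right x hx => simp
      | add_left x y z _ _ _ h1 h2 =>
        simp only [star_add, add_mul]
        exact ⟨add_mem h1.1 h2.1, add_mem h1.2 h2.2⟩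
      | add_right x y z _ _ _ h1 h2 =>
        simp only [star_add, mul_add]
        exact ⟨add_mem h1.1 h2.1, add_mem h1.2 h2.2⟩
      | smul_left r x y _ _ h =>
        simp only [star_smul, smul_mul_assoc]
        exact ⟨SMulMemClass.smul_mem _ h.1, SMulMemClass.smul_mem _ h.2⟩
      | smul_right r x y _ _ h =>
        simp only [star_smul, mul_smul_comm]
        exact ⟨SMulMemClass.smul_mem _ h.1, SMulMemClass.smul_mem _ h.2⟩
    intro x hx
    refine ⟨fun a ha => ?_, fun a ha => ?_⟩
    · have := map_mem_closure (f := fun y => y * a * star y) (t := (A : Set B))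
        (by fun_prop) hx fun y hy => (h1 y hy y hy a ha).1
      rwa [hA.closure_eq] at this
    · have := map_mem_closure (f := fun y => star y * a * y) (t := (A : Set B))
        (by fun_prop) hx fun y hy => (h1 y hy y hy a ha).2
      rwa [hA.closure_eq] at this
  mul_mem_left' {a x} ha hx := by
    refine map_mem_closure (continuous_const_mul a) hx fun y hy => ?_
    refine Submodule.span_induction (p := fun y _ => a * y ∈ Submodule.span ℂ _) ?_ ?_ ?_ ?_ hy
    · rintro _ ⟨m, hm, n, hn, rfl⟩
      exact Submodule.subset_span ⟨a * m, left_mem ha hm, n, hn, by simp only [mul_assoc]⟩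
    · simp
    · intro y z _ _ hy hz
      rw [mul_add]; exact add_mem hy hz
    · intro c y _ hy
      rw [mul_smul_comm]; exact Submodule.smul_mem _ c hy
  mul_mem_right' {a x} ha hx := by
    refine map_mem_closure (f := fun y => y * a) (continuous_mul_const a) hx fun y hy => ?_
    refine Submodule.span_induction (p := fun y _ => y * a ∈ Submodule.span ℂ _) ?_ ?_ ?_ ?_ hy
    · rintro _ ⟨m, hm, n, hn, rfl⟩
      exact Submodule.subset_span ⟨m, hm, n * a, right_mem hn ha, by simp only [mul_assoc]⟩
    · simp
    · intro y z _ _ hy hz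
      rw [add_mul]; exact add_mem hy hz
    · intro c y _ hy
      rw [smul_mul_assoc]; exact Submodule.smul_mem _ c hy

theorem mul_mem_mul (hA : IsClosed (A : Set B)) {m n : B} (hm : m ∈ M) (hn : n ∈ N) :
    m * n ∈ M.mul hA N :=
  subset_closure (Submodule.subset_span ⟨m, hm, n, hn, rfl⟩)

/-- Induction principle for membership of elements of `M · N` in closed subspaces. -/
theorem mul_le (hA : IsClosed (A : Set B)) (K : Submodule ℂ B) (hK : IsClosed (K : Set B))
    (h : ∀ m ∈ M, ∀ n ∈ N, m * n ∈ K) {x : B} (hx : x ∈ M.mul hA N) : x ∈ K := by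
  refine Submodule.topologicalClosure_minimal _ (Submodule.span_le.2 ?_) hK hx
  rintro _ ⟨m, hm, n, hn, rfl⟩
  exact h m hm n hn

/-- The unit slice `A`. -/
def unit (hA : IsClosed (A : Set B)) : Slice A where
  carrier := A
  add_mem' := add_mem
  zero_mem' := zero_mem A
  smul_mem' c _ h := SMulMemClass.smul_mem c h
  isClosed' := hA
  normalises x hx := ⟨fun _ ha => mul_mem (mul_mem hx ha) (star_mem hx),
    fun _ ha => mul_mem (mul_mem (star_mem hx) ha) hx⟩
  mul_mem_left' ha hm := mul_mem ha hm
  mul_mem_right' ha hm := mul_mem hm ha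

theorem mem_unit (hA : IsClosed (A : Set B)) {x : B} : x ∈ unit hA ↔ x ∈ A := Iff.rfl

theorem _root_.CStarIncl.IsRegularInclusion.exists_approx (h : IsRegularInclusion A) (x : B)
    {ε : ℝ} (hε : 0 < ε) : ∃ e ∈ A, ‖e * x - x‖ < ε := by
  haveI : IsClosed (A : Set B) := h.isClosed
  letI : NonUnitalCStarAlgebra A := NonUnitalStarSubalgebra.nonUnitalCStarAlgebra A
  letI := CStarAlgebra.spectralOrder A
  haveI := CStarAlgebra.spectralOrderedRing A
  have hl := CStarAlgebra.increasingApproximateUnit A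
  have hx : x ∈ (Submodule.span ℂ
      {x : B | ∃ a ∈ A, ∃ b : B, x = a * b}).topologicalClosure := by
    rw [h.nondegenerate]; trivial
  obtain ⟨s, hs, hxs⟩ := Metric.mem_closure_iff.1 hx (ε / 3) (by positivity)
  have ht : Tendsto (fun e : A => (e : B) * s) (CStarAlgebra.approximateUnit A) (𝓝 s) := by
    refine Submodule.span_induction
      (p := fun s _ => Tendsto (fun e : A => (e : B) * s) _ (𝓝 s)) ?_ ?_ ?_ ?_ hs
    · rintro _ ⟨a, ha, b, rfl⟩
      have h1 := hl.tendsto_mul_right ⟨a, ha⟩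
      have h2 := ((continuous_subtype_val.tendsto _).comp h1).mul_const b
      simpa [Function.comp_def, mul_assoc] using h2
    · simp
    · intro y z _ _ hy hz
      simpa [mul_add] using hy.add hz
    · intro c y _ hy
      simpa [mul_smul_comm] using hy.const_smul c
  have hev := (Metric.tendsto_nhds.1 ht (ε / 3) (by positivity)).and hl.eventually_norm
  obtain ⟨e, he, hen⟩ := hev.exists
  refine ⟨e, e.2, ?_⟩
  rw [dist_eq_norm] at hxs he
  have hen' : ‖(e : B)‖ ≤ 1 := hen
  have hxs' : ‖s - x‖ < ε / 3 := by rwa [norm_sub_rev]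
  calc ‖(e : B) * x - x‖ = ‖(e : B) * (x - s) + ((e : B) * s - s) + (s - x)‖ := by
        congr 1; rw [mul_sub]; abel
    _ ≤ ‖(e : B) * (x - s)‖ + ‖(e : B) * s - s‖ + ‖s - x‖ := norm_add₃_le
    _ ≤ 1 * ‖x - s‖ + ‖(e : B) * s - s‖ + ‖s - x‖ := by
        gcongr
        exact (norm_mul_le _ _).trans (by gcongr)
    _ < ε := by linarith

theorem star_mul_mem (h : IsRegularInclusion A) {m n : B} (hm : m ∈ M) (hn : n ∈ M) :
    star m * n ∈ A := by
  have hcl : n ∈ closure {x : B | ∃ e ∈ A, x = e * n} := by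
    rw [Metric.mem_closure_iff]
    intro ε hε
    obtain ⟨e, he, hlt⟩ := h.exists_approx n hε
    exact ⟨e * n, ⟨e, he, rfl⟩, by rwa [dist_eq_norm, norm_sub_rev]⟩
  have := map_mem_closure (f := fun y => star m * y) (t := (A : Set B))
    (continuous_const_mul _) hcl (by
      rintro _ ⟨e, he, rfl⟩
      have := star_mul_mul_mem hm hn he
      rwa [mul_assoc] at this)
  rwa [h.isClosed.closure_eq] at this

theorem mul_star_mem (h : IsRegularInclusion A) {m n : B} (hm : m ∈ M) (hn : n ∈ M) :
    m * star n ∈ A := by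
  simpa using star_mul_mem (M := M.adj) h (star_mem_adj hm) (star_mem_adj hn)

/-- An ideal `p` of `A`, seen as a subspace of `B`. -/
def _root_.CStarIncl.ClosedIdeal.inB (p : ClosedIdeal A) : Submodule ℂ B where
  carrier := {x | ∃ a ∈ p, (a : B) = x}
  add_mem' := by
    rintro _ _ ⟨a, ha, rfl⟩ ⟨b, hb, rfl⟩
    exact ⟨a + b, add_mem ha hb, rfl⟩
  zero_mem' := ⟨0, zero_mem p, rfl⟩
  smul_mem' := by
    rintro c _ ⟨a, ha, rfl⟩
    exact ⟨c • a, SMulMemClass.smul_mem c ha, rfl⟩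

theorem coe_mem_inB {p : ClosedIdeal A} {a : A} : (a : B) ∈ p.inB ↔ a ∈ p :=
  ⟨fun ⟨_, hb, e⟩ => Subtype.ext e ▸ hb, fun ha => ⟨a, ha, rfl⟩⟩

theorem isClosed_inB (hA : IsClosed (A : Set B)) (p : ClosedIdeal A) :
    IsClosed (p.inB : Set B) := by
  have : (p.inB : Set B) = (Subtype.val : A → B) '' (p : Set A) := rfl
  rw [this]
  exact hA.isClosedEmbedding_subtypeVal.isClosedMap _ p.isClosed

theorem inB_left {p : ClosedIdeal A} {a x : B} (ha : a ∈ A) (hx : x ∈ p.inB) :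
    a * x ∈ p.inB := by
  obtain ⟨y, hy, rfl⟩ := hx
  exact ⟨⟨a, ha⟩ * y, p.mul_mem_left _ hy, rfl⟩

theorem inB_right {p : ClosedIdeal A} {a x : B} (ha : a ∈ A) (hx : x ∈ p.inB) :
    x * a ∈ p.inB := by
  obtain ⟨y, hy, rfl⟩ := hx
  exact ⟨y * ⟨a, ha⟩, p.mul_mem_right _ hy, rfl⟩

theorem prim_mul (p : PrimitiveSpectrum A) {x y : B} (hxA : x ∈ A) (hyA : y ∈ A)
    (hx : x ∉ p.1.inB) (hy : y ∉ p.1.inB) : ∃ c ∈ A, x * c * y ∉ p.1.inB := by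
  obtain ⟨c, hc⟩ := p.2.exists_mul_mul_notMem (x := ⟨x, hxA⟩) (y := ⟨y, hyA⟩)
    (fun h => hx ⟨_, h, rfl⟩) (fun h => hy ⟨_, h, rfl⟩)
  exact ⟨c, c.2, fun h => hc (coe_mem_inB.1 h)⟩

/-! ### The dual action of the slices on the primitive ideal space -/

/-- The domain of the partial homeomorphism dual to `M`: the primitive ideals that do not contain
the ideal `M⋆ · M` of `A`. -/
def domain (hA : IsClosed (A : Set B)) (M : Slice A) : Set (PrimitiveSpectrum A) :=
  {p | ¬ (M.adj.mul hA M : Set B) ⊆ p.1.inB}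

/-- The graph of the map dual to `M`, on its domain: the Rieffel correspondence of the Hilbert
bimodule `M` sends the ideal `p` to the ideal of all `a : A` with `⟨m, a n⟩ = m⋆ a n ∈ p` for all
`m`, `n` in `M`, which is the kernel of the representation induced along `M` from any
representation with kernel `p`. -/
def DualMap (M : Slice A) (p q : PrimitiveSpectrum A) : Prop :=
  ∀ a : A, a ∈ q.1 ↔ ∀ m ∈ M, ∀ n ∈ M, star m * (a : B) * n ∈ p.1.inB

section

variable {hA : IsClosed (A : Set B)} {p q r : PrimitiveSpectrum A}

theorem mem_domain : p ∈ M.domain hA ↔ ∃ m ∈ M, ∃ n ∈ M, star m * n ∉ p.1.inB := by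
  constructor
  · intro h
    by_contra! hcon
    refine h fun x hx => mul_le hA p.1.inB (isClosed_inB hA p.1) (fun m hm n hn => ?_) hx
    simpa using hcon (star m) hm n hn
  · rintro ⟨m, hm, n, hn, h⟩ hsub
    exact h (hsub (mul_mem_mul hA (star_mem_adj hm) hn))

theorem DualMap.exists (h : M.DualMap p q) {a : B} (ha : a ∈ A) (haq : a ∉ q.1.inB) :
    ∃ m ∈ M, ∃ n ∈ M, star m * a * n ∉ p.1.inB := by
  by_contra! hcon
  exact haq ⟨⟨a, ha⟩, (h _).2 hcon, rfl⟩

theorem DualMap.mem (h : M.DualMap p q) {a m n : B} (ha : a ∈ q.1.inB) (hm : m ∈ M)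
    (hn : n ∈ M) : star m * a * n ∈ p.1.inB := by
  obtain ⟨a, ha, rfl⟩ := ha
  exact (h a).1 ha m hm n hn

theorem DualMap.of_le (hreg : IsRegularInclusion A) (hle : V ≤ M) (hV : p ∈ V.domain hA)
    (h : M.DualMap p q) : V.DualMap p q := by
  refine fun a => ⟨fun ha m hm n hn => (h a).1 ha m (hle hm) n (hle hn), fun hVa => ?_⟩
  obtain ⟨v₁, hv₁, v₂, hv₂, hu⟩ := mem_domain.1 hV
  by_contra haq
  obtain ⟨m, hm, n, hn, hma⟩ := h.exists a.2 (fun h => haq (coe_mem_inB.1 h))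
  have hmaA := star_mul_mul_mem hm hn a.2
  have huA := star_mul_mem hreg hv₁ hv₂
  obtain ⟨c, hc, h1⟩ := prim_mul p huA hmaA hu hma
  obtain ⟨d, hd, h2⟩ := prim_mul p (mul_mem (mul_mem huA hc) hmaA) huA h1 hu
  -- the elements of `A` that are moved next to `v₁` and `v₂`
  have hα : v₂ * c * star m ∈ A := mul_mul_star_mem (hle hv₂) hm hc
  have hβ : n * d * star v₁ ∈ A := mul_mul_star_mem hn (hle hv₁) hd
  have := hVa _ (left_mem (star_mem hα) hv₁) _ (left_mem hβ hv₂)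
  refine h2 ?_
  simp only [star_mul, star_star, mul_assoc] at this ⊢
  exact this

theorem DualMap.comp {q : PrimitiveSpectrum A} (h : M.DualMap p q) (h' : N.DualMap q r) :
    (N.mul hA M).DualMap p r := by
  have hcl := isClosed_inB hA p.1
  intro a
  constructor
  · intro ha x hx y hy
    have h1 : ∀ n ∈ N, ∀ m ∈ M, ∀ y ∈ N.mul hA M, star (n * m) * (a : B) * y ∈ p.1.inB := by
      intro n hn m hm y hy
      refine mul_le hA (p.1.inB.comap (LinearMap.mulLeft ℂ (star (n * m) * (a : B))))
        (hcl.preimage (continuous_const_mul _)) (fun n' hn' m' hm' => ?_) hy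
      have h2 := h.mem (h'.mem ((coe_mem_inB (a := a)).2 ha) hn hn') hm hm'
      simpa [mul_assoc] using h2
    have hx' : x ∈ {x : B | star x * (a : B) * y ∈ p.1.inB} := by
      let K : Submodule ℂ B :=
        { carrier := {x : B | star x * (a : B) * y ∈ p.1.inB}
          add_mem' := fun {u v} hu hv => by
            simp only [Set.mem_ofPred_eq, star_add, add_mul] at *
            exact add_mem hu hv
          zero_mem' := by simp
          smul_mem' := fun c u hu => by
            simp only [Set.mem_ofPred_eq, star_smul, smul_mul_assoc] at *
            exact Submodule.smul_mem _ _ hu }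
      exact mul_le hA K (hcl.preimage (by fun_prop)) (fun n hn m hm => h1 n hn m hm y hy) hx
    exact hx'
  · intro H
    by_contra har
    obtain ⟨n, hn, n', hn', h1⟩ := h'.exists a.2 (fun h => har (coe_mem_inB.1 h))
    obtain ⟨m, hm, m', hm', h2⟩ := h.exists (star_mul_mul_mem hn hn' a.2) h1
    refine h2 ?_
    have := H _ (mul_mem_mul hA hn hm) _ (mul_mem_mul hA hn' hm')
    simpa [mul_assoc] using this

theorem domain_mul {q : PrimitiveSpectrum A} (hreg : IsRegularInclusion A)
    (h : M.DualMap p q) (hN : q ∈ N.domain hA) : p ∈ (N.mul hA M).domain hA := by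
  obtain ⟨n, hn, n', hn', h1⟩ := mem_domain.1 hN
  obtain ⟨m, hm, m', hm', h2⟩ := h.exists (star_mul_mem hreg hn hn') h1
  refine mem_domain.2 ⟨_, mul_mem_mul hA hn hm, _, mul_mem_mul hA hn' hm', ?_⟩
  simpa [mul_assoc] using h2

theorem exists_notMem_inB (p : PrimitiveSpectrum A) : ∃ x ∈ A, x ∉ p.1.inB := by
  obtain ⟨x, hx⟩ := p.2.exists_notMem
  exact ⟨x, x.2, fun h => hx (coe_mem_inB.1 h)⟩

theorem domain_unit (p : PrimitiveSpectrum A) : p ∈ (unit hA).domain hA := by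
  obtain ⟨x, hxA, hx⟩ := exists_notMem_inB p
  obtain ⟨c, hc, h⟩ := prim_mul p hxA hxA hx hx
  refine mem_domain.2 ⟨star (x * c), (mem_unit hA).2 (star_mem (mul_mem hxA hc)), x,
      (mem_unit hA).2 hxA, ?_⟩
  simpa using h

theorem dualMap_unit (p : PrimitiveSpectrum A) : (unit hA).DualMap p p := by
  intro a
  constructor
  · intro ha m (hm : m ∈ A) n (hn : n ∈ A)
    exact inB_right hn (inB_left (star_mem hm) (coe_mem_inB.2 ha))
  · intro H
    by_contra hap
    have hap' : (a : B) ∉ p.1.inB := fun h => hap (coe_mem_inB.1 h)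
    obtain ⟨c, hc, h1⟩ := prim_mul p a.2 a.2 hap' hap'
    obtain ⟨d, hd, h2⟩ := prim_mul p a.2 (mul_mem (mul_mem a.2 hc) a.2) hap' h1
    refine h2 ?_
    have := H (star ((a : B) * d)) ((mem_unit hA).2 (star_mem (mul_mem a.2 hd))) (c * a)
      ((mem_unit hA).2 (mul_mem hc a.2))
    simpa [mul_assoc] using this

theorem domain_adj (hreg : IsRegularInclusion A) (hp : p ∈ M.domain hA) (h : M.DualMap p q) :
    q ∈ M.adj.domain hA := by
  obtain ⟨m₁, hm₁, m₂, hm₂, hu⟩ := mem_domain.1 hp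
  have huA := star_mul_mem hreg hm₁ hm₂
  obtain ⟨c, hc, h1⟩ := prim_mul p huA huA hu hu
  have hm₃ : m₁ * star c ∈ M := right_mem hm₁ (star_mem hc)
  refine mem_domain.2 ⟨_, star_mem_adj hm₂, _, star_mem_adj hm₃, fun hq => h1 ?_⟩
  have := h.mem hq hm₁ hm₂
  simpa [mul_assoc] using this

theorem DualMap.adj (hreg : IsRegularInclusion A) (hp : p ∈ M.domain hA) (h : M.DualMap p q) :
    M.adj.DualMap q p := by
  intro a
  constructor
  · intro ha m hm n hn
    have hA' : star m * (a : B) * n ∈ A := star_mul_mul_mem hm hn a.2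
    refine (coe_mem_inB (a := ⟨_, hA'⟩)).2 ((h _).2 fun m' hm' n' hn' => ?_)
    have h1 : star m' * star m ∈ A := star_mul_mem hreg hm' hm
    have h2 : n * n' ∈ A := by
      have := star_mul_mem hreg (show star n ∈ M from hn) hn'
      simpa using this
    have := inB_right h2 (inB_left h1 ((coe_mem_inB (a := a)).2 ha))
    simpa [mul_assoc] using this
  · intro H
    by_contra hap
    have hap' : (a : B) ∉ p.1.inB := fun h => hap (coe_mem_inB.1 h)
    obtain ⟨m₁, hm₁, m₂, hm₂, hu⟩ := mem_domain.1 hp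
    have huA := star_mul_mem hreg hm₁ hm₂
    obtain ⟨c, hc, h1⟩ := prim_mul p huA a.2 hu hap'
    obtain ⟨d, hd, h2⟩ := prim_mul p (mul_mem (mul_mem huA hc) a.2) huA h1 hu
    have e1 := H _ (star_mem_adj (right_mem hm₂ hc)) _
      (star_mem_adj (right_mem hm₁ (star_mem hd)))
    have := h.mem e1 hm₁ hm₂
    refine h2 ?_
    simpa [mul_assoc] using this

/-! ### The dual groupoid -/

/-- The slices `M` with `p` in the domain of the dual map of `M`, which sends `p` to `q`. -/
def ArrowRep (hA : IsClosed (A : Set B)) (p q : PrimitiveSpectrum A) : Type u :=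
  {M : Slice A // p ∈ M.domain hA ∧ M.DualMap p q}

/-- The germ relation at `p`: there is a slice `V` below both slices whose domain contains `p`. -/
def Germ (hA : IsClosed (A : Set B)) (p : PrimitiveSpectrum A) (M M' : Slice A) : Prop :=
  ∃ V : Slice A, V ≤ M ∧ V ≤ M' ∧ p ∈ V.domain hA

/-- The intersection of two slices. -/
def inter (M N : Slice A) : Slice A where
  toSubmodule := M.toSubmodule ⊓ N.toSubmodule
  isClosed' := M.isClosed.inter N.isClosed
  normalises _ hx := M.normalises hx.1
  mul_mem_left' ha hm := ⟨left_mem ha hm.1, left_mem ha hm.2⟩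
  mul_mem_right' ha hm := ⟨right_mem hm.1 ha, right_mem hm.2 ha⟩

theorem Germ.trans (hreg : IsRegularInclusion A) {M₁ M₂ M₃ : Slice A} (h : Germ hA p M₁ M₂)
    (h' : Germ hA p M₂ M₃) : Germ hA p M₁ M₃ := by
  obtain ⟨V, hV₁, hV₂, hV⟩ := h
  obtain ⟨W, hW₂, hW₃, hW⟩ := h'
  refine ⟨V.inter W, fun x hx => hV₁ hx.1, fun x hx => hW₃ hx.2, mem_domain.2 ?_⟩
  obtain ⟨v₁, hv₁, v₂, hv₂, hv⟩ := mem_domain.1 hV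
  obtain ⟨w₁, hw₁, w₂, hw₂, hw⟩ := mem_domain.1 hW
  have hvA := star_mul_mem hreg hv₁ hv₂
  have hwA := star_mul_mem hreg hw₁ hw₂
  obtain ⟨d, hd, h1⟩ := prim_mul p hwA hvA hw hv
  obtain ⟨c, hc, h2⟩ := prim_mul p (mul_mem (mul_mem hwA hd) hvA) hwA h1 hw
  have key : ∀ v ∈ V, ∀ e ∈ A, ∀ w ∈ W, ∀ w' ∈ W, v * e * (star w * w') ∈ V.inter W := by
    intro v hv e he w hw w' hw'
    refine ⟨?_, ?_⟩
    · exact right_mem (right_mem hv he) (star_mul_mem hreg hw hw')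
    · have := left_mem (M := W) (mul_mul_star_mem (hV₂ hv) (hW₂ hw) he) hw'
      change _ ∈ W
      simpa [mul_assoc] using this
  refine ⟨_, key v₁ hv₁ (star d) (star_mem hd) w₂ hw₂ w₁ hw₁, _, key v₂ hv₂ c hc w₁ hw₁ w₂ hw₂, ?_⟩
  simpa [mul_assoc] using h2

end

end Slice

open Slice CategoryTheory

def germSetoid (h : IsRegularInclusion A) (p q : PrimitiveSpectrum A) :
    Setoid (ArrowRep h.isClosed p q) where
  r M M' := Germ h.isClosed p M.1 M'.1
  iseqv :=
    { refl := fun M => ⟨M.1, le_rfl, le_rfl, M.2.1⟩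
      symm := fun ⟨V, h₁, h₂, hV⟩ => ⟨V, h₂, h₁, hV⟩
      trans := fun h₁ h₂ => h₁.trans h h₂ }

/-- The dual groupoid of a regular inclusion: its objects are the primitive ideals of `A`, and its
arrows are the germs `[M, p]`, with source `p` and with the image of `p` under the dual map of the
slice `M` as range. The composition is induced by the multiplication of slices, and the inverse by
the adjoint. -/
@[reducible] def dualGroupoid (h : IsRegularInclusion A) : Groupoid.{u} (PrimitiveSpectrum A) where
  Hom p q := Quotient (germSetoid h p q)
  id p := Quotient.mk _ ⟨Slice.unit h.isClosed, domain_unit p, dualMap_unit p⟩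
  comp {p q r} f g := Quotient.map₂ (sa := germSetoid h p q) (sb := germSetoid h q r)
    (sc := germSetoid h p r)
    (fun M N => ⟨N.1.mul h.isClosed M.1, domain_mul h M.2.2 N.2.1, M.2.2.comp N.2.2⟩)
    (by
      rintro M M' ⟨V, hV, hV', hVp⟩ N N' ⟨W, hW, hW', hWq⟩
      refine ⟨W.mul h.isClosed V, fun x hx => ?_, fun x hx => ?_,
        domain_mul h (M.2.2.of_le h hV hVp) hWq⟩
      · exact mul_le h.isClosed (N.1.mul h.isClosed M.1).toSubmodule (Slice.isClosed _)
          (fun m hm n hn => mul_mem_mul h.isClosed (hW hm) (hV hn)) hx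
      · exact mul_le h.isClosed (N'.1.mul h.isClosed M'.1).toSubmodule (Slice.isClosed _)
          (fun m hm n hn => mul_mem_mul h.isClosed (hW' hm) (hV' hn)) hx) f g
  inv {p q} f := Quotient.map (sa := germSetoid h p q) (sb := germSetoid h q p)
    (fun M => ⟨M.1.adj, domain_adj h M.2.1 M.2.2, M.2.2.adj h M.2.1⟩)
    (by
      rintro M M' ⟨V, hV, hV', hVp⟩
      exact ⟨V.adj, fun x hx => hV hx, fun x hx => hV' hx,
        domain_adj h hVp (M.2.2.of_le h hV hVp)⟩) f
  id_comp {p q} f := by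
    induction f using Quotient.ind with | _ M
    refine Quotient.sound ⟨M.1.mul h.isClosed (Slice.unit h.isClosed), le_rfl, fun x hx => ?_,
      domain_mul h (dualMap_unit p) M.2.1⟩
    exact mul_le h.isClosed M.1.toSubmodule M.1.isClosed (fun m hm a ha => right_mem hm ha) hx
  comp_id {p q} f := by
    induction f using Quotient.ind with | _ M
    refine Quotient.sound ⟨(Slice.unit h.isClosed).mul h.isClosed M.1, le_rfl, fun x hx => ?_,
      domain_mul h M.2.2 (domain_unit q)⟩
    exact mul_le h.isClosed M.1.toSubmodule M.1.isClosed (fun a ha m hm => left_mem ha hm) hx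
  assoc {p q r s} f g k := by
    induction f using Quotient.ind with | _ M
    induction g using Quotient.ind with | _ N
    induction k using Quotient.ind with | _ L
    have hNM : (N.1.mul h.isClosed M.1).DualMap p r := M.2.2.comp N.2.2
    refine Quotient.sound ⟨L.1.mul h.isClosed (N.1.mul h.isClosed M.1), le_rfl, fun x hx => ?_,
      domain_mul h hNM L.2.1⟩
    refine mul_le h.isClosed ((L.1.mul h.isClosed N.1).mul h.isClosed M.1).toSubmodule
      (Slice.isClosed _) (fun l hl y hy => ?_) hx
    refine mul_le h.isClosed (Submodule.comap (LinearMap.mulLeft ℂ l)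
      ((L.1.mul h.isClosed N.1).mul h.isClosed M.1).toSubmodule)
      ((Slice.isClosed ((L.1.mul h.isClosed N.1).mul h.isClosed M.1)).preimage
        (continuous_const_mul l)) (fun n hn m hm => ?_) hy
    have := mul_mem_mul h.isClosed (mul_mem_mul h.isClosed hl hn) hm
    rw [mul_assoc] at this
    exact this
  inv_comp {p q} f := by
    induction f using Quotient.ind with | _ M
    refine Quotient.sound ⟨M.1.mul h.isClosed M.1.adj, le_rfl, fun x hx => ?_,
      domain_mul h (M.2.2.adj h M.2.1) M.2.1⟩
    refine mul_le h.isClosed (Slice.unit h.isClosed).toSubmodule (Slice.isClosed _)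
      (fun m hm n hn => ?_) hx
    have := mul_star_mem h hm (show star n ∈ M.1 from hn)
    rw [star_star] at this
    exact this
  comp_inv {p q} f := by
    induction f using Quotient.ind with | _ M
    refine Quotient.sound ⟨M.1.adj.mul h.isClosed M.1, le_rfl, fun x hx => ?_,
      domain_mul h M.2.2 (domain_adj h M.2.1 M.2.2)⟩
    refine mul_le h.isClosed (Slice.unit h.isClosed).toSubmodule (Slice.isClosed _)
      (fun n hn m hm => ?_) hx
    have := star_mul_mem h (show star n ∈ M.1 from hn) hm
    rw [star_star] at this
    exact this

end Inclusion

/-! ### Quasi-orbits of groupoids -/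

section Groupoids

open CategoryTheory

variable {X : Type u}

/-- The orbit `G · x`: the ranges of the arrows with source `x`. -/
def groupoidOrbit (G : Groupoid.{u} X) (x : X) : Set X := {y | Nonempty (x ⟶ y)}

/-- The equivalence relation that defines the quasi-orbit space of a groupoid with object space
`X`: equality of orbit closures. -/
def groupoidQuasiOrbitRel [TopologicalSpace X] (G : Groupoid.{u} X) : Setoid X :=
  Setoid.ker fun x => closure (groupoidOrbit G x)

end Groupoids

end CStarIncl

end

/-! Restricted ideals can be recognised inside `A`: they are the ideals that conjugation by
normalisers preserves (`isRestricted_iff`). If `I` is such an ideal, `b` a normaliser and `a ∈ I`,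
then `(ba)(ba)⋆ = b a a⋆ b⋆` lies in `I`, so `ba` is a limit of elements of `I b a`. As normalisers
generate `B`, the closed span of `I B` is therefore a two-sided ideal; it equals `i(I)` and meets
`A` exactly in `I`. Invariance passes to joins, so the quasi-orbit space exists, and the closed
spans `i(I) = IB = BI` give the identities that define the quasi-orbit map.

For a primitive ideal `p`, Rieffel induction along slices (`exists_dualMap`) identifies the
intersection of the orbit of `p` with the set of all `a` such that `m⋆ a n ∈ p` for all slices `M`
and `m, n ∈ M` (`forall_orbit_mem_iff`). This ideal is invariant and contains every restricted ideal
below `p`, so it is `π(p)`. In the hull-kernel topology, equal intersections mean equal closures.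

The analytic point is surjectivity of `π`. For a prime restricted ideal `P`, first countability
provides restricted ideals `I n` not below `P` such that `P` is the only prime above `P` containing
none of them. Primeness says that the open sets `{p | ¬ I n ≤ p}` are dense in the hull of `P`, and
a Baire property (`exists_primitive_forall_not_le`) gives a common point `p`, for which `π(p) = P`.
The same argument in `B` makes restriction of primitive ideals surjective when `A` separates ideals.
Conversely, a homeomorphism forces `i(r(J)) = J`, because closed ideals are intersections of
primitive ideals.

This last fact and the Baire property both come from `exists_primitive_dist`: if `1 + c` has norm at
least `2` modulo `P`, with `‖c‖ ≤ 1`, then an extreme state with value `1` at `c` yields an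
irreducible representation that kills `P` and whose kernel stays at distance `1` from `c`. -/

namespace CStarIncl

/-! ### Approximate units and functional calculus in closed ideals -/

section Approximation

variable {B : Type*} [NonUnitalCStarAlgebra B]

/-- If `x x⋆` lies in a C⋆-subalgebra `D`, then `x` is approximated by the elements `e x` with
`e` in `D`. -/
theorem exists_mem_norm_sub_mul_lt (D : NonUnitalStarSubalgebra ℂ B) (hD : IsClosed (D : Set B))
    {x : B} (hx : x * star x ∈ D) {ε : ℝ} (hε : 0 < ε) : ∃ e ∈ D, ‖x - e * x‖ < ε := by
  have : IsClosed (D : Set B) := hD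
  let _ : NonUnitalCStarAlgebra D := NonUnitalStarSubalgebra.nonUnitalCStarAlgebra D
  let _ := CStarAlgebra.spectralOrder D
  have _ := CStarAlgebra.spectralOrderedRing D
  have hl := CStarAlgebra.increasingApproximateUnit D
  have h1 := hl.tendsto_mul_right ⟨_, hx⟩
  have h2 := (Metric.tendsto_nhds.1 h1 (ε ^ 2 / 2) (by positivity)).and
    (hl.eventually_norm.and hl.eventually_star_eq)
  obtain ⟨e, he, hen, hes⟩ := h2.exists
  refine ⟨e, e.2, ?_⟩
  have hes' : star (e : B) = e := congrArg Subtype.val hes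
  have hen' : ‖(e : B)‖ ≤ 1 := hen
  set z : B := (e : B) * (x * star x) - x * star x with hz
  have hzn : ‖z‖ < ε ^ 2 / 2 := by
    rw [dist_eq_norm] at he
    exact he
  -- By the C⋆-identity, `‖x - e x‖²` is the norm of `z e - z`, which is at most `2 ‖z‖`; hence the
  -- tolerance `ε² / 2`.
  have key : (x - e * x) * star (x - e * x) = z * e - z := by
    simp only [hz, star_sub, star_mul, hes', sub_mul, mul_sub, mul_assoc]
    abel
  have h3 : ‖x - e * x‖ * ‖x - e * x‖ < ε ^ 2 := by
    rw [← CStarRing.norm_self_mul_star, key]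
    calc ‖z * e - z‖ ≤ ‖z * e‖ + ‖z‖ := norm_sub_le _ _
      _ ≤ ‖z‖ * ‖(e : B)‖ + ‖z‖ := by gcongr; exact norm_mul_le _ _
      _ ≤ ‖z‖ * 1 + ‖z‖ := by gcongr
      _ < ε ^ 2 := by linarith
  rw [← sq] at h3
  exact lt_of_pow_lt_pow_left₀ 2 hε.le h3

/-- An element `x` is in a closed set `K` as soon as `x x⋆` lies in a C⋆-subalgebra `D` and `K`
contains `e x` for all `e` in `D`. -/
theorem mem_of_forall_mul_mem (D : NonUnitalStarSubalgebra ℂ B) (hD : IsClosed (D : Set B))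
    {x : B} (hx : x * star x ∈ D) {K : Set B} (hK : IsClosed K) (h : ∀ e ∈ D, e * x ∈ K) :
    x ∈ K := by
  rw [← hK.closure_eq, Metric.mem_closure_iff]
  intro ε hε
  obtain ⟨e, he, hlt⟩ := exists_mem_norm_sub_mul_lt D hD hx hε
  exact ⟨_, h e he, by rwa [dist_eq_norm]⟩

namespace ClosedIdeal

variable {I : ClosedIdeal B}

/-- `D = I ∩ I⋆` is a C⋆-subalgebra that contains `x⋆ x`, so `x⋆` is a limit of elements `e x⋆` with
`e ∈ D`, which lie in `I`. -/
theorem star_mem {x : B} (hx : x ∈ I) : star x ∈ I := by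
  let D : NonUnitalStarSubalgebra ℂ B :=
    { carrier := {y | y ∈ I ∧ star y ∈ I}
      add_mem' := fun ha hb => ⟨add_mem ha.1 hb.1, by
        rw [star_add]; exact add_mem ha.2 hb.2⟩
      zero_mem' := ⟨zero_mem I, by rw [star_zero]; exact zero_mem I⟩
      mul_mem' := fun {a b} ha hb => ⟨I.mul_mem_left a hb.1, by
        rw [star_mul]; exact I.mul_mem_left _ ha.2⟩
      smul_mem' := fun c a ha => ⟨SMulMemClass.smul_mem c ha.1, by
        rw [star_smul]; exact SMulMemClass.smul_mem _ ha.2⟩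
      star_mem' := fun ha => ⟨ha.2, by rw [star_star]; exact ha.1⟩ }
  have hD : IsClosed (D : Set B) := I.isClosed.inter (I.isClosed.preimage continuous_star)
  refine mem_of_forall_mul_mem D hD (x := star x) ?_ I.isClosed
    fun e he => I.mul_mem_right _ he.1
  have : star x * x ∈ I := I.mul_mem_left _ hx
  exact ⟨by simpa using this, by simpa using this⟩

/-- A closed two-sided ideal, as a C⋆-subalgebra. -/
def toStarSubalgebra (I : ClosedIdeal B) : NonUnitalStarSubalgebra ℂ B where
  toSubmodule := I.toSubmodule
  mul_mem' {a _} _ hb := I.mul_mem_left a hb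
  star_mem' ha := I.star_mem ha

theorem mem_of_forall_mul_mem {x : B} (hx : x * star x ∈ I) {K : Set B} (hK : IsClosed K)
    (h : ∀ e ∈ I, e * x ∈ K) : x ∈ K :=
  CStarIncl.mem_of_forall_mul_mem I.toStarSubalgebra I.isClosed hx hK h

theorem mem_of_mul_star_mem {x : B} (hx : x * star x ∈ I) : x ∈ I :=
  mem_of_forall_mul_mem hx I.isClosed fun _ he => I.mul_mem_right _ he

theorem mem_of_star_mul_mem {x : B} (hx : star x * x ∈ I) : x ∈ I := by
  have := mem_of_mul_star_mem (I := I) (x := star x) (by simpa using hx)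
  simpa using I.star_mem this

end ClosedIdeal

/-- A positive element outside of a closed ideal can be cut down by continuous functional calculus
to `b` outside of the ideal, on which another function `g` of the given element acts as a unit. -/
theorem exists_cutDown (P : ClosedIdeal B) {x : B} (hx : star x * x ∉ P) :
    ∃ g b : B, ‖g‖ ≤ 1 ∧ g * b = b ∧ b ∉ P ∧ IsSelfAdjoint g ∧ IsSelfAdjoint b ∧
      (∀ I : ClosedIdeal B, star x * x ∈ I → g ∈ I) ∧
      ∀ a : B, IsSelfAdjoint a → a * (star x * x) = star x * x → a * g = g := by
  let _ := CStarAlgebra.spectralOrder B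
  have _ := CStarAlgebra.spectralOrderedRing B
  have hy0 : 0 ≤ star x * x := star_mul_self_nonneg x
  set y := star x * x
  have hys : IsSelfAdjoint y := hy0.isSelfAdjoint
  -- `P` misses the open `δ`-ball around `y`. The element `b = (y - δ/2)₊` stays in this ball, and
  -- `g = min (2y/δ, 1)` equals `1` wherever `b` does not vanish.
  obtain ⟨δ, hδ, hball⟩ := Metric.isOpen_iff.1 P.isClosed.isOpen_compl y hx
  have hδ2 : 0 < δ / 2 := by positivity
  have hσ : ∀ t ∈ quasispectrum ℝ y, 0 ≤ t := fun t ht =>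
    quasispectrum_nonneg_of_nonneg y hy0 t ht
  have hg : Continuous fun t : ℝ => min (t / (δ / 2)) 1 := by fun_prop
  have hb : Continuous fun t : ℝ => max (t - δ / 2) 0 := by fun_prop
  have hg0 : min ((0 : ℝ) / (δ / 2)) 1 = 0 := by simp
  have hb0 : max ((0 : ℝ) - δ / 2) 0 = 0 := max_eq_right (by linarith)
  refine ⟨cfcₙ (fun t : ℝ => min (t / (δ / 2)) 1) y, cfcₙ (fun t : ℝ => max (t - δ / 2) 0) y,
    norm_cfcₙ_le fun t ht => ?_, ?_, fun hmem => ?_, cfcₙ_predicate _ _, cfcₙ_predicate _ _,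
    fun I hI => ?_, fun a ha hay => ?_⟩
  · have := hσ t ht
    rw [Real.norm_of_nonneg (by positivity)]
    exact min_le_right _ _
  · rw [← cfcₙ_mul _ _ y hg.continuousOn hg0 hb.continuousOn hb0]
    congr 1
    ext t
    rcases le_total t (δ / 2) with h | h
    · rw [max_eq_right (by linarith), mul_zero]
    · rw [min_eq_right ((one_le_div hδ2).2 h), one_mul]
  · refine hball (a := cfcₙ (fun t : ℝ => max (t - δ / 2) 0) y) ?_ hmem
    rw [Metric.mem_ball, dist_eq_norm]
    refine lt_of_le_of_lt ?_ (half_lt_self hδ)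
    nth_rw 2 [← cfcₙ_id ℝ y]
    rw [← cfcₙ_sub _ _ y hb.continuousOn hb0 continuousOn_id rfl]
    refine norm_cfcₙ_le fun t ht => ?_
    have := hσ t ht
    rw [Real.norm_eq_abs, abs_le, id]
    constructor
    · linarith [le_max_left (t - δ / 2) 0]
    · have : max (t - δ / 2) 0 ≤ t := max_le (by linarith) this
      linarith
  · have : IsClosed (I.toStarSubalgebra : Set B) := I.isClosed
    exact cfcₙ_mem (𝕜' := ℂ) (s := I.toStarSubalgebra) _ hI
  -- The elements on which, and on whose adjoints, `a` acts as a left unit form a C⋆-subalgebra. It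
  -- contains `y`, hence also `g`.
  · let S : NonUnitalStarSubalgebra ℂ B :=
      { carrier := {z | a * z = z ∧ a * star z = star z}
        add_mem' := fun hu hv => ⟨by rw [mul_add, hu.1, hv.1], by
          rw [star_add, mul_add, hu.2, hv.2]⟩
        zero_mem' := ⟨by simp, by simp⟩
        mul_mem' := fun hu hv => ⟨by rw [← mul_assoc, hu.1], by
          rw [star_mul, ← mul_assoc, hv.2]⟩
        smul_mem' := fun c u hu => ⟨by rw [mul_smul_comm, hu.1], by
          rw [star_smul, mul_smul_comm, hu.2]⟩
        star_mem' := fun hu => ⟨hu.2, by rw [star_star]; exact hu.1⟩ }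
    have : IsClosed (S : Set B) :=
      (isClosed_eq (continuous_const_mul a) continuous_id).inter
        (isClosed_eq ((continuous_const_mul a).comp continuous_star) continuous_star)
    exact (cfcₙ_mem (𝕜' := ℂ) (s := S) (fun t : ℝ => min (t / (δ / 2)) 1)
      (⟨hay, by rw [hys.star_eq]; exact hay⟩ : y ∈ S)).1

end Approximation

end CStarIncl

/-! ### Extreme states and irreducible representations -/

namespace CStarIncl

theorem eq_one_of_re_eq_one {z : ℂ} (hz : ‖z‖ ≤ 1) (hre : z.re = 1) : z = 1 := by
  have h1 : z.re * z.re + z.im * z.im ≤ 1 := by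
    have := Complex.sq_norm z
    rw [Complex.normSq_apply] at this
    nlinarith [norm_nonneg z]
  rw [hre] at h1
  have h2 : z.im = 0 := by
    have : z.im * z.im = 0 := le_antisymm (by linarith) (mul_self_nonneg _)
    exact mul_self_eq_zero.1 this
  exact Complex.ext hre h2

section States

variable {U : Type*} [CStarAlgebra U]

open ComplexOrder in
/-- A contractive linear functional that maps the unit to `1` is positive. -/
theorem nonneg_of_contractive [PartialOrder U] [StarOrderedRing U] (f : U →ₗ[ℂ] ℂ)
    (hf : ∀ x, ‖f x‖ ≤ ‖x‖) (h1 : f 1 = 1) {x : U} (hx : 0 ≤ x) : 0 ≤ f x := by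
  have hxs : star x = x := hx.isSelfAdjoint.star_eq
  have hU : ‖(1 : U)‖ ≤ 1 := by
    rcases subsingleton_or_nontrivial U with h | h
    · rw [Subsingleton.elim (1 : U) 0, norm_zero]; exact zero_le_one
    · rw [CStarRing.norm_one]
  have him : (f x).im = 0 := by
    -- Contractivity at `x + it`. The terms `t²` cancel, and the remaining inequality, affine in
    -- `t`, can hold for all `t` only if `Im f(x) = 0`.
    have key : ∀ t : ℝ, ((f x).im + t) ^ 2 ≤ ‖x‖ ^ 2 + t ^ 2 := by
      intro t
      have e1 : f (x + (t * Complex.I) • (1 : U)) = f x + t * Complex.I := by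
        rw [map_add, map_smul, h1, smul_eq_mul, mul_one]
      have e2 : star (x + (t * Complex.I) • (1 : U)) * (x + (t * Complex.I) • (1 : U)) =
          x * x + ((t ^ 2 : ℝ) : ℂ) • (1 : U) := by
        simp only [star_add, star_smul, star_one, hxs, add_mul, mul_add, smul_mul_assoc,
          mul_smul_comm, one_mul, mul_one, Complex.star_def, map_mul, Complex.conj_ofReal,
          Complex.conj_I]
        match_scalars
        · ring
        · ring
        · ring_nf; rw [Complex.I_sq]; ring
      have e3 : ‖x + (t * Complex.I) • (1 : U)‖ ^ 2 ≤ ‖x‖ ^ 2 + t ^ 2 := by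
        rw [sq, ← CStarRing.norm_star_mul_self, e2]
        refine (norm_add_le _ _).trans (add_le_add ((norm_mul_le _ _).trans (sq _).ge) ?_)
        rw [norm_smul, Complex.norm_real, Real.norm_of_nonneg (sq_nonneg t)]
        exact mul_le_of_le_one_right (sq_nonneg t) hU
      have e4 := hf (x + (t * Complex.I) • (1 : U))
      rw [e1] at e4
      have e5 := Complex.abs_im_le_norm (f x + t * Complex.I)
      have e6 : (f x + t * Complex.I).im = (f x).im + t := by simp
      rw [e6] at e5
      calc ((f x).im + t) ^ 2 = |(f x).im + t| ^ 2 := (sq_abs _).symm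
        _ ≤ ‖x + (t * Complex.I) • (1 : U)‖ ^ 2 := by gcongr; exact e5.trans e4
        _ ≤ _ := e3
    by_contra hne
    have := key ((‖x‖ ^ 2 + 1) / (2 * (f x).im))
    have e : (2 * (f x).im) * ((‖x‖ ^ 2 + 1) / (2 * (f x).im)) = ‖x‖ ^ 2 + 1 :=
      mul_div_cancel₀ _ (by simpa using hne)
    nlinarith [sq_nonneg (f x).im]
  have hre : 0 ≤ (f x).re := by
    -- From `0 ≤ x ≤ ‖x‖` the element `‖x‖ - x` has norm at most `‖x‖`; applying `f` gives `‖x‖ - Re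
    -- f(x) ≤ ‖x‖`.
    have hle : x ≤ algebraMap ℝ U ‖x‖ := IsSelfAdjoint.le_algebraMap_norm_self hx.isSelfAdjoint
    have e1 : ‖algebraMap ℝ U ‖x‖ - x‖ ≤ ‖x‖ := by
      rw [CStarAlgebra.norm_le_iff_le_algebraMap _ (norm_nonneg x) (sub_nonneg.2 hle)]
      exact sub_le_self _ hx
    have e2 : algebraMap ℝ U ‖x‖ = ((‖x‖ : ℝ) : ℂ) • (1 : U) := by
      rw [Algebra.algebraMap_eq_smul_one, Complex.coe_smul]
    have e3 := (Complex.re_le_norm _).trans ((hf _).trans e1)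
    rw [e2, map_sub, map_smul, h1] at e3
    simpa using e3
  exact Complex.nonneg_iff.2 ⟨hre, him.symm⟩

/-- The functionals that are contractive, unital, take the value `1` at `c`, and vanish on a given
set. -/
def stateSet (c : U) (P : Set U) : Set (U → ℂ) :=
  {f | (∀ x y, f (x + y) = f x + f y) ∧ (∀ (r : ℂ) x, f (r • x) = r * f x) ∧
    (∀ x, ‖f x‖ ≤ ‖x‖) ∧ f 1 = 1 ∧ f c = 1 ∧ ∀ x ∈ P, f x = 0}

/-- Banach–Alaoglu in this setting: the conditions are closed for pointwise convergence and confine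
the set to a product of discs. Compactness is what provides an extreme point. -/
theorem isCompact_stateSet (c : U) (P : Set U) : IsCompact (stateSet c P) := by
  have h1 : IsCompact (Set.pi Set.univ fun x : U => Metric.closedBall (0 : ℂ) ‖x‖) :=
    isCompact_univ_pi fun x => isCompact_closedBall 0 ‖x‖
  refine h1.of_isClosed_subset ?_ fun f hf x _ => by simpa using hf.2.2.1 x
  have e : ∀ x : U, Continuous fun f : U → ℂ => f x := continuous_apply
  simp only [stateSet, Set.ofPred_and, Set.ofPred_forall]
  refine IsClosed.inter ?_ <| IsClosed.inter ?_ <| IsClosed.inter ?_ <| IsClosed.inter ?_ <|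
    IsClosed.inter ?_ ?_
  · exact isClosed_iInter fun x => isClosed_iInter fun y => isClosed_eq (e _) ((e x).add (e y))
  · exact isClosed_iInter fun r => isClosed_iInter fun y =>
      isClosed_eq (e _) (continuous_const.mul (e y))
  · exact isClosed_iInter fun x => isClosed_le (e x).norm continuous_const
  · exact isClosed_eq (e _) continuous_const
  · exact isClosed_eq (e _) continuous_const
  · exact isClosed_iInter fun x => isClosed_iInter fun _ => isClosed_eq (e _) continuous_const

end States

theorem continuous_rep {A H : Type*} [NonUnitalCStarAlgebra A] [NormedAddCommGroup H]
    [InnerProductSpace ℂ H] [CompleteSpace H] (π : A →⋆ₙₐ[ℂ] (H →L[ℂ] H)) : Continuous π :=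
  AddMonoidHomClass.continuous_of_bound π 1 fun x => by
    simpa using NonUnitalStarAlgHom.norm_apply_le π x

/-- The kernel of a `*`-representation. -/
def kerIdeal {A : Type u} [NonUnitalCStarAlgebra A] {H : Type u} [NormedAddCommGroup H]
    [InnerProductSpace ℂ H] [CompleteSpace H] (π : A →⋆ₙₐ[ℂ] (H →L[ℂ] H)) : ClosedIdeal A where
  carrier := {a | π a = 0}
  add_mem' ha hb := by
    simp only [Set.mem_ofPred_eq] at *
    rw [map_add, ha, hb, add_zero]
  zero_mem' := map_zero π
  smul_mem' c _ ha := by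
    simp only [Set.mem_ofPred_eq] at *
    rw [map_smul, ha, smul_zero]
  isClosed' := isClosed_eq (continuous_rep π) continuous_const
  mul_mem_left' a _ hx := by
    simp only [Set.mem_ofPred_eq] at *
    rw [map_mul, hx, mul_zero]
  mul_mem_right' a _ hx := by
    simp only [Set.mem_ofPred_eq] at *
    rw [map_mul, hx, zero_mul]

end CStarIncl

namespace CStarIncl

open scoped InnerProductSpace ComplexOrder

theorem inner_self_eq_ofReal {H : Type*} [NormedAddCommGroup H] [InnerProductSpace ℂ H] (x : H) :
    ⟪x, x⟫_ℂ = ((‖x‖ ^ 2 : ℝ) : ℂ) := by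
  rw [inner_self_eq_norm_sq_to_K, Complex.ofReal_pow]
  rfl

/-- When an extreme state is decomposed along an invariant subspace, this puts the two normalised
pieces back into the same state set, so that extremality applies. -/
theorem mem_stateSet_of_vector {U H : Type*} [CStarAlgebra U] [NormedAddCommGroup H]
    [InnerProductSpace ℂ H] [CompleteSpace H] (ρ : U →⋆ₐ[ℂ] (H →L[ℂ] H)) {c : U} {P : Set U}
    (hP : ∀ x ∈ P, ρ x = 0) {t : ℝ} {η : H} (ht : ‖η‖ ^ 2 = t) (ht0 : 0 < t)
    (hc : ⟪η, ρ c η⟫_ℂ / t = 1) : (fun u => ⟪η, ρ u η⟫_ℂ / t) ∈ stateSet c P := by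
  have htc : (t : ℂ) ≠ 0 := by exact_mod_cast ht0.ne'
  refine ⟨fun x y => ?_, fun r x => ?_, fun x => ?_, ?_, hc, fun x hx => ?_⟩
  · beta_reduce
    rw [map_add, add_apply, inner_add_right, add_div]
  · beta_reduce
    rw [map_smul, smul_apply, inner_smul_right, mul_div_assoc]
  · beta_reduce
    rw [norm_div, Complex.norm_real, Real.norm_of_nonneg ht0.le, div_le_iff₀ ht0, ← ht]
    calc ‖⟪η, ρ x η⟫_ℂ‖ ≤ ‖η‖ * ‖ρ x η‖ := norm_inner_le_norm _ _
      _ ≤ ‖η‖ * (‖ρ x‖ * ‖η‖) := by gcongr; exact (ρ x).le_opNorm η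
      _ ≤ ‖η‖ * (‖x‖ * ‖η‖) := by gcongr; exact NonUnitalStarAlgHom.norm_apply_le ρ x
      _ = ‖x‖ * ‖η‖ ^ 2 := by ring
  · beta_reduce
    rw [map_one, one_apply_eq_self, inner_self_eq_ofReal, ht, div_self htc]
  · simp [hP x hx]

/-- An extreme point of a set of states gives an irreducible representation. -/
theorem exists_irreducible {U : Type u} [CStarAlgebra U] {c : U} (hc : ‖c‖ ≤ 1) {P : Set U}
    (hP : ∀ p ∈ P, ∀ a b : U, a * p * b ∈ P) (hne : (stateSet c P).Nonempty) :
    ∃ (H : Type u) (_ : NormedAddCommGroup H) (_ : InnerProductSpace ℂ H) (_ : CompleteSpace H)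
      (ρ : U →⋆ₐ[ℂ] (H →L[ℂ] H)) (ξ : H), ‖ξ‖ = 1 ∧ ⟪ξ, ρ c ξ⟫_ℂ = 1 ∧ (∀ p ∈ P, ρ p = 0) ∧
      ∀ K : Submodule ℂ H, IsClosed (K : Set H) → (∀ u, ∀ x ∈ K, ρ u x ∈ K) → K = ⊥ ∨ K = ⊤ := by
  let _ := CStarAlgebra.spectralOrder U
  have _ := CStarAlgebra.spectralOrderedRing U
  obtain ⟨φ, hφ⟩ := (isCompact_stateSet c P).extremePoints_nonempty hne
  rw [mem_extremePoints_iff_left] at hφ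
  obtain ⟨⟨hadd, hsmul, hnorm, hone, hφc, hφP⟩, hext⟩ := hφ
  let φl : U →ₗ[ℂ] ℂ := { toFun := φ, map_add' := hadd, map_smul' := hsmul }
  let f : U →ₚ[ℂ] ℂ := PositiveLinearMap.mk₀ φl fun x hx => nonneg_of_contractive φl hnorm hone hx
  have hf : ∀ u, f u = φ u := fun _ => rfl
  let ρ := f.gnsStarAlgHom
  let ξ : f.GNS := ((f.toPreGNS 1 : f.PreGNS) : f.GNS)
  have hρ : ∀ u a, ρ u ((f.toPreGNS a : f.PreGNS) : f.GNS) = (f.toPreGNS (u * a) : f.PreGNS) := by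
    intro u a
    exact f.gnsNonUnitalStarAlgHom_apply_coe
  have hinner : ∀ a b : U, ⟪((f.toPreGNS a : f.PreGNS) : f.GNS),
      ((f.toPreGNS b : f.PreGNS) : f.GNS)⟫_ℂ = φ (star a * b) := fun a b => by
    rw [UniformSpace.Completion.inner_coe]
    rfl
  have hξ : ∀ u, ρ u ξ = ((f.toPreGNS u : f.PreGNS) : f.GNS) := fun u => by
    rw [hρ, mul_one]
  have hvec : ∀ u, ⟪ξ, ρ u ξ⟫_ℂ = φ u := fun u => by
    rw [hξ, hinner, star_one, one_mul]
  have hξ1 : ‖ξ‖ = 1 := by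
    have := hvec 1
    rw [map_one, one_apply_eq_self, hone, inner_self_eq_ofReal] at this
    have h2 : ‖ξ‖ ^ 2 = 1 := by exact_mod_cast this
    exact (pow_eq_one_iff_of_nonneg (norm_nonneg ξ) two_ne_zero).1 h2
  have hdense : ∀ K : Submodule ℂ f.GNS, IsClosed (K : Set f.GNS) → (∀ u, ρ u ξ ∈ K) → K = ⊤ := by
    intro K hK hu
    refine Submodule.eq_top_iff'.2 fun x => ?_
    induction x using UniformSpace.Completion.induction_on with
    | hp => exact hK
    | ih a => exact hξ a ▸ hu a
  have hρP : ∀ p ∈ P, ρ p = 0 := by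
    intro p hp
    ext x
    induction x using UniformSpace.Completion.induction_on with
    | hp => exact isClosed_eq (ρ p).continuous continuous_const
    | ih a =>
      have e : ρ p a = ((f.toPreGNS (p * f.ofPreGNS a) : f.PreGNS) : f.GNS) := hρ p _
      have h0 : ⟪ρ p a, ρ p a⟫_ℂ = 0 := by
        rw [e, hinner, ← mul_assoc]
        exact hφP _ (hP p hp _ _)
      simpa using inner_self_eq_zero.1 h0
  have hstar : ∀ u (x y : f.GNS), ⟪x, ρ u y⟫_ℂ = ⟪ρ (star u) x, y⟫_ℂ := by
    intro u x y
    rw [map_star, ContinuousLinearMap.star_eq_adjoint, ContinuousLinearMap.adjoint_inner_left]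
  refine ⟨f.GNS, inferInstance, inferInstance, inferInstance, ρ, ξ, hξ1, (hvec c).trans hφc, hρP,
    fun K hK hinv => ?_⟩
  have : CompleteSpace K := hK.completeSpace_coe
  have hperp : ∀ u, ∀ x ∈ Kᗮ, ρ u x ∈ Kᗮ := by
    intro u x hx
    rw [Submodule.mem_orthogonal] at hx ⊢
    intro y hy
    rw [hstar]
    exact hx _ (hinv _ _ hy)
  -- The cyclic vector is split along the invariant subspace. If one part vanishes, cyclicity
  -- decides; otherwise `φ` is a proper convex combination of the two normalised vector states.
  obtain ⟨η, hη, ζ, hζ, hsum⟩ : ∃ η ∈ K, ∃ ζ ∈ Kᗮ, ξ = η + ζ :=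
    ⟨K.starProjection ξ, K.starProjection_apply_mem ξ, ξ - K.starProjection ξ,
      K.sub_starProjection_mem_orthogonal ξ, by abel⟩
  rcases eq_or_ne η 0 with h0 | hη0
  · left
    have h1 : ξ ∈ Kᗮ := by rw [hsum, h0, zero_add]; exact hζ
    have h2 := hdense Kᗮ K.isClosed_orthogonal fun u => hperp u _ h1
    rwa [Submodule.orthogonal_eq_top_iff] at h2
  right
  rcases eq_or_ne ζ 0 with h0 | hζ0
  · exact hdense K hK fun u => hinv u _ (by rw [hsum, h0, add_zero]; exact hη)
  have hηζ : ∀ u, ⟪η, ρ u ζ⟫_ℂ = 0 := fun u => hperp u _ hζ _ hη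
  have hζη : ∀ u, ⟪ζ, ρ u η⟫_ℂ = 0 := fun u => by
    rw [← inner_conj_symm, hζ _ (hinv u _ hη), map_zero]
  have hsplit : ∀ u, φ u = ⟪η, ρ u η⟫_ℂ + ⟪ζ, ρ u ζ⟫_ℂ := fun u => by
    rw [← hvec, hsum, map_add, inner_add_left, inner_add_right, inner_add_right, hηζ, hζη]
    ring
  set s := ‖η‖ ^ 2 with hs
  set t := ‖ζ‖ ^ 2 with ht
  have hs0 : 0 < s := by positivity
  have ht0 : 0 < t := by positivity
  have hsc : (s : ℂ) ≠ 0 := by exact_mod_cast hs0.ne'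
  have htc : (t : ℂ) ≠ 0 := by exact_mod_cast ht0.ne'
  have hst : s + t = 1 := by
    have := hsplit 1
    rw [map_one, one_apply_eq_self, one_apply_eq_self, hone,
      inner_self_eq_ofReal, inner_self_eq_ofReal] at this
    exact_mod_cast this.symm
  -- The two parts contribute at most `s` and `t` to `φ(c) = 1 = s + t`. Both bounds are therefore
  -- attained, and both normalised vector states take the value `1` at `c`.
  have hbound : ∀ (η : f.GNS) (s : ℝ), ‖η‖ ^ 2 = s → ‖⟪η, ρ c η⟫_ℂ‖ ≤ s := by
    rintro η _ rfl
    calc ‖⟪η, ρ c η⟫_ℂ‖ ≤ ‖η‖ * ‖ρ c η‖ := norm_inner_le_norm _ _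
      _ ≤ ‖η‖ * (‖ρ c‖ * ‖η‖) := by gcongr; exact (ρ c).le_opNorm η
      _ ≤ ‖η‖ * (1 * ‖η‖) := by
        gcongr; exact (NonUnitalStarAlgHom.norm_apply_le ρ c).trans hc
      _ = ‖η‖ ^ 2 := by ring
  have hb1 := hbound η s rfl
  have hb2 := hbound ζ t rfl
  have hre : (⟪η, ρ c η⟫_ℂ).re + (⟪ζ, ρ c ζ⟫_ℂ).re = 1 := by
    have := congrArg Complex.re ((hsplit c).symm.trans hφc)
    simpa using this
  have hr1 := (Complex.re_le_norm _).trans hb1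
  have hr2 := (Complex.re_le_norm _).trans hb2
  have hcη : ⟪η, ρ c η⟫_ℂ / s = 1 := by
    refine eq_one_of_re_eq_one ?_ ?_
    · rw [norm_div, Complex.norm_real, Real.norm_of_nonneg hs0.le]
      exact (div_le_one hs0).2 hb1
    · rw [Complex.div_ofReal_re, div_eq_one_iff_eq hs0.ne']
      linarith
  have hcζ : ⟪ζ, ρ c ζ⟫_ℂ / t = 1 := by
    refine eq_one_of_re_eq_one ?_ ?_
    · rw [norm_div, Complex.norm_real, Real.norm_of_nonneg ht0.le]
      exact (div_le_one ht0).2 hb2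
    · rw [Complex.div_ofReal_re, div_eq_one_iff_eq ht0.ne']
      linarith
  have hmem1 := mem_stateSet_of_vector ρ hρP hs.symm hs0 hcη
  have hmem2 := mem_stateSet_of_vector ρ hρP ht.symm ht0 hcζ
  have heq := hext _ hmem1 _ hmem2 ⟨s, t, hs0, ht0, hst, by
    ext u
    simp only [Pi.add_apply, Pi.smul_apply, Complex.real_smul]
    rw [mul_div_cancel₀ _ hsc, mul_div_cancel₀ _ htc, hsplit]⟩
  -- By extremality the vector state of `η` is `φ`. So `η - s ξ` is orthogonal to the cyclic
  -- subspace, which forces `η = s ξ` and `ξ ∈ K`.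
  have hη' : ∀ u, ⟪η - (s : ℂ) • ξ, ρ u ξ⟫_ℂ = 0 := fun u => by
    have e1 : ⟪η, ρ u ξ⟫_ℂ = s * φ u := by
      have : ⟪η, ρ u η⟫_ℂ / s = φ u := congrFun heq u
      rw [hsum, map_add, inner_add_right, hηζ, add_zero, ← this, mul_div_cancel₀ _ hsc]
    rw [inner_sub_left, e1, inner_smul_left, hvec]
    simp
  have hz : η - (s : ℂ) • ξ = 0 := by
    have h2 := hdense (ℂ ∙ (η - (s : ℂ) • ξ))ᗮ (Submodule.isClosed_orthogonal _) fun u =>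
      Submodule.mem_orthogonal_singleton_iff_inner_right.2 (hη' u)
    rw [Submodule.orthogonal_eq_top_iff] at h2
    exact Submodule.span_singleton_eq_bot.1 h2
  refine hdense K hK fun u => hinv u _ ?_
  have : ξ = (s : ℂ)⁻¹ • η := by
    rw [sub_eq_zero.1 hz, smul_smul, inv_mul_cancel₀ hsc, one_smul]
  rw [this]
  exact K.smul_mem _ hη

end CStarIncl

/-! ### Primitive ideals above a closed ideal -/

namespace CStarIncl

open scoped InnerProductSpace

section

variable {A : Type u} [NonUnitalCStarAlgebra A]

/-- Hahn–Banach in the quotient of the unitization by `P`: a norming functional `g` for the class of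
`1 + c` has `g(1) + g(c) ≥ 2`. Both summands have modulus at most `1`, so both are `1`. -/
theorem stateSet_nonempty (P : ClosedIdeal A) {c : A} (hc : ‖c‖ ≤ 1)
    (h : ∀ p ∈ P, 2 ≤ ‖(1 : Unitization ℂ A) + (c : Unitization ℂ A) - (p : Unitization ℂ A)‖) :
    (stateSet (c : Unitization ℂ A) (Unitization.inr '' (P : Set A))).Nonempty := by
  let PU : Submodule ℂ (Unitization ℂ A) :=
    P.toSubmodule.map (Unitization.inrNonUnitalStarAlgHom ℂ A : A →ₗ[ℂ] Unitization ℂ A)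
  have hPU : ∀ x ∈ PU, ∃ p ∈ P, x = (p : Unitization ℂ A) := by
    rintro _ ⟨p, hp, rfl⟩
    exact ⟨p, hp, rfl⟩
  obtain ⟨g, hg, hgx⟩ := exists_dual_vector'' ℂ
    (PU.mkQ ((1 : Unitization ℂ A) + (c : Unitization ℂ A)))
  have hle : ∀ u, ‖g (PU.mkQ u)‖ ≤ ‖u‖ := fun u =>
    calc ‖g (PU.mkQ u)‖ ≤ ‖g‖ * ‖PU.mkQ u‖ := g.le_opNorm _
      _ ≤ 1 * ‖u‖ := by
        gcongr
        exact Submodule.Quotient.norm_mk_le PU u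
      _ = ‖u‖ := one_mul _
  have h2 : 2 ≤ ‖PU.mkQ ((1 : Unitization ℂ A) + (c : Unitization ℂ A))‖ := by
    refine le_of_forall_pos_le_add fun ε hε => ?_
    obtain ⟨m, hm, hlt⟩ := Submodule.Quotient.norm_mk_lt
      (PU.mkQ ((1 : Unitization ℂ A) + (c : Unitization ℂ A))) hε
    have hm' : ((1 : Unitization ℂ A) + (c : Unitization ℂ A)) - m ∈ PU :=
      (Submodule.Quotient.eq PU).1 hm.symm
    obtain ⟨p, hp, hpm⟩ := hPU _ hm'
    have := h p hp
    rw [← hpm, sub_sub_cancel] at this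
    linarith
  have hre := congrArg Complex.re hgx
  rw [map_add, map_add, Complex.add_re] at hre
  have hc' : ‖(c : Unitization ℂ A)‖ ≤ 1 := by rwa [Unitization.norm_inr]
  have hn1 := (hle 1).trans_eq CStarRing.norm_one
  have hn2 := (hle c).trans hc'
  have hr1 := (Complex.re_le_norm _).trans hn1
  have hr2 := (Complex.re_le_norm _).trans hn2
  have hre' : (g (PU.mkQ 1)).re + (g (PU.mkQ (c : Unitization ℂ A))).re ≥ 2 := by
    rw [hre]
    simpa using h2
  refine ⟨fun u => g (PU.mkQ u), fun x y => ?_, fun r x => ?_, hle,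
    eq_one_of_re_eq_one hn1 (by linarith), eq_one_of_re_eq_one hn2 (by linarith), ?_⟩
  · simp only [map_add]
  · simp only [map_smul, smul_eq_mul]
  · rintro _ ⟨p, hp, rfl⟩
    have : PU.mkQ (p : Unitization ℂ A) = 0 :=
      (Submodule.Quotient.mk_eq_zero PU).2 ⟨p, hp, rfl⟩
    beta_reduce
    rw [this, map_zero]

/-- If the distance of `1 + c` to `P` is at least `2`, there is a primitive ideal over `P` that
keeps distance `1` to `c`. -/
theorem exists_primitive_dist (P : ClosedIdeal A) {c : A} (hc : ‖c‖ ≤ 1)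
    (h : ∀ p ∈ P, 2 ≤ ‖(1 : Unitization ℂ A) + (c : Unitization ℂ A) - (p : Unitization ℂ A)‖) :
    ∃ p : PrimitiveSpectrum A, P ≤ p.1 ∧ ∀ x ∈ p.1, 1 ≤ ‖c - x‖ := by
  have hc' : ‖(c : Unitization ℂ A)‖ ≤ 1 := by rwa [Unitization.norm_inr]
  obtain ⟨H, _, _, _, ρ, ξ, hξ, hρc, hρP, hirr⟩ := exists_irreducible hc' (by
    rintro _ ⟨p, hp, rfl⟩ a b
    -- An ideal of `A` is still an ideal in the unitization; the witness is `a p b` expanded into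
    -- scalar and `A`-parts.
    refine ⟨(a.fst • p + a.snd * p) * b.snd + b.fst • (a.fst • p + a.snd * p), ?_, ?_⟩
    · have h1 : a.fst • p + a.snd * p ∈ P :=
        add_mem (SMulMemClass.smul_mem _ hp) (P.mul_mem_left _ hp)
      exact add_mem (P.mul_mem_right _ h1) (SMulMemClass.smul_mem _ h1)
    · ext
      · simp
      · simp [add_comm]) (stateSet_nonempty P hc h)
  let π : A →⋆ₙₐ[ℂ] (H →L[ℂ] H) :=
    (ρ : Unitization ℂ A →⋆ₙₐ[ℂ] (H →L[ℂ] H)).comp (Unitization.inrNonUnitalStarAlgHom ℂ A)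
  have hπ : ∀ a, π a = ρ (a : Unitization ℂ A) := fun _ => rfl
  have hpi : IsIrreducibleRep π := by
    refine ⟨⟨c, fun h0 => ?_⟩, fun K hK hinv => hirr K hK fun u x hx => ?_⟩
    · rw [← hπ, h0] at hρc
      simp at hρc
    · rw [← Unitization.inl_fst_add_inr_snd_eq u, map_add, add_apply]
      refine K.add_mem ?_ (hinv _ _ hx)
      have : ρ (Unitization.inl u.fst) = algebraMap ℂ _ u.fst := ρ.commutes' u.fst
      rw [this, Algebra.algebraMap_eq_smul_one, smul_apply, one_apply_eq_self]
      exact K.smul_mem _ hx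
  refine ⟨⟨kerIdeal π, H, _, _, _, π, hpi, fun a => Iff.rfl⟩, fun x hx => hρP _ ⟨x, hx, rfl⟩,
    fun x hx => ?_⟩
  have hx0 : ρ (x : Unitization ℂ A) = 0 := hx
  have h1 : ⟪ξ, π (c - x) ξ⟫_ℂ = 1 := by
    rw [hπ, Unitization.inr_sub, map_sub, hx0, sub_zero, hρc]
  calc (1 : ℝ) = ‖⟪ξ, π (c - x) ξ⟫_ℂ‖ := by rw [h1, norm_one]
    _ ≤ ‖ξ‖ * ‖π (c - x) ξ‖ := norm_inner_le_norm _ _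
    _ ≤ ‖ξ‖ * (‖π (c - x)‖ * ‖ξ‖) := by gcongr; exact (π (c - x)).le_opNorm ξ
    _ ≤ ‖ξ‖ * (‖c - x‖ * ‖ξ‖) := by gcongr; exact NonUnitalStarAlgHom.norm_apply_le π _
    _ = ‖c - x‖ := by rw [hξ]; ring

/-- Modulo `P`, left multiplication by `1 + c - p` sends the nonzero class of `b` to `1 + s` times
itself. The estimate is carried out with the distance from `b` to `P` in place of the quotient norm.
-/
theorem le_norm_one_add_sub {P : ClosedIdeal A} {b c : A} (hb : b ∉ P) {s : ℝ} (hs : 0 ≤ s)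
    (hcb : c * b = (s : ℂ) • b) {p : A} (hp : p ∈ P) :
    1 + s ≤ ‖(1 : Unitization ℂ A) + (c : Unitization ℂ A) - (p : Unitization ℂ A)‖ := by
  have hne : (P : Set A).Nonempty := ⟨0, zero_mem P⟩
  set d := Metric.infDist b (P : Set A) with hd
  have hd0 : 0 < d := (P.isClosed.notMem_iff_infDist_pos hne).1 hb
  set N := ‖(1 : Unitization ℂ A) + (c : Unitization ℂ A) - (p : Unitization ℂ A)‖ with hN
  have hN0 : 0 ≤ N := norm_nonneg _
  have hs1 : ((1 + s : ℝ) : ℂ) ≠ 0 := by exact_mod_cast (by linarith : (1 + s : ℝ) ≠ 0)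
  have key : ∀ q ∈ P, (1 + s) * d ≤ N * ‖b - q‖ := by
    intro q hq
    set w := (q + c * q + p * (b - q)) with hw
    have hwP : w ∈ P := add_mem (add_mem hq (P.mul_mem_left _ hq)) (P.mul_mem_right _ hp)
    have e : ((1 : Unitization ℂ A) + (c : Unitization ℂ A) - (p : Unitization ℂ A)) *
        ((b - q : A) : Unitization ℂ A) = ((((1 + s : ℝ) : ℂ) • b - w : A) :
          Unitization ℂ A) := by
      rw [Complex.ofReal_add, add_smul, ← hcb, Complex.ofReal_one, one_smul]
      simp only [hw, Unitization.inr_sub, Unitization.inr_add, Unitization.inr_mul,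
        sub_mul, add_mul, one_mul, mul_sub]
      abel
    have h1 : (1 + s) * d ≤ ‖((1 + s : ℝ) : ℂ) • b - w‖ := by
      have hw2 : ((1 + s : ℝ) : ℂ)⁻¹ • w ∈ P := SMulMemClass.smul_mem _ hwP
      have : ((1 + s : ℝ) : ℂ) • b - w =
          ((1 + s : ℝ) : ℂ) • (b - ((1 + s : ℝ) : ℂ)⁻¹ • w) := by
        rw [smul_sub, smul_smul, mul_inv_cancel₀ hs1, one_smul]
      rw [this, norm_smul, Complex.norm_real, Real.norm_of_nonneg (by linarith), ← dist_eq_norm]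
      gcongr
      exact Metric.infDist_le_dist_of_mem hw2
    calc (1 + s) * d ≤ ‖((1 + s : ℝ) : ℂ) • b - w‖ := h1
      _ = ‖((1 : Unitization ℂ A) + (c : Unitization ℂ A) - (p : Unitization ℂ A)) *
        ((b - q : A) : Unitization ℂ A)‖ := by rw [e, Unitization.norm_inr]
      _ ≤ N * ‖((b - q : A) : Unitization ℂ A)‖ := norm_mul_le _ _
      _ = N * ‖b - q‖ := by rw [Unitization.norm_inr]
  have h3 : (1 + s) * d ≤ N * d := by
    refine le_of_forall_pos_le_add fun ε hε => ?_
    obtain ⟨q, hq, hlt⟩ := (Metric.infDist_lt_iff hne).1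
      (lt_add_of_pos_right d (show 0 < ε / (N + 1) by positivity))
    rw [dist_eq_norm] at hlt
    calc (1 + s) * d ≤ N * ‖b - q‖ := key q hq
      _ ≤ N * (d + ε / (N + 1)) := by gcongr
      _ = N * d + N / (N + 1) * ε := by ring
      _ ≤ N * d + 1 * ε := by
        gcongr
        exact (div_le_one (by positivity)).2 (by linarith)
      _ = N * d + ε := by ring
  exact le_of_mul_le_mul_right h3 hd0

/-- Closed ideals are intersections of primitive ideals. -/
theorem exists_primitive_notMem (P : ClosedIdeal A) {x : A} (hx : x ∉ P) :
    ∃ p : PrimitiveSpectrum A, P ≤ p.1 ∧ x ∉ p.1 := by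
  -- Since `g` acts as a unit on `b ∉ P`, some primitive ideal above `P` keeps distance `1` from
  -- `g`. It cannot contain `x`, because `g` lies in every closed ideal that contains `x⋆ x`.
  obtain ⟨g, b, hg, hgb, hb, -, -, hmem, -⟩ := exists_cutDown P
    (fun h => hx (ClosedIdeal.mem_of_star_mul_mem h))
  obtain ⟨p, hp, hdist⟩ := exists_primitive_dist P hg fun p hp => by
    have := le_norm_one_add_sub hb zero_le_one (by simpa using hgb) hp
    linarith
  refine ⟨p, hp, fun hxp => ?_⟩
  have := hdist g (hmem p.1 (p.1.mul_mem_left _ hxp))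
  rw [sub_self, norm_zero] at this
  linarith

theorem ClosedIdeal.le_iff_forall_primitive {I J : ClosedIdeal A} :
    I ≤ J ↔ ∀ p : PrimitiveSpectrum A, J ≤ p.1 → I ≤ p.1 := by
  refine ⟨fun h p hp => h.trans hp, fun h x hx => ?_⟩
  by_contra hxJ
  obtain ⟨p, hp, hxp⟩ := exists_primitive_notMem J hxJ
  exact hxp (h p hp hx)

end

end CStarIncl

/-! ### A Baire property of the primitive ideal space -/

namespace CStarIncl

section

variable {A : Type u} [NonUnitalCStarAlgebra A]

/-- Otherwise `b` lies in the ideal `J` of all `z` with `I z ⊆ P`, so `J` is not below `P`. But each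
`z ∈ I ⊓ J` has `z⋆ z ∈ P`, hence `I ⊓ J ≤ P`, against density. -/
theorem exists_mem_mul_notMem {P I : ClosedIdeal A} (hI : ∀ J, ¬ J ≤ P → ¬ I ⊓ J ≤ P) {b : A}
    (hb : b ∉ P) : ∃ x ∈ I, x * b ∉ P := by
  by_contra! hcon
  let J : ClosedIdeal A :=
    { carrier := {z | ∀ x ∈ I, x * z ∈ P}
      add_mem' := fun hu hv x hx => by rw [mul_add]; exact add_mem (hu x hx) (hv x hx)
      zero_mem' := fun x _ => by rw [mul_zero]; exact zero_mem P
      smul_mem' := fun c u hu x hx => by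
        rw [mul_smul_comm]; exact SMulMemClass.smul_mem c (hu x hx)
      isClosed' := by
        have : {z : A | ∀ x ∈ I, x * z ∈ P} = ⋂ x ∈ I, (x * ·) ⁻¹' (P : Set A) := by ext; simp
        rw [this]
        exact isClosed_biInter fun x _ => P.isClosed.preimage (continuous_const_mul x)
      mul_mem_left' := fun a z hz x hx => by
        rw [← mul_assoc]; exact hz _ (I.mul_mem_right a hx)
      mul_mem_right' := fun a z hz x hx => by
        rw [← mul_assoc]; exact P.mul_mem_right a (hz x hx) }
  refine hI J (fun hJ => hb (hJ hcon)) fun z hz => ?_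
  exact ClosedIdeal.mem_of_star_mul_mem (hz.2 _ (ClosedIdeal.star_mem hz.1))

/-- A Baire category property of the primitive ideal space: if the open sets that are given by the
ideals `I n` are dense in the hull of `P`, then they have a common point in this hull. -/
theorem exists_primitive_forall_not_le {P : ClosedIdeal A} (hP : P ≠ ⊤) (I : ℕ → ClosedIdeal A)
    (hI : ∀ n J, ¬ J ≤ P → ¬ I n ⊓ J ≤ P) :
    ∃ p : PrimitiveSpectrum A, P ≤ p.1 ∧ ∀ n, ¬ I n ≤ p.1 := by
  have hstep : ∀ (n : ℕ) (b : {b : A // b ∉ P ∧ IsSelfAdjoint b}),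
      ∃ (g : A) (b' : {b : A // b ∉ P ∧ IsSelfAdjoint b}), ‖g‖ ≤ 1 ∧ g * b' = b' ∧
        IsSelfAdjoint g ∧ g ∈ I n ∧
        ∀ a : A, IsSelfAdjoint a → a * b = b → a * b' = b' := by
    rintro n ⟨b, hb, hbs⟩
    obtain ⟨x, hx, hxb⟩ := exists_mem_mul_notMem (hI n) hb
    obtain ⟨g, b', hg, hgb, hb', hgs, hbs', hmem, hun⟩ := exists_cutDown P
      (fun h => hxb (ClosedIdeal.mem_of_star_mul_mem h))
    refine ⟨g, ⟨b', hb', hbs'⟩, hg, hgb, hgs,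
      hmem _ ((I n).mul_mem_left _ ((I n).mul_mem_right _ hx)), fun a ha hab => ?_⟩
    have hab' : a * b = b := hab
    have := hun a ha (by
      rw [star_mul, hbs.star_eq, mul_assoc b, ← mul_assoc a, hab'])
    change a * b' = b'
    rw [← hgb, ← mul_assoc, this]
  choose g next hg1 hgb hgs hgI hnext using hstep
  obtain ⟨x, hx⟩ : ∃ x, x ∉ P := by
    by_contra! h
    exact hP (top_le_iff.1 fun x _ => h x)
  -- Successive cut-downs take the place of shrinking neighbourhoods: each `γ k ∈ I k` acts as a
  -- unit on every later `b N`, and no `b N` lies in `P`.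
  let b : ℕ → {b : A // b ∉ P ∧ IsSelfAdjoint b} := fun n =>
    Nat.rec ⟨star x * x, fun h => hx (ClosedIdeal.mem_of_star_mul_mem h), .star_mul_self x⟩
      (fun n b => next n b) n
  let γ : ℕ → A := fun n => g n (b n)
  have hγb : ∀ n k, γ k * (b (k + 1 + n)).1 = (b (k + 1 + n)).1 := by
    intro n k
    induction n with
    | zero => exact hgb k (b k)
    | succ n ih => exact hnext _ _ _ (hgs k (b k)) ih
  have hγb' : ∀ N, ∀ k < N, γ k * (b N).1 = (b N).1 := fun N k hk => by
    obtain ⟨n, rfl⟩ := Nat.exists_eq_add_of_le (Nat.succ_le_of_lt hk)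
    exact hγb n k
  -- The weights sum to `1`, so `c = ∑ r n γ n` has norm at most `1`. Its partial sums act on `b N ∉
  -- P` as scalars tending to `1`, so `1 + c` has norm at least `2` modulo `P`.
  let r : ℕ → ℝ := fun n => 1 / 2 / 2 ^ n
  have hr0 : ∀ n, 0 < r n := fun n => by positivity
  have hr : HasSum r 1 := hasSum_geometric_two' 1
  have hbound : ∀ n, ‖(r n : ℂ) • γ n‖ ≤ r n := fun n => by
    rw [norm_smul, Complex.norm_real, Real.norm_of_nonneg (hr0 n).le]
    exact mul_le_of_le_one_right (hr0 n).le (hg1 _ _)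
  obtain ⟨c, hc⟩ : Summable fun n => (r n : ℂ) • γ n := .of_norm_bounded hr.summable hbound
  obtain ⟨p, hp, hdist⟩ := exists_primitive_dist P (c := c) (hc.norm_le_of_bounded hr hbound)
    fun p hp => by
      have h1 : ∀ N, 1 + ∑ k ∈ Finset.range N, r k ≤ ‖(1 : Unitization ℂ A) +
          ((∑ k ∈ Finset.range N, (r k : ℂ) • γ k : A) : Unitization ℂ A) -
          (p : Unitization ℂ A)‖ := fun N => by
        refine le_norm_one_add_sub (b N).2.1 (Finset.sum_nonneg fun k _ => (hr0 k).le) ?_ hp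
        rw [Complex.ofReal_sum, Finset.sum_mul, Finset.sum_smul]
        refine Finset.sum_congr rfl fun k hk => ?_
        rw [smul_mul_assoc, hγb' N k (Finset.mem_range.1 hk)]
      have h2 := (hr.tendsto_sum_nat.const_add 1)
      have h3 := (((Unitization.isometry_inr (𝕜 := ℂ) (A := A)).continuous.tendsto c).comp
        hc.tendsto_sum_nat).const_add (1 : Unitization ℂ A)
      have h4 := (h3.sub_const (p : Unitization ℂ A)).norm
      have h5 := le_of_tendsto_of_tendsto' h2 h4 h1
      linarith
  refine ⟨p, hp, fun n hn => ?_⟩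
  -- If `p` contained `I n`, it would contain `r n γ n`; but dropping this term from `c` leaves norm
  -- at most `1 - r n`, less than the distance from `c` to `p`.
  have h1 := hdist ((r n : ℂ) • γ n) (SMulMemClass.smul_mem _ (hn (hgI n (b n))))
  have h2 := hc.update n 0
  have h3 := hr.update n 0
  have h4 := h2.norm_le_of_bounded h3 fun k => by
    rcases eq_or_ne k n with rfl | hk
    · simp
    · simp only [Function.update_of_ne hk]
      exact hbound k
  have h5 : ‖c - (r n : ℂ) • γ n‖ ≤ 1 - r n := by
    have e : c - (r n : ℂ) • γ n = 0 - (r n : ℂ) • γ n + c := by abel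
    rw [e]
    linarith
  linarith [hr0 n]

end

end CStarIncl

/-! ### Rieffel induction of irreducible representations along a slice -/

namespace CStarIncl

open scoped InnerProductSpace ComplexOrder

theorem exists_sqrt_mem {B : Type*} [NonUnitalCStarAlgebra B] [PartialOrder B] [StarOrderedRing B]
    (D : NonUnitalStarSubalgebra ℂ B) (hD : IsClosed (D : Set B)) {y : B} (hy : y ∈ D)
    (hy0 : 0 ≤ y) : ∃ s ∈ D, star s = s ∧ s * s = y := by
  have := hD
  have hσ : ∀ t ∈ quasispectrum ℝ y, 0 ≤ t := fun t ht =>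
    quasispectrum_nonneg_of_nonneg y hy0 t ht
  refine ⟨cfcₙ Real.sqrt y, cfcₙ_mem (𝕜' := ℂ) (s := D) _ hy,
    (cfcₙ_predicate Real.sqrt y : IsSelfAdjoint _).star_eq, ?_⟩
  rw [← cfcₙ_mul Real.sqrt Real.sqrt y Real.continuous_sqrt.continuousOn Real.sqrt_zero
    Real.continuous_sqrt.continuousOn Real.sqrt_zero]
  nth_rw 2 [← cfcₙ_id ℝ y hy0.isSelfAdjoint]
  exact cfcₙ_congr fun t ht => Real.mul_self_sqrt (hσ t ht)

theorem exists_completion_extension {E H : Type*} [SeminormedAddCommGroup E] [NormedSpace ℂ E]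
    [NormedAddCommGroup H] [NormedSpace ℂ H] [CompleteSpace H] (f : E →L[ℂ] H) :
    ∃ g : UniformSpace.Completion E →L[ℂ] H, ∀ x : E, g x = f x :=
  ⟨f.extend UniformSpace.Completion.toComplL, fun x =>
    f.extend_eq UniformSpace.Completion.denseRange_coe
      (UniformSpace.Completion.isUniformInducing_coe E) x⟩

section Intertwiners

variable {ι Γ : Type*} {H K : Type*} [NormedAddCommGroup H] [InnerProductSpace ℂ H]
  [NormedAddCommGroup K] [InnerProductSpace ℂ K]
  (π : Γ → H →L[ℂ] H) (ρ : Γ → K →L[ℂ] K) (S : ι → K →L[ℂ] H)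

/-- The closed linear span of the images of `L` under the operators `S n`. -/
def imageSpan (L : Submodule ℂ K) : Submodule ℂ H :=
  (Submodule.span ℂ {x | ∃ n, ∃ l ∈ L, S n l = x}).topologicalClosure

variable {S π ρ}

theorem mem_imageSpan {L : Submodule ℂ K} {n : ι} {l : K} (hl : l ∈ L) :
    S n l ∈ imageSpan S L :=
  subset_closure (Submodule.subset_span ⟨n, l, hl, rfl⟩)

theorem imageSpan_le {L : Submodule ℂ K} {W : Submodule ℂ H} (hW : IsClosed (W : Set H))
    (h : ∀ n, ∀ l ∈ L, S n l ∈ W) : imageSpan S L ≤ W := by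
  refine Submodule.topologicalClosure_minimal _ (Submodule.span_le.2 ?_) hW
  rintro _ ⟨n, l, hl, rfl⟩
  exact h n l hl

theorem imageSpan_eq_bot_or_top
    (hπ : ∀ W : Submodule ℂ H, IsClosed (W : Set H) → (∀ a, ∀ x ∈ W, π a x ∈ W) → W = ⊥ ∨ W = ⊤)
    (h2 : ∀ a n, ∃ n', ∀ x, π a (S n x) = S n' x) (L : Submodule ℂ K) :
    imageSpan S L = ⊥ ∨ imageSpan S L = ⊤ := by
  refine hπ _ (Submodule.isClosed_topologicalClosure _) fun a x hx => ?_
  have : imageSpan S L ≤ (imageSpan S L).comap (π a).toLinearMap := by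
    refine imageSpan_le ((Submodule.isClosed_topologicalClosure _).preimage (π a).continuous)
      fun n l hl => ?_
    obtain ⟨n', hn'⟩ := h2 a n
    change π a (S n l) ∈ imageSpan S L
    rw [hn']
    exact mem_imageSpan hl
  exact this hx

/-- Irreducibility passes along a family of operators `S n` such that the products `S n⋆ S k` are
given by the second representation. -/
theorem irreducible_of_intertwiners [CompleteSpace H] [CompleteSpace K]
    (hπ : ∀ W : Submodule ℂ H, IsClosed (W : Set H) → (∀ a, ∀ x ∈ W, π a x ∈ W) → W = ⊥ ∨ W = ⊤)
    (h1 : ∀ n k, ∃ a, ∀ x, (S n).adjoint (S k x) = ρ a x)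
    (h2 : ∀ a n, ∃ n', ∀ x, π a (S n x) = S n' x)
    (h3 : ∀ L : Submodule ℂ K, IsClosed (L : Set K) → (∀ n x, (S n).adjoint x ∈ L) → L = ⊤)
    (L : Submodule ℂ K) (hL : IsClosed (L : Set K)) (hinv : ∀ a, ∀ x ∈ L, ρ a x ∈ L) :
    L = ⊥ ∨ L = ⊤ := by
  -- If all `S n` kill `L`, the ranges of the adjoints lie in `Lᗮ`. If the images of `L` span `H`,
  -- then `S n⋆ S k = ρ a` and invariance of `L` put these ranges into `L`. In either case `h3`
  -- concludes.
  rcases imageSpan_eq_bot_or_top hπ h2 L with h | h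
  · left
    have h4 : Lᗮ = ⊤ := h3 _ L.isClosed_orthogonal fun n x => by
      rw [Submodule.mem_orthogonal]
      intro l hl
      have h0 : S n l = 0 := by
        have := mem_imageSpan (S := S) (n := n) hl
        rwa [h, Submodule.mem_bot] at this
      rw [ContinuousLinearMap.adjoint_inner_right, h0, inner_zero_left]
    have : CompleteSpace L := hL.completeSpace_coe
    rwa [Submodule.orthogonal_eq_top_iff] at h4
  · right
    refine h3 L hL fun n x => ?_
    have : imageSpan S L ≤ L.comap (S n).adjoint.toLinearMap :=
      imageSpan_le (hL.preimage (S n).adjoint.continuous) fun k l hl => by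
        obtain ⟨a, ha⟩ := h1 n k
        change (S n).adjoint (S k l) ∈ L
        rw [ha]
        exact hinv a l hl
    exact this (h ▸ Submodule.mem_top)

end Intertwiners

namespace Slice

variable {B : Type u} [NonUnitalCStarAlgebra B] {A : NonUnitalStarSubalgebra ℂ B} {M : Slice A}

/-- The element `m⋆ a n` of `A`. -/
def sandwich {m n : B} (hm : m ∈ M) (hn : n ∈ M) : A →ₗ[ℂ] A where
  toFun a := ⟨star m * (a : B) * n, star_mul_mul_mem hm hn a.2⟩
  map_add' a b := Subtype.ext (by simp [mul_add, add_mul])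
  map_smul' c a := Subtype.ext (by simp [mul_smul_comm, smul_mul_assoc])

theorem coe_star_eq (a : A) : ((star a : A) : B) = star (a : B) := rfl

theorem coe_sandwich {m n : B} (hm : m ∈ M) (hn : n ∈ M) (a : A) :
    (sandwich hm hn a : B) = star m * (a : B) * n := rfl

section

variable {H : Type u} [NormedAddCommGroup H] [InnerProductSpace ℂ H] [CompleteSpace H]

/-- Positivity in `B` suffices for an element of `A`, because its square root already lies in `A`.
-/
theorem inner_map_nonneg [PartialOrder B] [StarOrderedRing B] (hA : IsClosed (A : Set B))
    (π : A →⋆ₙₐ[ℂ] (H →L[ℂ] H)) (ξ : H) (y : A) (hy : 0 ≤ (y : B)) : 0 ≤ ⟪ξ, π y ξ⟫_ℂ := by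
  obtain ⟨s, hsA, hs, hss⟩ := exists_sqrt_mem A hA y.2 hy
  have e : y = star ⟨s, hsA⟩ * ⟨s, hsA⟩ := Subtype.ext (by
    change (y : B) = star s * s
    rw [hs, hss])
  rw [e, map_mul, map_star, mul_apply_eq_comp, ContinuousLinearMap.star_eq_adjoint,
    ContinuousLinearMap.adjoint_inner_right, inner_self_eq_ofReal]
  exact Complex.zero_le_real.2 (sq_nonneg _)

theorem inner_map_star (π : A →⋆ₙₐ[ℂ] (H →L[ℂ] H)) (x y : H) (a : A) :
    ⟪π a x, y⟫_ℂ = ⟪x, π (star a) y⟫_ℂ := by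
  rw [map_star, ContinuousLinearMap.star_eq_adjoint, ContinuousLinearMap.adjoint_inner_right]

/-- In `B` one has `m⋆ a⋆ n n⋆ a m ≤ ‖n‖² m⋆ a⋆ a m`, and both sides lie in `A`, where the vector
functional of `ξ` is positive. The estimate bounds the operators `S n` in `exists_dualMap`. -/
theorem norm_sq_sandwich_le (hreg : IsRegularInclusion A) (π : A →⋆ₙₐ[ℂ] (H →L[ℂ] H)) (ξ : H)
    {m n : B} (hm : m ∈ M) (hn : n ∈ M) (a : A) :
    ‖π (sandwich hn hm a) ξ‖ ^ 2 ≤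
      ‖n‖ ^ 2 * (⟪ξ, π (sandwich hm hm (star a * a)) ξ⟫_ℂ).re := by
  let _ := CStarAlgebra.spectralOrder B
  have _ := CStarAlgebra.spectralOrderedRing B
  set y : A := ((‖n‖ ^ 2 : ℝ) : ℂ) • sandwich hm hm (star a * a) -
    star (sandwich hn hm a) * sandwich hn hm a with hy
  have h0 : 0 ≤ (y : B) := by
    have h1 := CStarAlgebra.star_left_conjugate_le_norm_smul (a := (a : B) * m)
      (b := n * star n) (.mul_star_self n)
    rw [CStarRing.norm_self_mul_star, ← sq, ← sub_nonneg] at h1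
    convert h1 using 1
    simp only [hy, NonUnitalStarSubalgebra.coe_sub, NonUnitalStarSubalgebra.coe_smul,
      NonUnitalStarSubalgebra.coe_mul, coe_star_eq, coe_sandwich, star_mul,
      star_star, mul_assoc, Complex.coe_smul]
  have h1 := (Complex.nonneg_iff.1 (inner_map_nonneg hreg.isClosed π ξ y h0)).1
  rw [hy, map_sub, map_smul, sub_apply, smul_apply, inner_sub_right, inner_smul_right,
    map_mul π (star (sandwich hn hm a)), mul_apply_eq_comp, ← inner_map_star,
    inner_self_eq_ofReal, Complex.sub_re, Complex.re_ofReal_mul, Complex.ofReal_re] at h1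
  linarith

end

end Slice

end CStarIncl

namespace CStarIncl

open scoped InnerProductSpace ComplexOrder

namespace Slice

variable {B : Type u} [NonUnitalCStarAlgebra B] {A : NonUnitalStarSubalgebra ℂ B} {M : Slice A}

/-- The vector functional `a ↦ ⟨ξ, π(m⋆ a m) ξ⟩` is positive. -/
theorem vectorFunctional_nonneg {H : Type u} [NormedAddCommGroup H] [InnerProductSpace ℂ H]
    [CompleteSpace H] (hA : IsClosed (A : Set B)) (π : A →⋆ₙₐ[ℂ] (H →L[ℂ] H)) (ξ : H)
    {m : B} (hm : m ∈ M) (s : A) :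
    0 ≤ ⟪ξ, π (sandwich hm hm (star s * s)) ξ⟫_ℂ := by
  let _ := CStarAlgebra.spectralOrder B
  have _ := CStarAlgebra.spectralOrderedRing B
  refine inner_map_nonneg hA π ξ _ ?_
  have e : (sandwich hm hm (star s * s) : B) = star ((s : B) * m) * ((s : B) * m) := by
    simp only [coe_sandwich, NonUnitalStarSubalgebra.coe_mul, coe_star_eq, star_mul, mul_assoc]
  rw [e]
  exact star_mul_self_nonneg _

theorem exists_mul_mul_notMem (hreg : IsRegularInclusion A) {p : PrimitiveSpectrum A} {m n : B}
    (h : star m * n ∉ p.1.inB) : ∃ e ∈ A, star m * e * n ∉ p.1.inB := by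
  by_contra! hcon
  refine h ?_
  have hcl : n ∈ closure {x : B | ∃ e ∈ A, x = e * n} := by
    rw [Metric.mem_closure_iff]
    intro ε hε
    obtain ⟨e, he, hlt⟩ := hreg.exists_approx n hε
    exact ⟨e * n, ⟨e, he, rfl⟩, by rwa [dist_eq_norm, norm_sub_rev]⟩
  have hc := isClosed_inB hreg.isClosed p.1
  have := map_mem_closure (f := fun y => star m * y) (t := (p.1.inB : Set B))
    (continuous_const_mul _) hcl (by
      rintro _ ⟨e, he, rfl⟩
      have := hcon e he
      rwa [mul_assoc] at this)
  rwa [hc.closure_eq] at this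

/-- The map that is dual to a slice is defined on the domain of the slice. -/
theorem exists_dualMap (hreg : IsRegularInclusion A) {p : PrimitiveSpectrum A}
    (hp : p ∈ M.domain hreg.isClosed) : ∃ q : PrimitiveSpectrum A, M.DualMap p q := by
  obtain ⟨k, hk, m, hm, hkm⟩ := mem_domain.1 hp
  obtain ⟨e, he, hekm⟩ := exists_mul_mul_notMem hreg hkm
  obtain ⟨H, _, _, _, π, ⟨-, hirr⟩, hker⟩ := p.2
  have hkerB : ∀ y : A, (y : B) ∈ p.1.inB ↔ π y = 0 := fun y => coe_mem_inB.trans (hker y)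
  obtain ⟨ξ, hξ⟩ : ∃ ξ, π (sandwich hk hm ⟨e, he⟩) ξ ≠ 0 := by
    by_contra! h
    exact hekm ((hkerB (sandwich hk hm ⟨e, he⟩)).2 (ContinuousLinearMap.ext h))
  have hA := hreg.isClosed
  let _ : NonUnitalCStarAlgebra A := NonUnitalStarSubalgebra.nonUnitalCStarAlgebra A
  let _ := CStarAlgebra.spectralOrder A
  have _ := CStarAlgebra.spectralOrderedRing A
  -- The induced representation lives on `M ⊗ H`. Only the cyclic subspace of `m ⊗ ξ` is built, as
  -- the GNS space of its vector functional; `v a` below stands for `a m ⊗ ξ`.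
  let ψl : A →ₗ[ℂ] ℂ :=
    { toFun := fun a => ⟪ξ, π (sandwich hm hm a) ξ⟫_ℂ
      map_add' := fun a b => by rw [map_add, map_add, add_apply, inner_add_right]
      map_smul' := fun c a => by
        rw [map_smul, map_smul, smul_apply, inner_smul_right]; rfl }
  let ψ : A →ₚ[ℂ] ℂ := PositiveLinearMap.mk₀ ψl fun a ha => by
    obtain ⟨s, rfl⟩ := CStarAlgebra.nonneg_iff_eq_star_mul_self.1 ha
    exact vectorFunctional_nonneg hA π ξ hm s
  have hψ : ∀ a, ψ a = ⟪ξ, π (sandwich hm hm a) ξ⟫_ℂ := fun _ => rfl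
  let ρ := ψ.gnsNonUnitalStarAlgHom
  let v : A → ψ.GNS := fun a => ((ψ.toPreGNS a : ψ.PreGNS) : ψ.GNS)
  have hρ : ∀ u a, ρ u (v a) = v (u * a) := fun u a => ψ.gnsNonUnitalStarAlgHom_apply_coe
  have hinner : ∀ a b : A, ⟪v a, v b⟫_ℂ = ⟪ξ, π (sandwich hm hm (star a * b)) ξ⟫_ℂ :=
    fun a b => UniformSpace.Completion.inner_coe _ _
  have hdense : ∀ L : Set ψ.GNS, IsClosed L → (∀ a, v a ∈ L) → ∀ x, x ∈ L := by
    intro L hL h x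
    induction x using UniformSpace.Completion.induction_on with
    | hp => exact hL
    | ih a => exact h (ψ.ofPreGNS a)
  -- `S n` is the operator `x ⊗ η ↦ π(n⋆ x) η`, restricted to that cyclic subspace.
  have hS : ∀ n : M, ∃ S : ψ.GNS →L[ℂ] H, ∀ a, S (v a) = π (sandwich n.2 hm a) ξ := by
    rintro ⟨n, hn⟩
    let S₀ : A →ₗ[ℂ] H :=
      { toFun := fun a => π (sandwich hn hm a) ξ
        map_add' := fun a b => by rw [map_add, map_add, add_apply]
        map_smul' := fun c a => by rw [map_smul, map_smul, smul_apply]; rfl }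
    obtain ⟨S, hS⟩ := exists_completion_extension
      ((S₀ ∘ₗ ψ.ofPreGNS.toLinearMap).mkContinuous ‖n‖ fun x => by
        rw [← sq_le_sq₀ (norm_nonneg _) (by positivity), mul_pow]
        refine (norm_sq_sandwich_le hreg π ξ hm hn (ψ.ofPreGNS x)).trans (le_of_eq ?_)
        congr 1
        have := ψ.preGNS_norm_sq x
        rw [hψ] at this
        rw [← this, ← Complex.ofReal_pow, Complex.ofReal_re])
    exact ⟨S, fun a => hS _⟩
  choose S hS using hS
  have hmulS : ∀ c (n : M) x, π c (S n x) = S ⟨n * star (c : B), right_mem n.2 (star_mem c.2)⟩ x := by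
    intro c n
    refine hdense _ (isClosed_eq ((π c).continuous.comp (S n).continuous) (S _).continuous)
      fun a => ?_
    change π c (S n (v a)) = S _ (v a)
    rw [hS, hS, ← mul_apply_eq_comp, ← map_mul]
    congr 2
    exact Subtype.ext (by
      simp only [NonUnitalStarSubalgebra.coe_mul, coe_sandwich, star_mul, star_star, mul_assoc])
  have hSρ : ∀ a (n : M) x, S n (ρ a x) = S ⟨star (a : B) * n, left_mem (star_mem a.2) n.2⟩ x := by
    intro a n
    refine hdense _ (isClosed_eq ((S n).continuous.comp (ρ a).continuous) (S _).continuous)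
      fun b => ?_
    change S n (ρ a (v b)) = S _ (v b)
    rw [hρ, hS, hS]
    congr 2
    exact Subtype.ext (by
      simp only [NonUnitalStarSubalgebra.coe_mul, coe_sandwich, star_mul, star_star, mul_assoc])
  have hTS : ∀ n k : M, ∀ x, (S n).adjoint (S k x) =
      ρ ⟨n * star (k : B), mul_star_mem hreg n.2 k.2⟩ x := by
    intro n k
    refine hdense _ (isClosed_eq ((S n).adjoint.continuous.comp (S k).continuous)
      (ρ _).continuous) fun a => ?_
    change (S n).adjoint (S k (v a)) = ρ _ (v a)
    refine ext_inner_left ℂ fun y => ?_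
    revert y
    refine hdense _ (isClosed_eq (continuous_id.inner continuous_const)
      (continuous_id.inner continuous_const)) fun b => ?_
    change ⟪v b, (S n).adjoint (S k (v a))⟫_ℂ = ⟪v b, ρ _ (v a)⟫_ℂ
    rw [ContinuousLinearMap.adjoint_inner_right, hS, hS, inner_map_star, hρ, hinner,
      ← mul_apply_eq_comp, ← map_mul]
    congr 3
    exact Subtype.ext (by
      simp only [NonUnitalStarSubalgebra.coe_mul, coe_sandwich, coe_star_eq, star_mul, star_star,
        mul_assoc])
  have hT : ∀ b : A, v b = (S ⟨b * m, left_mem b.2 hm⟩).adjoint ξ := by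
    intro b
    refine ext_inner_left ℂ fun y => ?_
    revert y
    refine hdense _ (isClosed_eq (continuous_id.inner continuous_const)
      (continuous_id.inner continuous_const)) fun a => ?_
    change ⟪v a, v b⟫_ℂ = ⟪v a, _⟫_ℂ
    rw [ContinuousLinearMap.adjoint_inner_right, hS, hinner, inner_map_star]
    congr 3
    exact Subtype.ext (by
      simp only [NonUnitalStarSubalgebra.coe_mul, coe_sandwich, coe_star_eq, star_mul, star_star,
        mul_assoc])
  -- The images of the `S n` form an invariant subspace, nonzero by the choice of `k`, `e`, `ξ`.
  -- Irreducibility of `π` thus allows `S n S n'⋆ = π(n⋆ n')` to be checked on vectors `S j l`.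
  have hW : imageSpan S (⊤ : Submodule ℂ ψ.GNS) = ⊤ := by
    refine (imageSpan_eq_bot_or_top hirr (fun c n => ⟨_, hmulS c n⟩) ⊤).resolve_left fun h => ?_
    have := mem_imageSpan (S := S) (n := ⟨k, hk⟩) (L := ⊤) (l := v ⟨e, he⟩) trivial
    rw [h, Submodule.mem_bot, hS] at this
    exact hξ this
  have hST : ∀ (n n' : M) x, S n ((S n').adjoint x) =
      π ⟨star (n : B) * n', star_mul_mem hreg n.2 n'.2⟩ x := by
    intro n n' x
    have : imageSpan S (⊤ : Submodule ℂ ψ.GNS) ≤ LinearMap.eqLocus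
        ((S n).comp (S n').adjoint).toLinearMap
        (π ⟨star (n : B) * n', star_mul_mem hreg n.2 n'.2⟩).toLinearMap := by
      refine imageSpan_le (isClosed_eq ((S n).comp (S n').adjoint).continuous
        (π ⟨star (n : B) * n', star_mul_mem hreg n.2 n'.2⟩).continuous) fun j l _ => ?_
      change S n ((S n').adjoint (S j l)) = π _ (S j l)
      rw [hTS, hSρ, hmulS]
      congr 2
      simp only [star_mul, star_star, mul_assoc]
    exact this (hW ▸ Submodule.mem_top)
  -- The kernel is read off from `S n ρ(a) S n'⋆ = π(n⋆ a n')` in one direction, and from `‖v (a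
  -- b)‖² = ⟨ξ, π(m⋆ b⋆ a⋆ a b m) ξ⟩` in the other.
  have hq : ∀ a : A, ρ a = 0 ↔ ∀ n ∈ M, ∀ n' ∈ M, star n * (a : B) * n' ∈ p.1.inB := by
    intro a
    constructor
    · intro h n hn n' hn'
      refine (hkerB (sandwich hn hn' a)).2 (ContinuousLinearMap.ext fun x => ?_)
      have h1 := hSρ a ⟨n, hn⟩ ((S ⟨n', hn'⟩).adjoint x)
      rw [h, hST] at h1
      simp only [zero_apply, map_zero] at h1
      rw [zero_apply, h1]
      congr 2
      exact Subtype.ext (by simp only [coe_sandwich, star_mul, star_star])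
    · intro h
      refine ContinuousLinearMap.ext fun x => ?_
      revert x
      refine hdense _ (isClosed_eq (ρ a).continuous continuous_const) fun b => ?_
      change ρ a (v b) = 0
      refine inner_self_eq_zero (𝕜 := ℂ).1 ?_
      rw [hρ, hinner]
      have h1 : π (sandwich hm hm (star (a * b) * (a * b))) = 0 := by
        refine (hkerB _).1 ?_
        have := h _ (left_mem (mul_mem a.2 b.2) hm) _ (left_mem b.2 hm)
        simpa only [NonUnitalStarSubalgebra.coe_mul, coe_sandwich, coe_star_eq, star_mul,
          mul_assoc] using this
      rw [h1, zero_apply, inner_zero_right]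
  refine ⟨⟨kerIdeal ρ, ψ.GNS, inferInstance, inferInstance, inferInstance, ρ, ⟨?_, ?_⟩,
    fun a => Iff.rfl⟩, hq⟩
  · by_contra! h
    exact hekm ((hq ⟨e, he⟩).1 (h _) k hk m hm)
  · refine irreducible_of_intertwiners hirr (fun n k => ⟨_, hTS n k⟩)
      (fun c n => ⟨_, hmulS c n⟩) fun L hL h => Submodule.eq_top_iff'.2 ?_
    exact hdense _ hL fun b => hT b ▸ h _ _

end Slice

end CStarIncl

namespace CStarIncl

variable {B : Type u} [NonUnitalCStarAlgebra B] {A : NonUnitalStarSubalgebra ℂ B}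

open Slice

/-! ### Approximation by elements of an ideal of the subalgebra -/

/-- A closed ideal of `A`, as a C⋆-subalgebra of `B`. -/
def ClosedIdeal.starSubalgebraInB (hA : IsClosed (A : Set B)) (I : ClosedIdeal A) :
    NonUnitalStarSubalgebra ℂ B where
  toSubmodule := I.inB
  mul_mem' {a b} ha hb := by
    obtain ⟨a, -, rfl⟩ := ha
    exact inB_left a.2 hb
  star_mem' {a} ha := by
    obtain ⟨a, ha, rfl⟩ := ha
    let _ : NonUnitalCStarAlgebra A :=
      have := hA; NonUnitalStarSubalgebra.nonUnitalCStarAlgebra A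
    exact ⟨star a, ClosedIdeal.star_mem ha, rfl⟩

theorem ClosedIdeal.isClosed_starSubalgebraInB (hA : IsClosed (A : Set B)) (I : ClosedIdeal A) :
    IsClosed (I.starSubalgebraInB hA : Set B) := isClosed_inB hA I

theorem ClosedIdeal.star_mem_inB (hA : IsClosed (A : Set B)) {I : ClosedIdeal A} {x : B}
    (hx : x ∈ I.inB) : star x ∈ I.inB := (I.starSubalgebraInB hA).star_mem' hx

theorem ClosedIdeal.mem_of_forall_inB_mul_mem (hA : IsClosed (A : Set B)) {I : ClosedIdeal A}
    {x : B} (hx : x * star x ∈ I.inB) {K : Set B} (hK : IsClosed K)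
    (h : ∀ e ∈ I.inB, e * x ∈ K) : x ∈ K :=
  CStarIncl.mem_of_forall_mul_mem (I.starSubalgebraInB hA) (I.isClosed_starSubalgebraInB hA) hx
    hK h

theorem coe_subset (I : ClosedIdeal A) {x : B} (hx : x ∈ I.inB) : x ∈ A := by
  obtain ⟨x, -, rfl⟩ := hx
  exact x.2

/-- The closed linear span of `I B`. -/
def rightSpan (I : ClosedIdeal A) : Submodule ℂ B :=
  (Submodule.span ℂ {x : B | ∃ a ∈ I.inB, ∃ c : B, x = a * c}).topologicalClosure

theorem isClosed_rightSpan (I : ClosedIdeal A) : IsClosed (rightSpan I : Set B) :=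
  Submodule.isClosed_topologicalClosure _

theorem mul_mem_rightSpan {I : ClosedIdeal A} {a : B} (ha : a ∈ I.inB) (c : B) :
    a * c ∈ rightSpan I :=
  subset_closure (Submodule.subset_span ⟨a, ha, c, rfl⟩)

theorem rightSpan_le {I : ClosedIdeal A} {K : Submodule ℂ B} (hK : IsClosed (K : Set B))
    (h : ∀ a ∈ I.inB, ∀ c, a * c ∈ K) : rightSpan I ≤ K := by
  refine Submodule.topologicalClosure_minimal _ (Submodule.span_le.2 ?_) hK
  rintro _ ⟨a, ha, c, rfl⟩
  exact h a ha c

theorem mul_right_mem_rightSpan {I : ClosedIdeal A} {x : B} (hx : x ∈ rightSpan I) (c : B) :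
    x * c ∈ rightSpan I := by
  have : rightSpan I ≤ (rightSpan I).comap (LinearMap.mulRight ℂ c) :=
    rightSpan_le ((isClosed_rightSpan I).preimage (continuous_mul_const c)) fun a ha d => by
      change a * d * c ∈ rightSpan I
      rw [mul_assoc]
      exact mul_mem_rightSpan ha _
  exact this hx

/-- An approximate unit of `I` is contractive, so its convergence on products `a c` with `a ∈ I`
extends to their closed span. -/
theorem exists_norm_mul_sub_lt (hA : IsClosed (A : Set B)) {I : ClosedIdeal A} {x : B}
    (hx : x ∈ rightSpan I) {ε : ℝ} (hε : 0 < ε) : ∃ e ∈ I.inB, ‖e * x - x‖ < ε := by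
  set D := I.starSubalgebraInB hA
  have : IsClosed (D : Set B) := I.isClosed_starSubalgebraInB hA
  let _ : NonUnitalCStarAlgebra D := NonUnitalStarSubalgebra.nonUnitalCStarAlgebra D
  let _ := CStarAlgebra.spectralOrder D
  have _ := CStarAlgebra.spectralOrderedRing D
  have hl := CStarAlgebra.increasingApproximateUnit D
  obtain ⟨s, hs, hxs⟩ := Metric.mem_closure_iff.1 hx (ε / 3) (by positivity)
  have ht : Tendsto (fun e : D => (e : B) * s) (CStarAlgebra.approximateUnit D) (𝓝 s) := by
    refine Submodule.span_induction
      (p := fun s _ => Tendsto (fun e : D => (e : B) * s) _ (𝓝 s)) ?_ ?_ ?_ ?_ hs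
    · rintro _ ⟨a, ha, b, rfl⟩
      have h1 := hl.tendsto_mul_right ⟨a, ha⟩
      have h2 := ((continuous_subtype_val.tendsto _).comp h1).mul_const b
      simpa [Function.comp_def, mul_assoc] using h2
    · simp
    · intro y z _ _ hy hz
      simpa [mul_add] using hy.add hz
    · intro c y _ hy
      simpa [mul_smul_comm] using hy.const_smul c
  have hev := (Metric.tendsto_nhds.1 ht (ε / 3) (by positivity)).and hl.eventually_norm
  obtain ⟨e, he, hen⟩ := hev.exists
  refine ⟨e, e.2, ?_⟩
  rw [dist_eq_norm] at hxs he
  have hen' : ‖(e : B)‖ ≤ 1 := hen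
  have hxs' : ‖s - x‖ < ε / 3 := by rwa [norm_sub_rev]
  calc ‖(e : B) * x - x‖ = ‖(e : B) * (x - s) + ((e : B) * s - s) + (s - x)‖ := by
        congr 1; rw [mul_sub]; abel
    _ ≤ ‖(e : B) * (x - s)‖ + ‖(e : B) * s - s‖ + ‖s - x‖ := norm_add₃_le
    _ ≤ 1 * ‖x - s‖ + ‖(e : B) * s - s‖ + ‖s - x‖ := by
        gcongr
        exact (norm_mul_le _ _).trans (by gcongr)
    _ < ε := by linarith

theorem mem_of_mem_rightSpan (hA : IsClosed (A : Set B)) {I : ClosedIdeal A} {x : B}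
    (hx : x ∈ rightSpan I) {K : Set B} (hK : IsClosed K) (h : ∀ e ∈ I.inB, e * x ∈ K) :
    x ∈ K := by
  rw [← hK.closure_eq, Metric.mem_closure_iff]
  intro ε hε
  obtain ⟨e, he, hlt⟩ := exists_norm_mul_sub_lt hA hx hε
  exact ⟨_, h e he, by rwa [dist_comm, dist_eq_norm]⟩

/-! ### Induction and restriction -/

theorem mul_mul_mem_induce {I : ClosedIdeal A} {a : B} (ha : a ∈ I.inB) (b c : B) :
    b * a * c ∈ induce A I := by
  obtain ⟨a, ha, rfl⟩ := ha
  exact subset_closure (Submodule.subset_span ⟨b, c, a, ha, rfl⟩)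

theorem induce_le_submodule {I : ClosedIdeal A} {K : Submodule ℂ B} (hK : IsClosed (K : Set B))
    (h : ∀ a ∈ I.inB, ∀ b c, b * a * c ∈ K) {x : B} (hx : x ∈ induce A I) : x ∈ K := by
  refine Submodule.topologicalClosure_minimal _ (Submodule.span_le.2 ?_) hK hx
  rintro _ ⟨b, c, a, ha, rfl⟩
  exact h a ⟨a, ha, rfl⟩ b c

/-- Generators of `i(I)` need a factor on each side, so `x` is approximated by products `f e x` with
`e, f ∈ I`, where `e` plays the middle role. -/
theorem inB_subset_induce (hA : IsClosed (A : Set B)) {I : ClosedIdeal A} {x : B}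
    (hx : x ∈ I.inB) : x ∈ induce A I := by
  have h1 : ∀ e ∈ I.inB, e * x * star (e * x) ∈ I.inB := fun e he =>
    inB_right (star_mem (mul_mem (coe_subset I he) (coe_subset I hx)))
      (inB_right (coe_subset I hx) he)
  refine ClosedIdeal.mem_of_forall_inB_mul_mem hA (inB_right (star_mem (coe_subset I hx)) hx)
    (induce A I).isClosed fun e he => ?_
  refine ClosedIdeal.mem_of_forall_inB_mul_mem hA (h1 e he) (induce A I).isClosed fun f _ => ?_
  rw [← mul_assoc]
  exact mul_mul_mem_induce he f x

theorem induce_le_iff (hA : IsClosed (A : Set B)) {I : ClosedIdeal A} {J : ClosedIdeal B} :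
    induce A I ≤ J ↔ I ≤ restrict A J := by
  refine ⟨fun h x hx => h (inB_subset_induce hA ⟨x, hx, rfl⟩), fun h x hx => ?_⟩
  refine induce_le_submodule (K := J.toSubmodule) J.isClosed (fun a ha b c => ?_) hx
  obtain ⟨a, ha, rfl⟩ := ha
  exact J.mul_mem_right c (J.mul_mem_left b (h ha))

theorem galoisConnection_induce_restrict (hA : IsClosed (A : Set B)) :
    GaloisConnection (induce A) (restrict A) := fun _ _ => induce_le_iff hA

/-! ### Invariant ideals -/

variable (A) in
/-- Ideals of `A` that are invariant under conjugation with normalisers. -/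
def IsInvariant (I : ClosedIdeal A) : Prop :=
  ∀ b ∈ normalisers A, ∀ x ∈ I.inB, star b * x * b ∈ I.inB

theorem star_mem_normalisers {b : B} (hb : b ∈ normalisers A) : star b ∈ normalisers A :=
  ⟨fun a ha => by simpa using hb.2 a ha, fun a ha => by simpa using hb.1 a ha⟩

theorem IsRestricted.isInvariant {I : ClosedIdeal A} (hI : IsRestricted A I) :
    IsInvariant A I := by
  obtain ⟨J, rfl⟩ := hI
  rintro b hb _ ⟨x, hx, rfl⟩
  refine ⟨⟨_, hb.2 x x.2⟩, ?_, rfl⟩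
  exact J.mul_mem_right b (J.mul_mem_left _ hx)

/-- For a normaliser `b` and `a ∈ I`, invariance puts `(ba)(ba)⋆` into `I`, so `ba` is a limit of
elements of `I b a`. The `b` that preserve the closed span of `I B`, together with their adjoints,
form a C⋆-subalgebra; as it contains the generators, it is `B`. -/
theorem IsInvariant.mul_mem_rightSpan (hreg : IsRegularInclusion A) {I : ClosedIdeal A}
    (hI : IsInvariant A I) {x : B} (hx : x ∈ rightSpan I) (b : B) : b * x ∈ rightSpan I := by
  have hA := hreg.isClosed
  have hN : ∀ b ∈ normalisers A, ∀ x ∈ rightSpan I, b * x ∈ rightSpan I := by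
    intro b hb x hx
    have : rightSpan I ≤ (rightSpan I).comap (LinearMap.mulLeft ℂ b) :=
      rightSpan_le ((isClosed_rightSpan I).preimage (continuous_const_mul b)) fun a ha d => by
        change b * (a * d) ∈ rightSpan I
        rw [← mul_assoc]
        refine mul_right_mem_rightSpan ?_ d
        refine ClosedIdeal.mem_of_forall_inB_mul_mem hA (I := I) ?_ (isClosed_rightSpan I)
          fun e he => CStarIncl.mul_mem_rightSpan he _
        have := hI _ (star_mem_normalisers hb) _ (inB_right (star_mem (coe_subset I ha)) ha)
        simpa [mul_assoc] using this
    exact this hx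
  let S : NonUnitalStarSubalgebra ℂ B :=
    { carrier := {b | (∀ x ∈ rightSpan I, b * x ∈ rightSpan I) ∧
        ∀ x ∈ rightSpan I, star b * x ∈ rightSpan I}
      add_mem' := fun hu hv => ⟨fun x hx => by
          rw [add_mul]; exact add_mem (hu.1 x hx) (hv.1 x hx), fun x hx => by
          rw [star_add, add_mul]; exact add_mem (hu.2 x hx) (hv.2 x hx)⟩
      zero_mem' := ⟨fun x _ => by rw [zero_mul]; exact zero_mem _, fun x _ => by
          rw [star_zero, zero_mul]; exact zero_mem _⟩
      mul_mem' := fun hu hv => ⟨fun x hx => by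
          rw [mul_assoc]; exact hu.1 _ (hv.1 x hx), fun x hx => by
          rw [star_mul, mul_assoc]; exact hv.2 _ (hu.2 x hx)⟩
      smul_mem' := fun c u hu => ⟨fun x hx => by
          rw [smul_mul_assoc]; exact Submodule.smul_mem _ c (hu.1 x hx), fun x hx => by
          rw [star_smul, smul_mul_assoc]; exact Submodule.smul_mem _ _ (hu.2 x hx)⟩
      star_mem' := fun hu => ⟨hu.2, fun x hx => by rw [star_star]; exact hu.1 x hx⟩ }
  have hS : IsClosed (S : Set B) := by
    have : (S : Set B) = ⋂ x ∈ rightSpan I,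
        {b | b * x ∈ rightSpan I} ∩ {b | star b * x ∈ rightSpan I} := by
      ext b
      simp only [Set.mem_iInter, Set.mem_inter_iff, Set.mem_ofPred_eq]
      exact ⟨fun h x hx => ⟨h.1 x hx, h.2 x hx⟩,
        fun h => ⟨fun x hx => (h x hx).1, fun x hx => (h x hx).2⟩⟩
    rw [this]
    refine isClosed_biInter fun x _ => IsClosed.inter ?_ ?_
    · exact (isClosed_rightSpan I).preimage (continuous_mul_const x)
    · exact (isClosed_rightSpan I).preimage ((continuous_mul_const x).comp continuous_star)
  have hle : (NonUnitalStarAlgebra.adjoin ℂ (normalisers A)).topologicalClosure ≤ S := by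
    refine NonUnitalStarSubalgebra.topologicalClosure_minimal _
      (NonUnitalStarAlgebra.adjoin_le fun b hb => ?_) hS
    exact ⟨hN b hb, hN _ (star_mem_normalisers hb)⟩
  rw [hreg.generates] at hle
  exact (hle (x := b) trivial).1 x hx

theorem IsInvariant.mem_rightSpan_of_mem_induce (hreg : IsRegularInclusion A)
    {I : ClosedIdeal A} (hI : IsInvariant A I) {x : B} (hx : x ∈ induce A I) :
    x ∈ rightSpan I :=
  induce_le_submodule (isClosed_rightSpan I) (fun a ha b c => by
    rw [mul_assoc]
    exact hI.mul_mem_rightSpan hreg (CStarIncl.mul_mem_rightSpan ha c) b) hx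

/-- An element `x` of `A` in the closed span of `I B` is a limit of elements `e x` with `e ∈ I`, all
of which lie in `I`. -/
theorem IsInvariant.restrict_induce (hreg : IsRegularInclusion A) {I : ClosedIdeal A}
    (hI : IsInvariant A I) : restrict A (induce A I) = I := by
  refine le_antisymm (fun x hx => ?_) ((induce_le_iff hreg.isClosed).1 le_rfl)
  refine coe_mem_inB.1 (mem_of_mem_rightSpan hreg.isClosed
    (hI.mem_rightSpan_of_mem_induce hreg hx) (isClosed_inB hreg.isClosed I)
    fun e he => inB_right x.2 he)

theorem isRestricted_iff (hreg : IsRegularInclusion A) {I : ClosedIdeal A} :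
    IsRestricted A I ↔ IsInvariant A I :=
  ⟨fun h => h.isInvariant, fun h => ⟨_, h.restrict_induce hreg⟩⟩

/-- An element `z` of `i(I)` is a limit of elements `e z` with `e ∈ I`. If `z` is replaced by a
generator `b a c` of `i(J)`, then `e b` is a limit of elements `e b f⋆` with `f ∈ I`, by taking
adjoints in the closed span of `I B`, and `f⋆ a ∈ I ∩ J`. -/
theorem IsInvariant.induce_inf_le (hreg : IsRegularInclusion A) {I : ClosedIdeal A}
    (hI : IsInvariant A I) (J : ClosedIdeal A) :
    induce A I ⊓ induce A J ≤ induce A (I ⊓ J) := by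
  have hA := hreg.isClosed
  have hcl := (induce A (I ⊓ J)).isClosed
  intro z hz
  refine mem_of_mem_rightSpan hA (hI.mem_rightSpan_of_mem_induce hreg hz.1) hcl fun e he => ?_
  refine induce_le_submodule
    (K := (induce A (I ⊓ J)).toSubmodule.comap (LinearMap.mulLeft ℂ e))
    (hcl.preimage (continuous_const_mul e)) (fun a ha b c => ?_) hz.2
  change e * (b * a * c) ∈ induce A (I ⊓ J)
  have hw : star (e * b) ∈ rightSpan I := by
    rw [star_mul]
    refine hI.mem_rightSpan_of_mem_induce hreg ((induce A I).mul_mem_left _ ?_)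
    exact inB_subset_induce hA (ClosedIdeal.star_mem_inB hA he)
  have hK : IsClosed {w : B | star w * (a * c) ∈ induce A (I ⊓ J)} :=
    hcl.preimage ((continuous_mul_const (a * c)).comp continuous_star)
  have := mem_of_mem_rightSpan hA hw hK fun f hf => by
    change star (f * star (e * b)) * (a * c) ∈ induce A (I ⊓ J)
    have h1 : star f * a ∈ (I ⊓ J).inB := by
      obtain ⟨f', hf', hff⟩ := ClosedIdeal.star_mem_inB hA hf
      obtain ⟨a', ha', rfl⟩ := ha
      exact ⟨f' * a', ⟨I.mul_mem_right _ hf', J.mul_mem_left _ ha'⟩, by rw [← hff]; rfl⟩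
    have h2 := mul_mul_mem_induce h1 (e * b) c
    simpa [mul_assoc] using h2
  have h3 : star (star (e * b)) * (a * c) ∈ induce A (I ⊓ J) := this
  simpa [mul_assoc] using h3

theorem inf_restrict_induce (hreg : IsRegularInclusion A) {I : ClosedIdeal A}
    (hI : IsInvariant A I) (J : ClosedIdeal A) :
    I ⊓ restrict A (induce A J) = restrict A (induce A (I ⊓ J)) := by
  have gc := galoisConnection_induce_restrict hreg.isClosed
  refine le_antisymm (fun z hz => ?_) (le_inf ?_ ?_)
  · exact hI.induce_inf_le hreg J ⟨inB_subset_induce hreg.isClosed ⟨z, hz.1, rfl⟩, hz.2⟩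
  · conv_rhs => rw [← hI.restrict_induce hreg]
    exact gc.monotone_u (gc.monotone_l inf_le_left)
  · exact gc.monotone_u (gc.monotone_l inf_le_right)

theorem induce_top (hreg : IsRegularInclusion A) : induce A ⊤ = ⊤ := by
  have hA := hreg.isClosed
  refine top_le_iff.1 fun x _ => ?_
  refine closure_minimal (s := {y | ∃ e ∈ A, y = e * x}) ?_ (induce A ⊤).isClosed ?_
  · rintro _ ⟨e, he, rfl⟩
    exact (induce A ⊤).mul_mem_right x
      (inB_subset_induce hA ⟨⟨e, he⟩, ClosedIdeal.mem_top _, rfl⟩)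
  · rw [Metric.mem_closure_iff]
    intro ε hε
    obtain ⟨e, he, hlt⟩ := hreg.exists_approx x hε
    exact ⟨e * x, ⟨e, he, rfl⟩, by rwa [dist_comm, dist_eq_norm]⟩

theorem IsInduced.inf (hreg : IsRegularInclusion A) {J₁ J₂ : ClosedIdeal B}
    (h₁ : IsInduced A J₁) (h₂ : IsInduced A J₂) : IsInduced A (J₁ ⊓ J₂) := by
  have gc := galoisConnection_induce_restrict hreg.isClosed
  obtain ⟨I₁, rfl⟩ := h₁
  obtain ⟨I₂, rfl⟩ := h₂
  refine ⟨restrict A (induce A I₁ ⊓ induce A I₂), le_antisymm (gc.l_u_le _) ?_⟩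
  -- Since `i r i = i`, both ideals may be replaced by their restricted hulls, and then
  -- `induce_inf_le` applies.
  have hinv : IsInvariant A (restrict A (induce A I₁)) :=
    IsRestricted.isInvariant ⟨_, rfl⟩
  have := hinv.induce_inf_le hreg (restrict A (induce A I₂))
  rw [gc.l_u_l_eq_l, gc.l_u_l_eq_l] at this
  exact this

theorem isInduced_sInf (hreg : IsRegularInclusion A) {S : Set (ClosedIdeal B)} (hS : S.Finite)
    (h : ∀ J ∈ S, IsInduced A J) : IsInduced A (sInf S) := by
  induction S, hS using Set.Finite.induction_on with
  | empty => exact ⟨⊤, by rw [induce_top hreg, sInf_empty]⟩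
  | insert _ _ ih =>
    rw [sInf_insert]
    exact (h _ (Set.mem_insert _ _)).inf hreg (ih fun J hJ => h J (Set.mem_insert_of_mem _ hJ))

/-! ### Joins of restricted ideals -/

theorem mem_closure_mul_mul (hreg : IsRegularInclusion A) (b : B) :
    b ∈ closure {y | ∃ a ∈ A, ∃ c ∈ A, y = a * b * c} := by
  have hl : ∀ x : B, x ∈ closure {y | ∃ e ∈ A, y = e * x} := fun x => by
    rw [Metric.mem_closure_iff]
    intro ε hε
    obtain ⟨e, he, hlt⟩ := hreg.exists_approx x hε
    exact ⟨e * x, ⟨e, he, rfl⟩, by rwa [dist_comm, dist_eq_norm]⟩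
  refine closure_minimal ?_ isClosed_closure (hl b)
  rintro _ ⟨a, ha, rfl⟩
  have := map_mem_closure continuous_star (hl (star (a * b)))
    (t := {y | ∃ a ∈ A, ∃ c ∈ A, y = a * b * c}) (by
      rintro _ ⟨e, he, rfl⟩
      exact ⟨a, ha, star e, star_mem he, by rw [star_mul, star_star]⟩)
  rwa [star_star] at this

theorem quasiOrbitSpaceExists (hreg : IsRegularInclusion A) : QuasiOrbitSpaceExists A := by
  intro S hS
  have hA := hreg.isClosed
  rw [isRestricted_iff hreg]
  have hcl := isClosed_inB hA (sSup S)
  intro b hb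
  -- The condition `b⋆ x b ∈ sSup S` alone need not define an ideal in `x`; with factors from `A`
  -- around `x` it does, and this ideal contains every member of `S`. Nondegeneracy removes the
  -- factors at the end.
  let T : ClosedIdeal A :=
    { carrier := {x | ∀ a ∈ A, ∀ c ∈ A, star b * (a * (x : B) * c) * b ∈ (sSup S).inB}
      add_mem' := fun {u v} hu hv a ha c hc => by
        have := add_mem (hu a ha c hc) (hv a ha c hc)
        simpa [mul_add, add_mul] using this
      zero_mem' := fun a _ c _ => by
        simp
      smul_mem' := fun r u hu a ha c hc => by
        have := Submodule.smul_mem _ r (hu a ha c hc)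
        simpa [mul_smul_comm, smul_mul_assoc] using this
      isClosed' := by
        have : {x : A | ∀ a ∈ A, ∀ c ∈ A, star b * (a * (x : B) * c) * b ∈ (sSup S).inB} =
            ⋂ a ∈ A, ⋂ c ∈ A, (fun x : A => star b * (a * (x : B) * c) * b) ⁻¹'
              ((sSup S).inB : Set B) := by ext; simp
        rw [this]
        exact isClosed_biInter fun a _ => isClosed_biInter fun c _ => hcl.preimage (by fun_prop)
      mul_mem_left' := fun d x hx a ha c hc => by
        have := hx (a * d) (mul_mem ha d.2) c hc
        simpa [mul_assoc] using this
      mul_mem_right' := fun d x hx a ha c hc => by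
        have := hx a ha (d * c) (mul_mem d.2 hc)
        simpa [mul_assoc] using this }
  have hST : sSup S ≤ T := sSup_le fun I hI x hx a ha c hc => by
    have h1 := (hS I hI).isInvariant b hb _
      (inB_right hc (inB_left ha ((coe_mem_inB (a := x)).2 hx)))
    obtain ⟨y, hy, hyx⟩ := h1
    exact ⟨y, le_sSup hI hy, hyx⟩
  rintro _ ⟨x, hx, rfl⟩
  have := map_mem_closure (f := fun y => star b * y * b) (t := ((sSup S).inB : Set B))
    (by fun_prop) (mem_closure_mul_mul hreg (x : B)) (by
      rintro _ ⟨a, ha, c, hc, rfl⟩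
      exact hST hx a ha c hc)
  rwa [hcl.closure_eq] at this

end CStarIncl

namespace CStarIncl

open Slice

/-! ### Topology of spaces of primitive and of prime elements -/

section Topology

variable {A : Type u} [NonUnitalNormedRing A] [NormedSpace ℂ A] [StarRing A]

theorem isTopologicalBasis_primitiveSpectrum : TopologicalSpace.IsTopologicalBasis
    (Set.range fun I : ClosedIdeal A => {p : PrimitiveSpectrum A | ¬ I ≤ p.1}) where
  exists_subset_inter := by
    rintro _ ⟨I, rfl⟩ _ ⟨J, rfl⟩ p ⟨hI, hJ⟩
    exact ⟨_, ⟨I ⊓ J, rfl⟩, fun h => (p.2.le_or_le h).elim hI hJ,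
      fun q hq => ⟨fun h => hq (inf_le_left.trans h), fun h => hq (inf_le_right.trans h)⟩⟩
  sUnion_eq := by
    refine Set.eq_univ_of_forall fun p => ⟨_, ⟨⊤, rfl⟩, fun h => ?_⟩
    obtain ⟨x, hx⟩ := p.2.exists_notMem
    exact hx (h (ClosedIdeal.mem_top x))
  eq_generateFrom := rfl

theorem isOpen_primitiveSpectrum_iff {U : Set (PrimitiveSpectrum A)} :
    IsOpen U ↔ ∃ I : ClosedIdeal A, U = {p | ¬ I ≤ p.1} := by
  constructor
  · intro hU
    obtain ⟨S, hS, rfl⟩ := isTopologicalBasis_primitiveSpectrum.open_eq_sUnion hU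
    refine ⟨sSup {I | {p : PrimitiveSpectrum A | ¬ I ≤ p.1} ∈ S}, ?_⟩
    ext p
    simp only [Set.mem_sUnion, Set.mem_ofPred_eq, sSup_le_iff, not_forall]
    constructor
    · rintro ⟨V, hV, hp⟩
      obtain ⟨I, rfl⟩ := hS hV
      exact ⟨I, hV, hp⟩
    · rintro ⟨I, hV, hp⟩
      exact ⟨_, hV, hp⟩
  · rintro ⟨I, rfl⟩
    exact TopologicalSpace.isOpen_generateFrom_of_mem ⟨I, rfl⟩

theorem mem_closure_primitiveSpectrum_iff {S : Set (PrimitiveSpectrum A)}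
    {p : PrimitiveSpectrum A} : p ∈ closure S ↔ ⨅ q ∈ S, q.1 ≤ p.1 := by
  rw [isTopologicalBasis_primitiveSpectrum.mem_closure_iff]
  constructor
  · intro h
    by_contra hp
    obtain ⟨q, hq, hqS⟩ := h _ ⟨_, rfl⟩ hp
    exact hq (iInf₂_le q hqS)
  · rintro h _ ⟨I, rfl⟩ hI
    by_contra hne
    refine hI (le_trans (le_iInf₂ fun q hq => ?_) h)
    by_contra hIq
    exact hne ⟨q, hIq, hq⟩

theorem iInf_closure_primitiveSpectrum (S : Set (PrimitiveSpectrum A)) :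
    ⨅ q ∈ closure S, q.1 = ⨅ q ∈ S, q.1 :=
  le_antisymm (le_iInf₂ fun q hq => iInf₂_le q (subset_closure hq))
    (le_iInf₂ fun _ hq => mem_closure_primitiveSpectrum_iff.1 hq)

theorem closure_eq_closure_iff {S T : Set (PrimitiveSpectrum A)} :
    closure S = closure T ↔ ⨅ q ∈ S, q.1 = ⨅ q ∈ T, q.1 := by
  refine ⟨fun h => ?_, fun h => ?_⟩
  · rw [← iInf_closure_primitiveSpectrum S, h, iInf_closure_primitiveSpectrum]
  · ext p
    rw [mem_closure_primitiveSpectrum_iff, mem_closure_primitiveSpectrum_iff, h]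

theorem isTopologicalBasis_primeSpace (L : Type u) [SemilatticeInf L] [OrderTop L] :
    TopologicalSpace.IsTopologicalBasis
      (Set.range fun I : L => {p : PrimeSpace L | ¬ I ≤ p.1}) where
  exists_subset_inter := by
    rintro _ ⟨I, rfl⟩ _ ⟨J, rfl⟩ p ⟨hI, hJ⟩
    exact ⟨_, ⟨I ⊓ J, rfl⟩, fun h => (p.2.2 h).elim hI hJ,
      fun q hq => ⟨fun h => hq (inf_le_left.trans h), fun h => hq (inf_le_right.trans h)⟩⟩
  sUnion_eq := by
    refine Set.eq_univ_of_forall fun p => ⟨_, ⟨⊤, rfl⟩, fun h => p.2.1 ?_⟩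
    rw [top_le_iff.1 h]
    exact isMax_top
  eq_generateFrom := rfl

end Topology

variable {B : Type u} [NonUnitalCStarAlgebra B] {A : NonUnitalStarSubalgebra ℂ B}

/-! ### Slices generated by normalisers -/

/-- The closed linear span of `A b A`, for a normaliser `b`. -/
def Slice.ofNormaliser (hA : IsClosed (A : Set B)) {b : B} (hb : b ∈ normalisers A) :
    Slice A where
  toSubmodule :=
    (Submodule.span ℂ {x : B | ∃ a ∈ A, ∃ c ∈ A, x = a * b * c}).topologicalClosure
  isClosed' := Submodule.isClosed_topologicalClosure _
  normalises := by
    have h1 : ∀ x ∈ Submodule.span ℂ {x : B | ∃ a ∈ A, ∃ c ∈ A, x = a * b * c},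
        ∀ y ∈ Submodule.span ℂ {x : B | ∃ a ∈ A, ∃ c ∈ A, x = a * b * c}, ∀ d ∈ A,
          x * d * star y ∈ A ∧ star x * d * y ∈ A := by
      intro x hx y hy d hd
      induction hx, hy using Submodule.span_induction₂ with
      | mem_mem x y hx hy =>
        obtain ⟨a, ha, c, hc, rfl⟩ := hx
        obtain ⟨a', ha', c', hc', rfl⟩ := hy
        have e1 := mul_mem (mul_mem ha (hb.1 _ (mul_mem (mul_mem hc hd) (star_mem hc'))))
          (star_mem ha')
        have e2 := mul_mem (mul_mem (star_mem hc) (hb.2 _ (mul_mem (mul_mem (star_mem ha) hd) ha')))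
          hc'
        simp only [star_mul, mul_assoc] at *
        exact ⟨e1, e2⟩
      | zero_left y hy => simp
      | zero_right x hx => simp
      | add_left x y z _ _ _ h1 h2 =>
        simp only [star_add, add_mul]
        exact ⟨add_mem h1.1 h2.1, add_mem h1.2 h2.2⟩
      | add_right x y z _ _ _ h1 h2 =>
        simp only [star_add, mul_add]
        exact ⟨add_mem h1.1 h2.1, add_mem h1.2 h2.2⟩
      | smul_left r x y _ _ h =>
        simp only [star_smul, smul_mul_assoc]
        exact ⟨SMulMemClass.smul_mem _ h.1, SMulMemClass.smul_mem _ h.2⟩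
      | smul_right r x y _ _ h =>
        simp only [star_smul, mul_smul_comm]
        exact ⟨SMulMemClass.smul_mem _ h.1, SMulMemClass.smul_mem _ h.2⟩
    intro x hx
    refine ⟨fun a ha => ?_, fun a ha => ?_⟩
    · have := map_mem_closure (f := fun y => y * a * star y) (t := (A : Set B))
        (by fun_prop) hx fun y hy => (h1 y hy y hy a ha).1
      rwa [hA.closure_eq] at this
    · have := map_mem_closure (f := fun y => star y * a * y) (t := (A : Set B))
        (by fun_prop) hx fun y hy => (h1 y hy y hy a ha).2
      rwa [hA.closure_eq] at this
  mul_mem_left' {a x} ha hx := by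
    refine map_mem_closure (continuous_const_mul a) hx fun y hy => ?_
    refine Submodule.span_induction (p := fun y _ => a * y ∈ Submodule.span ℂ _) ?_ ?_ ?_ ?_ hy
    · rintro _ ⟨m, hm, n, hn, rfl⟩
      exact Submodule.subset_span ⟨a * m, mul_mem ha hm, n, hn, by simp only [mul_assoc]⟩
    · simp
    · intro y z _ _ hy hz
      rw [mul_add]; exact add_mem hy hz
    · intro c y _ hy
      rw [mul_smul_comm]; exact Submodule.smul_mem _ c hy
  mul_mem_right' {a x} ha hx := by
    refine map_mem_closure (f := fun y => y * a) (continuous_mul_const a) hx fun y hy => ?_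
    refine Submodule.span_induction (p := fun y _ => y * a ∈ Submodule.span ℂ _) ?_ ?_ ?_ ?_ hy
    · rintro _ ⟨m, hm, n, hn, rfl⟩
      exact Submodule.subset_span ⟨m, hm, n * a, mul_mem hn ha, by simp only [mul_assoc]⟩
    · simp
    · intro y z _ _ hy hz
      rw [add_mul]; exact add_mem hy hz
    · intro c y _ hy
      rw [smul_mul_assoc]; exact Submodule.smul_mem _ c hy

theorem Slice.mem_ofNormaliser (hreg : IsRegularInclusion A) {b : B} (hb : b ∈ normalisers A) :
    b ∈ Slice.ofNormaliser hreg.isClosed hb :=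
  closure_mono (fun _ hx => Submodule.subset_span hx) (mem_closure_mul_mul hreg b)

/-! ### Orbits of the dual groupoid -/

theorem mem_groupoidOrbit_iff (hreg : IsRegularInclusion A) {p q : PrimitiveSpectrum A} :
    q ∈ groupoidOrbit (dualGroupoid hreg) p ↔
      ∃ M : Slice A, p ∈ M.domain hreg.isClosed ∧ M.DualMap p q := by
  constructor
  · rintro ⟨f⟩
    obtain ⟨M, -⟩ := Quotient.exists_rep f
    exact ⟨M.1, M.2⟩
  · rintro ⟨M, hM⟩
    exact ⟨Quotient.mk _ ⟨M, hM⟩⟩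

theorem self_mem_groupoidOrbit (hreg : IsRegularInclusion A) (p : PrimitiveSpectrum A) :
    p ∈ groupoidOrbit (dualGroupoid hreg) p :=
  (mem_groupoidOrbit_iff hreg).2 ⟨Slice.unit hreg.isClosed, domain_unit p, dualMap_unit p⟩

theorem groupoidOrbit_eq {X : Type u} (G : CategoryTheory.Groupoid.{u} X) {x y : X}
    (h : y ∈ groupoidOrbit G x) : groupoidOrbit G y = groupoidOrbit G x := by
  obtain ⟨f⟩ := h
  ext z
  exact ⟨fun ⟨g⟩ => ⟨G.comp f g⟩, fun ⟨g⟩ => ⟨G.comp (G.inv f) g⟩⟩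

/-- Outside the domain `m⋆ m ∈ p`, so `m⋆` is a limit of elements `e m⋆` with `e ∈ p`, and `e (m⋆ a
n) ∈ p`. Slices not defined at `p` thus impose no condition in `forall_orbit_mem_iff`. -/
theorem star_mul_mul_mem_of_notMem_domain (hreg : IsRegularInclusion A) {M : Slice A}
    {p : PrimitiveSpectrum A} (hp : p ∉ M.domain hreg.isClosed) {m n : B} (hm : m ∈ M)
    (hn : n ∈ M) {a : B} (ha : a ∈ A) : star m * a * n ∈ p.1.inB := by
  have h : star m * m ∈ p.1.inB := by
    by_contra h
    exact hp (mem_domain.2 ⟨m, hm, m, hm, h⟩)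
  have hK : IsClosed {x : B | x * (a * n) ∈ p.1.inB} :=
    (isClosed_inB hreg.isClosed p.1).preimage (continuous_mul_const _)
  have := ClosedIdeal.mem_of_forall_inB_mul_mem hreg.isClosed (x := star m) (I := p.1)
    (by simpa using h) hK fun e he => by
      change e * star m * (a * n) ∈ p.1.inB
      have := inB_right (star_mul_mul_mem hm hn ha) he
      simpa [mul_assoc] using this
  have h2 : star m * (a * n) ∈ p.1.inB := this
  rwa [← mul_assoc] at h2

/-- This removes the groupoid from the orbit intersection. A slice defined at `p` has a dual image
by `exists_dualMap`, which is a point of the orbit; the other slices give nothing. -/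
theorem forall_orbit_mem_iff (hreg : IsRegularInclusion A) {p : PrimitiveSpectrum A} {a : A} :
    (∀ q ∈ groupoidOrbit (dualGroupoid hreg) p, a ∈ q.1) ↔
      ∀ M : Slice A, ∀ m ∈ M, ∀ n ∈ M, star m * (a : B) * n ∈ p.1.inB := by
  constructor
  · intro h M m hm n hn
    by_cases hp : p ∈ M.domain hreg.isClosed
    · obtain ⟨q, hq⟩ := exists_dualMap hreg hp
      exact (hq a).1 (h q ((mem_groupoidOrbit_iff hreg).2 ⟨M, hp, hq⟩)) m hm n hn
    · exact star_mul_mul_mem_of_notMem_domain hreg hp hm hn a.2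
  · intro h q hq
    obtain ⟨M, -, hM⟩ := (mem_groupoidOrbit_iff hreg).1 hq
    exact (hM a).2 (h M)

theorem mem_biInf_iff {S : Set (PrimitiveSpectrum A)} {a : A} :
    a ∈ ⨅ q ∈ S, q.1 ↔ ∀ q ∈ S, a ∈ q.1 := by
  constructor
  · exact fun h q hq => (show ⨅ q ∈ S, q.1 ≤ q.1 from iInf₂_le q hq) h
  · intro h
    rw [← sInf_image]
    refine ClosedIdeal.mem_sInf.2 ?_
    rintro _ ⟨q, hq, rfl⟩
    exact h q hq

/-- The intersection of an orbit of primitive ideals is restricted. -/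
theorem isRestricted_iInf_orbit (hreg : IsRegularInclusion A) (p : PrimitiveSpectrum A) :
    IsRestricted A (⨅ q ∈ groupoidOrbit (dualGroupoid hreg) p, q.1) := by
  rw [isRestricted_iff hreg]
  rintro b hb _ ⟨x, hx, rfl⟩
  refine ⟨⟨_, hb.2 x x.2⟩, ?_, rfl⟩
  rw [mem_biInf_iff, forall_orbit_mem_iff] at hx ⊢
  intro M m hm n hn
  have hbV := Slice.mem_ofNormaliser hreg hb
  -- Conjugation by `b` is absorbed into the slice: `b m` and `b n` belong to the product of the
  -- slice generated by `b` with `M`.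
  have := hx ((Slice.ofNormaliser hreg.isClosed hb).mul hreg.isClosed M) _
    (mul_mem_mul hreg.isClosed hbV hm) _ (mul_mem_mul hreg.isClosed hbV hn)
  simpa [mul_assoc] using this

theorem le_iInf_orbit (hreg : IsRegularInclusion A) {p : PrimitiveSpectrum A}
    {I : ClosedIdeal A} (hI : IsRestricted A I) (hIp : I ≤ p.1) :
    I ≤ ⨅ q ∈ groupoidOrbit (dualGroupoid hreg) p, q.1 := by
  obtain ⟨J, rfl⟩ := hI
  intro x hx
  rw [mem_biInf_iff, forall_orbit_mem_iff]
  intro M m hm n hn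
  refine ⟨⟨_, star_mul_mul_mem hm hn x.2⟩, hIp ?_, rfl⟩
  exact J.mul_mem_right n (J.mul_mem_left _ hx)

theorem quasiOrbitProj_eq_iInf_orbit (hreg : IsRegularInclusion A)
    (h : QuasiOrbitSpaceExists A) (p : PrimitiveSpectrum A) :
    (quasiOrbitProj h p).1.1 = ⨅ q ∈ groupoidOrbit (dualGroupoid hreg) p, q.1 :=
  le_antisymm (sSup_le fun _ hI => le_iInf_orbit hreg hI.1 hI.2)
    (le_sSup ⟨isRestricted_iInf_orbit hreg p, iInf₂_le p (self_mem_groupoidOrbit hreg p)⟩)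

theorem quasiOrbitProj_eq_iff (hreg : IsRegularInclusion A) (h : QuasiOrbitSpaceExists A)
    {p q : PrimitiveSpectrum A} : quasiOrbitProj h p = quasiOrbitProj h q ↔
      closure (groupoidOrbit (dualGroupoid hreg) p) =
        closure (groupoidOrbit (dualGroupoid hreg) q) := by
  rw [closure_eq_closure_iff, ← quasiOrbitProj_eq_iInf_orbit hreg h,
    ← quasiOrbitProj_eq_iInf_orbit hreg h]
  exact ⟨fun e => by rw [e], fun e => Subtype.ext (Subtype.ext e)⟩

theorem le_quasiOrbitProj_iff (h : QuasiOrbitSpaceExists A) {I : RestrictedIdeal A}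
    {p : PrimitiveSpectrum A} : I ≤ (quasiOrbitProj h p).1 ↔ I.1 ≤ p.1 :=
  ⟨fun hI => le_trans (show I.1 ≤ (quasiOrbitProj h p).1.1 from hI)
      (sSup_le fun _ hJ => hJ.2),
    fun hI => le_sSup (α := ClosedIdeal A) ⟨I.2, hI⟩⟩

end CStarIncl

/-! ### Countability of the space of prime restricted ideals -/

namespace CStarIncl

open Slice

/-- The `I n` describe a countable neighbourhood basis at `P`. A prime `Q > P` in all these sets
would lie in the neighbourhood `{R | ¬ Q ≤ R}` of `P`, which excludes `Q` itself. -/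
theorem exists_seq_of_firstCountable {L : Type u} [SemilatticeInf L] [OrderTop L]
    [FirstCountableTopology (PrimeSpace L)] (P : PrimeSpace L) :
    ∃ I : ℕ → L, (∀ n, ¬ I n ≤ P.1) ∧
      ∀ Q : PrimeSpace L, P.1 ≤ Q.1 → (∀ n, ¬ I n ≤ Q.1) → Q = P := by
  obtain ⟨t, ht, htb⟩ :=
    (((isTopologicalBasis_primeSpace L).nhds_hasBasis (a := P))).exists_antitone_subbasis
  choose I hI using fun n => (ht n).1
  refine ⟨I, fun n => ?_, fun Q hPQ hQ => ?_⟩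
  · have := (ht n).2
    rw [← hI n] at this
    exact this
  · refine Subtype.ext (le_antisymm ?_ hPQ)
    by_contra hne
    have hopen : {R : PrimeSpace L | ¬ Q.1 ≤ R.1} ∈ 𝓝 P :=
      ((isTopologicalBasis_primeSpace L).isOpen ⟨Q.1, rfl⟩).mem_nhds hne
    obtain ⟨n, -, hn⟩ := htb.toHasBasis.mem_iff.1 hopen
    have hmem : Q ∈ t n := by
      rw [← hI n]
      exact hQ n
    exact hn hmem le_rfl

variable {B : Type u} [NonUnitalCStarAlgebra B] {A : NonUnitalStarSubalgebra ℂ B}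

noncomputable instance : OrderTop (RestrictedIdeal A) where
  top := ⟨⊤, ⊤, rfl⟩
  le_top I := le_top (α := ClosedIdeal A) (a := I.1)

theorem ClosedIdeal.le_iff_forall_primitive_of_isClosed (hA : IsClosed (A : Set B))
    {I J : ClosedIdeal A} : I ≤ J ↔ ∀ p : PrimitiveSpectrum A, J ≤ p.1 → I ≤ p.1 :=
  have := hA
  let _ : NonUnitalCStarAlgebra A := NonUnitalStarSubalgebra.nonUnitalCStarAlgebra A
  ClosedIdeal.le_iff_forall_primitive

theorem RestrictedIdeal.isInvariant (I : RestrictedIdeal A) : IsInvariant A I.1 :=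
  I.2.isInvariant

variable (A) in
/-- The smallest restricted ideal that contains a given ideal. -/
def restrictedHull (J : ClosedIdeal A) : RestrictedIdeal A := ⟨restrict A (induce A J), _, rfl⟩

theorem restrictedHull_le_iff (hreg : IsRegularInclusion A) {J : ClosedIdeal A}
    {I : RestrictedIdeal A} : restrictedHull A J ≤ I ↔ J ≤ I.1 := by
  have gc := galoisConnection_induce_restrict hreg.isClosed
  refine ⟨fun h => (gc.le_u_l J).trans h, fun h => ?_⟩
  change restrict A (induce A J) ≤ I.1
  rw [← I.isInvariant.restrict_induce hreg]
  exact gc.monotone_u (gc.monotone_l h)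

/-- If the primitive ideal space of `A` is second countable, then so is the space of prime
restricted ideals. -/
theorem secondCountable_restrictedPrime (hreg : IsRegularInclusion A)
    [SecondCountableTopology (PrimitiveSpectrum A)] :
    SecondCountableTopology (RestrictedPrime A) := by
  have hA := hreg.isClosed
  obtain ⟨b, hbc, -, hb⟩ := TopologicalSpace.exists_countable_basis (PrimitiveSpectrum A)
  -- The value of `J` off the countable basis is immaterial.
  have hJ : ∀ U : Set (PrimitiveSpectrum A), ∃ J : ClosedIdeal A, U ∈ b → U = {p | ¬ J ≤ p.1} := by
    intro U
    by_cases hU : U ∈ b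
    · obtain ⟨J, h⟩ := isOpen_primitiveSpectrum_iff.1 (hb.isOpen hU)
      exact ⟨J, fun _ => h⟩
    · exact ⟨⊤, fun h => absurd h hU⟩
  choose J hJ using hJ
  refine TopologicalSpace.IsTopologicalBasis.secondCountableTopology
    (b := (fun U => {P : RestrictedPrime A | ¬ restrictedHull A (J U) ≤ P.1}) '' b) ?_
    (hbc.image _)
  refine TopologicalSpace.isTopologicalBasis_of_isOpen_of_nhds ?_ fun P V hP hV => ?_
  · rintro _ ⟨U, -, rfl⟩
    exact TopologicalSpace.isOpen_generateFrom_of_mem ⟨_, rfl⟩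
  obtain ⟨_, ⟨I, rfl⟩, hIP, hIV⟩ :=
    (isTopologicalBasis_primeSpace (RestrictedIdeal A)).exists_subset_of_mem_open hP hV
  -- The open set of `I` is a union of basic sets `U`, so `I` is below the join of their ideals.
  -- Hence some `J U` is not below `P`; its restricted hull lies below `I` and gives the required
  -- neighbourhood.
  have hle : I.1 ≤ sSup (J '' {U ∈ b | U ⊆ {p | ¬ I.1 ≤ p.1}}) := by
    rw [ClosedIdeal.le_iff_forall_primitive_of_isClosed hA]
    intro p hp
    by_contra hIp
    have hopen : IsOpen {p : PrimitiveSpectrum A | ¬ I.1 ≤ p.1} :=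
      isOpen_primitiveSpectrum_iff.2 ⟨I.1, rfl⟩
    obtain ⟨U, hU, hpU, hUI⟩ := hb.exists_subset_of_mem_open (a := p) hIp hopen
    have hpU' := hpU
    rw [hJ U hU] at hpU'
    have hle : J U ≤ sSup (J '' {U ∈ b | U ⊆ {p | ¬ I.1 ≤ p.1}}) :=
      le_sSup ⟨U, ⟨hU, hUI⟩, rfl⟩
    exact hpU' (hle.trans hp)
  obtain ⟨U, ⟨hU, hUI⟩, hUP⟩ : ∃ U ∈ {U ∈ b | U ⊆ {p | ¬ I.1 ≤ p.1}}, ¬ J U ≤ P.1.1 := by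
    by_contra! h
    refine hIP (show I.1 ≤ P.1.1 from hle.trans (sSup_le ?_))
    rintro _ ⟨U, hU, rfl⟩
    exact h U hU
  refine ⟨_, ⟨U, hU, rfl⟩, fun h => hUP ((restrictedHull_le_iff hreg).1 h),
    fun Q hQ => hIV fun h => hQ (le_trans ((restrictedHull_le_iff hreg).2 ?_) h)⟩
  rw [ClosedIdeal.le_iff_forall_primitive_of_isClosed hA]
  intro p hp
  by_contra hJp
  have : p ∈ U := by rw [hJ U hU]; exact hJp
  exact hUI this hp

/-! ### The quasi-orbit map -/

theorem quasiOrbitMapExists (hreg : IsRegularInclusion A) : QuasiOrbitMapExists A where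
  joins_restricted := quasiOrbitSpaceExists hreg
  inf_restrict_induce _ J hI := inf_restrict_induce hreg hI.isInvariant J
  meets_induced _ hS h := isInduced_sInf hreg hS h

theorem continuous_quasiOrbitProj (h : QuasiOrbitSpaceExists A) :
    Continuous (quasiOrbitProj h) := by
  refine continuous_generateFrom_iff.2 ?_
  rintro _ ⟨I, rfl⟩
  refine isOpen_primitiveSpectrum_iff.2 ⟨I.1, ?_⟩
  ext p
  exact not_congr (le_quasiOrbitProj_iff h)

theorem RestrictedPrime.ne_top (P : RestrictedPrime A) : P.1.1 ≠ ⊤ := fun h =>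
  P.2.1 fun _ _ => (le_top.trans_eq h.symm : _ ≤ P.1.1)

/-- Since `I n ∩ r(i(J)) = r(i(I n ∩ J))`, primeness of `P` among restricted ideals implies the
density condition for arbitrary ideals `J` of `A`. The Baire property then gives `p` above `P`
containing no `I n`, so `π(p) = P`. -/
theorem surjective_quasiOrbitProj (hreg : IsRegularInclusion A) (h : QuasiOrbitSpaceExists A)
    [FirstCountableTopology (RestrictedPrime A)] : Function.Surjective (quasiOrbitProj h) := by
  intro P
  obtain ⟨I, hI, hP⟩ := exists_seq_of_firstCountable P
  have hA := hreg.isClosed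
  let _ : NonUnitalCStarAlgebra A := NonUnitalStarSubalgebra.nonUnitalCStarAlgebra A
  obtain ⟨p, hPp, hp⟩ := exists_primitive_forall_not_le P.ne_top (fun n => (I n).1)
    fun n J hJ hle => by
      have h1 := (restrictedHull_le_iff hreg (I := P.1)).2 hle
      have h2 : I n ⊓ restrictedHull A J ≤ P.1 := by
        refine le_trans (le_of_eq (Subtype.ext ?_)) h1
        exact inf_restrict_induce hreg (I n).isInvariant J
      exact (P.2.2 h2).elim (hI n) fun h3 => hJ ((restrictedHull_le_iff hreg).1 h3)
  exact ⟨p, hP _ ((le_quasiOrbitProj_iff h).2 hPp) fun n hn =>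
    hp n ((le_quasiOrbitProj_iff h).1 hn)⟩

theorem isOpenMap_quasiOrbitProj (hreg : IsRegularInclusion A) (h : QuasiOrbitSpaceExists A)
    [FirstCountableTopology (RestrictedPrime A)] : IsOpenMap (quasiOrbitProj h) := by
  refine isTopologicalBasis_primitiveSpectrum.isOpenMap_iff.2 ?_
  rintro _ ⟨J, rfl⟩
  have : quasiOrbitProj h '' {p | ¬ J ≤ p.1} =
      {P : RestrictedPrime A | ¬ restrictedHull A J ≤ P.1} := by
    ext P
    constructor
    · rintro ⟨p, hp, rfl⟩ hle
      exact hp (((galoisConnection_induce_restrict hreg.isClosed).le_u_l J).trans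
        ((le_quasiOrbitProj_iff h).1 hle))
    · intro hP
      -- The chosen preimage `p` may contain `J`, but then some other point `q` of its orbit does
      -- not, and `π(q) = π(p)`.
      obtain ⟨p, rfl⟩ := surjective_quasiOrbitProj hreg h P
      by_contra hne
      refine hP ((restrictedHull_le_iff hreg).2 ?_)
      rw [quasiOrbitProj_eq_iInf_orbit hreg h]
      refine le_iInf₂ fun q hq => ?_
      by_contra hJq
      refine hne ⟨q, hJq, ?_⟩
      rw [quasiOrbitProj_eq_iff hreg h, groupoidOrbit_eq _ hq]
  rw [this]
  exact TopologicalSpace.isOpen_generateFrom_of_mem ⟨_, rfl⟩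

/-! ### Restriction of primitive ideals of the ambient algebra -/

/-- The restriction of a primitive ideal, as a prime restricted ideal. -/
def restrictPrimitive (hreg : IsRegularInclusion A) (P : PrimitiveSpectrum B) :
    RestrictedPrime A :=
  ⟨⟨restrict A P.1, P.1, rfl⟩, by
    refine ⟨fun hmax => ?_, fun I J hIJ => ?_⟩
    · obtain ⟨x, hx⟩ := P.2.exists_notMem
      have h1 : (⊤ : ClosedIdeal A) ≤ restrict A P.1 := hmax (b := ⊤) le_top
      have h2 := (induce_le_iff hreg.isClosed).2 h1
      rw [induce_top hreg] at h2
      exact hx (h2 (ClosedIdeal.mem_top x))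
    · have h1 : induce A (I.1 ⊓ J.1) ≤ P.1 := (induce_le_iff hreg.isClosed).2 hIJ
      exact (P.2.le_or_le ((I.isInvariant.induce_inf_le hreg J.1).trans h1)).imp
        (induce_le_iff hreg.isClosed).1 (induce_le_iff hreg.isClosed).1⟩

theorem le_restrictPrimitive_iff (hreg : IsRegularInclusion A) {I : RestrictedIdeal A}
    {P : PrimitiveSpectrum B} : I ≤ (restrictPrimitive hreg P).1 ↔ induce A I.1 ≤ P.1 :=
  (induce_le_iff hreg.isClosed).symm

theorem continuous_restrictPrimitive (hreg : IsRegularInclusion A) :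
    Continuous (restrictPrimitive hreg) := by
  refine continuous_generateFrom_iff.2 ?_
  rintro _ ⟨I, rfl⟩
  refine isOpen_primitiveSpectrum_iff.2 ⟨induce A I.1, ?_⟩
  ext p
  exact not_congr (le_restrictPrimitive_iff hreg)

/-- Both ideals have the same restriction, because `r i r = r`. -/
theorem SeparatesIdeals.induce_restrict (hreg : IsRegularInclusion A) (h : SeparatesIdeals A)
    (J : ClosedIdeal B) : induce A (restrict A J) = J :=
  h ((galoisConnection_induce_restrict hreg.isClosed).u_l_u_eq_u J)

theorem SeparatesIdeals.restrict_le_iff (hreg : IsRegularInclusion A) (h : SeparatesIdeals A)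
    {J J' : ClosedIdeal B} : restrict A J ≤ restrict A J' ↔ J ≤ J' := by
  rw [← induce_le_iff hreg.isClosed, h.induce_restrict hreg]

/-- The Baire argument is repeated in `B` with `i(P)` and the ideals `i(I n)`. Separation of ideals
transfers primeness of `P` to all ideals `J` of `B`, since `J ≤ i(P)` can be tested on restrictions.
-/
theorem SeparatesIdeals.surjective_restrictPrimitive (hreg : IsRegularInclusion A)
    [FirstCountableTopology (RestrictedPrime A)] (h : SeparatesIdeals A) :
    Function.Surjective (restrictPrimitive hreg) := by
  intro P
  obtain ⟨I, hI, hP⟩ := exists_seq_of_firstCountable P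
  have hri : ∀ I : RestrictedIdeal A, restrict A (induce A I.1) = I.1 :=
    fun I => I.isInvariant.restrict_induce hreg
  have hne : induce A P.1.1 ≠ ⊤ := fun htop => P.ne_top <| by
    rw [← hri, htop]
    rfl
  obtain ⟨Q, hPQ, hQ⟩ := exists_primitive_forall_not_le hne (fun n => induce A (I n).1)
    fun n J hJ hle => by
      have h2 : I n ⊓ ⟨restrict A J, J, rfl⟩ ≤ P.1 := by
        have h3 := (galoisConnection_induce_restrict hreg.isClosed).monotone_u hle
        rw [hri] at h3
        refine le_trans (b := restrict A (induce A (I n).1 ⊓ J)) (fun x hx => ?_) h3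
        exact ⟨inB_subset_induce hreg.isClosed ⟨x, hx.1, rfl⟩, hx.2⟩
      refine (P.2.2 h2).elim (hI n) fun h3 => hJ ?_
      rw [← h.restrict_le_iff hreg, hri]
      exact h3
  exact ⟨Q, hP _ ((le_restrictPrimitive_iff hreg).2 hPQ) fun n hn =>
    hQ n ((le_restrictPrimitive_iff hreg).1 hn)⟩

theorem SeparatesIdeals.isHomeomorph_restrictPrimitive (hreg : IsRegularInclusion A)
    [FirstCountableTopology (RestrictedPrime A)] (h : SeparatesIdeals A) :
    IsHomeomorph (restrictPrimitive hreg) := by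
  have hsurj := h.surjective_restrictPrimitive hreg
  refine ⟨continuous_restrictPrimitive hreg, ?_, fun P Q hPQ => ?_, hsurj⟩
  · refine isTopologicalBasis_primitiveSpectrum.isOpenMap_iff.2 ?_
    rintro _ ⟨J, rfl⟩
    have : restrictPrimitive hreg '' {p | ¬ J ≤ p.1} =
        {P : RestrictedPrime A | ¬ (⟨restrict A J, J, rfl⟩ : RestrictedIdeal A) ≤ P.1} := by
      ext P
      obtain ⟨Q, rfl⟩ := hsurj P
      constructor
      · rintro ⟨p, hp, hpQ⟩ hle
        rw [← hpQ] at hle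
        exact hp ((h.restrict_le_iff hreg).1 hle)
      · exact fun hQ => ⟨Q, fun hJ => hQ ((h.restrict_le_iff hreg).2 hJ), rfl⟩
    rw [this]
    exact TopologicalSpace.isOpen_generateFrom_of_mem ⟨_, rfl⟩
  · exact Subtype.ext (h (congrArg (fun R : RestrictedPrime A => R.1.1) hPQ))

/-- If `i(r(J))` were smaller than `J`, some primitive `Q` would contain the first but not the
second. Openness gives a restricted `I` with `i(I)` not below `Q`, whose open set lies in the image
of `{Q | ¬ J ≤ Q}`. By injectivity every primitive ideal above `J` contains `i(I)`, so `i(I) ≤ J`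
and then `i(I) ≤ i(r(J)) ≤ Q`, a contradiction. -/
theorem separatesIdeals_of_isHomeomorph (hreg : IsRegularInclusion A)
    (h : IsHomeomorph (restrictPrimitive hreg)) : SeparatesIdeals A := by
  have gc := galoisConnection_induce_restrict hreg.isClosed
  have key : ∀ J : ClosedIdeal B, induce A (restrict A J) = J := by
    intro J
    refine le_antisymm (gc.l_u_le J) (ClosedIdeal.le_iff_forall_primitive.2 fun Q hQ => ?_)
    by_contra hJQ
    have hopen := h.isOpenMap _ (isOpen_primitiveSpectrum_iff.2 ⟨J, rfl⟩)
    obtain ⟨_, ⟨I, rfl⟩, hIQ, hIV⟩ :=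
      (isTopologicalBasis_primeSpace (RestrictedIdeal A)).exists_subset_of_mem_open
        (Set.mem_image_of_mem (restrictPrimitive hreg) (show Q ∈ {Q | ¬ J ≤ Q.1} from hJQ)) hopen
    have hIJ : induce A I.1 ≤ J := ClosedIdeal.le_iff_forall_primitive.2 fun R hR => by
      by_contra hIR
      obtain ⟨R', hR', hRR'⟩ := hIV (show restrictPrimitive hreg R ∈ _ from
        fun hle => hIR ((le_restrictPrimitive_iff hreg).1 hle))
      rw [h.injective hRR'] at hR'
      exact hR' hR
    exact hIQ ((le_restrictPrimitive_iff hreg).2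
      ((gc.monotone_l ((induce_le_iff hreg.isClosed).1 hIJ)).trans hQ))
  intro J₁ J₂ hJ
  rw [← key J₁, ← key J₂, hJ]

end CStarIncl

theorem theorem6p17 {B : Type u} [NonUnitalCStarAlgebra B] (A : NonUnitalStarSubalgebra ℂ B)
    (hreg : CStarIncl.IsRegularInclusion A) :
    ∃ h : CStarIncl.QuasiOrbitSpaceExists A,
      CStarIncl.quasiOrbitRel h = CStarIncl.groupoidQuasiOrbitRel (CStarIncl.dualGroupoid hreg) ∧
      (∀ p₁ p₂ : CStarIncl.PrimitiveSpectrum A, (CStarIncl.quasiOrbitRel h).r p₁ p₂ ↔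
        closure (CStarIncl.groupoidOrbit (CStarIncl.dualGroupoid hreg) p₁) =
          closure (CStarIncl.groupoidOrbit (CStarIncl.dualGroupoid hreg) p₂)) ∧
      (SecondCountableTopology (CStarIncl.PrimitiveSpectrum A) →
        FirstCountableTopology (CStarIncl.RestrictedPrime A)) ∧
      (FirstCountableTopology (CStarIncl.RestrictedPrime A) →
        CStarIncl.QuasiOrbitMapExists A ∧
        Continuous (CStarIncl.quasiOrbitProj h) ∧
        IsOpenMap (CStarIncl.quasiOrbitProj h) ∧
        Function.Surjective (CStarIncl.quasiOrbitProj h) ∧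
        (∀ p : CStarIncl.PrimitiveSpectrum A, (CStarIncl.quasiOrbitProj h p).1.1 =
          ⨅ p' ∈ closure (CStarIncl.groupoidOrbit (CStarIncl.dualGroupoid hreg) p), p'.1) ∧
        ∃ πt : CStarIncl.QuasiOrbitSpace h ≃ₜ CStarIncl.RestrictedPrime A,
          (∀ p : CStarIncl.PrimitiveSpectrum A,
            πt (Quotient.mk (CStarIncl.quasiOrbitRel h) p) = CStarIncl.quasiOrbitProj h p) ∧
          ∃ ϱ : CStarIncl.PrimitiveSpectrum B → CStarIncl.QuasiOrbitSpace h,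
            Continuous ϱ ∧
            (∀ P : CStarIncl.PrimitiveSpectrum B, (πt (ϱ P)).1.1 = CStarIncl.restrict A P.1) ∧
            (IsHomeomorph ϱ ↔ CStarIncl.SeparatesIdeals A)) := by
  have h := CStarIncl.quasiOrbitSpaceExists hreg
  have hrel : ∀ p₁ p₂ : CStarIncl.PrimitiveSpectrum A, (CStarIncl.quasiOrbitRel h).r p₁ p₂ ↔
      closure (CStarIncl.groupoidOrbit (CStarIncl.dualGroupoid hreg) p₁) =
        closure (CStarIncl.groupoidOrbit (CStarIncl.dualGroupoid hreg) p₂) :=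
    fun _ _ => CStarIncl.quasiOrbitProj_eq_iff hreg h
  refine ⟨h, Setoid.ext hrel, hrel, fun _ => ?_, fun _ => ?_⟩
  · have := CStarIncl.secondCountable_restrictedPrime hreg
    infer_instance
  have hcont := CStarIncl.continuous_quasiOrbitProj h
  have hopen := CStarIncl.isOpenMap_quasiOrbitProj hreg h
  have hsurj := CStarIncl.surjective_quasiOrbitProj hreg h
  refine ⟨CStarIncl.quasiOrbitMapExists hreg, hcont, hopen, hsurj, fun p => ?_, ?_⟩
  · rw [CStarIncl.iInf_closure_primitiveSpectrum]
    exact CStarIncl.quasiOrbitProj_eq_iInf_orbit hreg h p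
  let πt : CStarIncl.QuasiOrbitSpace h ≃ₜ CStarIncl.RestrictedPrime A :=
    Topology.IsQuotientMap.homeomorph (f := ⟨CStarIncl.quasiOrbitProj h, hcont⟩)
      (hopen.isQuotientMap hcont hsurj)
  refine ⟨πt, fun p => rfl, πt.symm ∘ CStarIncl.restrictPrimitive hreg,
    πt.symm.continuous.comp (CStarIncl.continuous_restrictPrimitive hreg), fun P => ?_,
    fun hϱ => ?_, fun hsep => ?_⟩
  · rw [Function.comp_apply, πt.apply_symm_apply]
    rfl
  · refine CStarIncl.separatesIdeals_of_isHomeomorph hreg ?_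
    have := πt.isHomeomorph.comp hϱ
    rwa [← Function.comp_assoc, πt.self_comp_symm, Function.id_comp] at this
  · exact πt.symm.isHomeomorph.comp (hsep.isHomeomorph_restrictPrimitive hreg)
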